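/- Let $\mathcal A$ be an abelian category with enough injectives and small coproducts, in which small coproducts of injective objects are injective. Let $\Phi:\mathcal A\to\mathcal A$ be an autoequivalence and $w:\mathrm{Id}_{\mathcal A}\to\Phi$ a natural transformation with $w_{\Phi(A)}=\Phi(w_A)$ for all $A$. A *factorization* of $w$ is $E=(E^{-1},E^0,\varphi^{-1},\varphi^0)$ with $\varphi^{0}:E^{-1}\to E^0$, $\varphi^{-1}:\Phi^{-1}(E^0)\to E^{-1}$ in $\mathcal A$ such that $\varphi^0\circ\varphi^{-1}=\Phi^{-1}(w_{E^0})$ and $\Phi(\varphi^{-1})\circ\varphi^0=w_{E^{-1}}$ (identifying $\Phi^{-1}\Phi$ and $\Phi\Phi^{-1}$ with $\mathrm{Id}$). Morphisms are pairs $(g^{-1},g^0)$ commuting with the $\varphi$'s; this gives an abelian category $\mathrm{Fact}(w)$. The shift is $E[1]=(E^0,\Phi(E^{-1}),-\varphi^0,-\Phi(\varphi^{-1}))$, with entries in the order $(E^{-1},E^0,\varphi^{-1},\varphi^0)$. Let $K(\mathrm{Fact}\,w)$ be the homotopy category of factorizations, triangulated by $[1]$ and the usual mapping cones. A factorization is *totally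 acyclic* if it lies in the smallest thick subcategory of $K(\mathrm{Fact}\,w)$ containing the totalizations of all bounded exact complexes of factorizations, and *co-acyclic* if it lies in the smallest such thick subcategory that is moreover closed under small coproducts. The absolute derived category $D^{\mathrm{abs}}(\mathrm{Fact}\,w)$ and the co-derived category $D^{\mathrm{co}}(\mathrm{Fact}\,w)$ are the Verdier quotients of $K(\mathrm{Fact}\,w)$ by the totally acyclic, respectively the co-acyclic, factorizations. Let $E$ and $F$ be factorizations of $w$. Put $\mathrm{Ext}^n_{\mathcal A}=0$ for $n<0$. There is a spectral sequence of abelian groups $(E_r^{p,q},d_r)_{r\ge1}$, $p,q\in\mathbb Z$, with differentials $d_r:E_r^{p,q}\to E_r^{p-r,q+1}$ (so that $q$ is the total degree and $p$ the filtration index), whose first page is $$E_1^{p,q}\cong\begin{cases}\mathrm{Ext}^{p+q}_{\mathcal A}(E^{-1},\Phi^{-s}(F^{-1}))\oplus\mathrm{Ext}^{p+q}_{\mathcal A}(E^{0},\Phi^{-s}(F^{0}))& p=2s,\\[2pt]\mathrm{Ext}^{p+q}_{\mathcal A}(E^{-1},\Phi^{-s-1}(F^{0}))\oplus\mathrm{Ext}^{p+q}_{\mathcal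 A}(E^{0},\Phi^{-s}(F^{-1}))& p=2s+1.\end{cases}$$ If $F^{-1}$ and $F^0$ have finite injective dimension, this spectral sequence converges strongly to the graded group $\bigoplus_r\mathrm{Hom}(E,F[r])$, with $\mathrm{Hom}(E,F[r])$ in degree $r$, taken in $D^{\mathrm{co}}(\mathrm{Fact}\,w)$, and likewise to the one taken in $D^{\mathrm{abs}}(\mathrm{Fact}\,w)$. Strong convergence to graded groups $(H^q)_{q\in\mathbb Z}$ means: each $H^q$ carries an exhaustive, separated and complete increasing filtration $(F_pH^q)_{p\in\mathbb Z}$, and for all $p,q$ there is an $r\geq 1$ such that all differentials into and out of $E_{r'}^{p,q}$ vanish for $r'\ge r$, and $E_r^{p,q}\cong F_pH^q/F_{p-1}H^q$. -/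

import Mathlib

open CategoryTheory CategoryTheory.Limits ZeroObject

set_option linter.unusedSimpArgs false

universe w v u

noncomputable section

/-- An autoequivalence `Φ` of `C` together with a natural transformation `w : Id ⟶ Φ`
such that `w_{Φ(A)} = Φ(w_A)` for all `A`. -/
structure Potential (C : Type u) [Category.{v} C] where
  /-- the autoequivalence; `Φ⁻¹` is `Φ.inverse`, and `Φ ^ s` is its `s`-th power, `s : ℤ` -/
  Φ : C ≌ C
  /-- the natural transformation -/
  w : 𝟭 C ⟶ Φ.functor
  w_comm : ∀ A : C, w.app (Φ.functor.obj A) = Φ.functor.map (w.app A)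

namespace Potential

variable {C : Type u} [Category.{v} C]

/-- The functor underlying the autoequivalence. -/
abbrev T (P : Potential C) : C ⥤ C := P.Φ.functor

end Potential

/-- A factorization of `(C, Φ, w)`: two objects `E⁻¹`, `E⁰`, and morphisms `φ⁰ : E⁻¹ ⟶ E⁰` and
`φ⁻¹ : Φ⁻¹(E⁰) ⟶ E⁻¹`. The second morphism is recorded through its transpose
`ψ = Φ(φ⁻¹) : E⁰ ≅ Φ(Φ⁻¹(E⁰)) ⟶ Φ(E⁻¹)`; see `Factorization.phiNeg`, `Factorization.phiNeg_comp_phi`,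
`Factorization.phi_comp_map_phiNeg` and `Factorization.ofPhiNeg` for the translation. -/
structure Factorization {C : Type u} [Category.{v} C] (P : Potential C) where
  /-- the component `E⁻¹` -/
  Xm : C
  /-- the component `E⁰` -/
  X0 : C
  /-- the morphism `φ⁰` -/
  phi : Xm ⟶ X0
  /-- the transpose of the morphism `φ⁻¹` -/
  psi : X0 ⟶ P.T.obj Xm
  phi_psi : phi ≫ psi = P.w.app Xm
  psi_phi : psi ≫ P.T.map phi = P.w.app X0

namespace Factorization

section Basic

variable {C : Type u} [Category.{v} C] {P : Potential C}

attribute [simp] phi_psi psi_phi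

@[simp]
lemma phi_psi_assoc (E : Factorization P) {Z : C} (h : P.T.obj E.Xm ⟶ Z) :
    E.phi ≫ E.psi ≫ h = P.w.app E.Xm ≫ h := by
  rw [← Category.assoc, phi_psi]

@[simp]
lemma psi_phi_assoc (E : Factorization P) {Z : C} (h : P.T.obj E.X0 ⟶ Z) :
    E.psi ≫ P.T.map E.phi ≫ h = P.w.app E.X0 ≫ h := by
  rw [← Category.assoc, psi_phi]

/-- The morphism `φ⁻¹ : Φ⁻¹(E⁰) ⟶ E⁻¹`. -/
def phiNeg (E : Factorization P) : P.Φ.inverse.obj E.X0 ⟶ E.Xm :=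
  P.Φ.inverse.map E.psi ≫ P.Φ.unitInv.app E.Xm

/-- A morphism of factorizations. -/
@[ext]
structure Hom (E F : Factorization P) where
  /-- the component `E⁻¹ ⟶ F⁻¹` -/
  fm : E.Xm ⟶ F.Xm
  /-- the component `E⁰ ⟶ F⁰` -/
  f0 : E.X0 ⟶ F.X0
  phi_f0 : E.phi ≫ f0 = fm ≫ F.phi
  psi_fm : E.psi ≫ P.T.map fm = f0 ≫ F.psi

attribute [simp] Hom.phi_f0 Hom.psi_fm

@[simp]
lemma Hom.phi_f0_assoc {E F : Factorization P} (f : Hom E F) {Z : C} (h : F.X0 ⟶ Z) :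
    E.phi ≫ f.f0 ≫ h = f.fm ≫ F.phi ≫ h := by
  rw [← Category.assoc, Hom.phi_f0, Category.assoc]

@[simp]
lemma Hom.psi_fm_assoc {E F : Factorization P} (f : Hom E F) {Z : C} (h : P.T.obj F.Xm ⟶ Z) :
    E.psi ≫ P.T.map f.fm ≫ h = f.f0 ≫ F.psi ≫ h := by
  rw [← Category.assoc, Hom.psi_fm, Category.assoc]

/-- The category `Fact(w)` of factorizations. -/
instance : Category (Factorization P) where
  Hom := Hom
  id E := { fm := 𝟙 _, f0 := 𝟙 _, phi_f0 := by simp, psi_fm := by simp }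
  comp f g :=
    { fm := f.fm ≫ g.fm, f0 := f.f0 ≫ g.f0, phi_f0 := by simp, psi_fm := by simp }
  id_comp f := by cases f; simp
  comp_id f := by cases f; simp
  assoc f g h := by simp

@[ext]
lemma hom_ext {E F : Factorization P} {f g : E ⟶ F} (h₁ : f.fm = g.fm) (h₂ : f.f0 = g.f0) :
    f = g := Hom.ext h₁ h₂

@[simp] lemma id_fm (E : Factorization P) : Hom.fm (𝟙 E) = 𝟙 E.Xm := rfl
@[simp] lemma id_f0 (E : Factorization P) : Hom.f0 (𝟙 E) = 𝟙 E.X0 := rfl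
@[simp] lemma comp_fm {E F G : Factorization P} (f : E ⟶ F) (g : F ⟶ G) :
    (f ≫ g).fm = f.fm ≫ g.fm := rfl
@[simp] lemma comp_f0 {E F G : Factorization P} (f : E ⟶ F) (g : F ⟶ G) :
    (f ≫ g).f0 = f.f0 ≫ g.f0 := rfl

/-- An isomorphism of factorizations from isomorphisms of the components. -/
@[simps]
def isoMk {E F : Factorization P} (em : E.Xm ≅ F.Xm) (e0 : E.X0 ≅ F.X0)
    (h₁ : E.phi ≫ e0.hom = em.hom ≫ F.phi) (h₂ : E.psi ≫ P.T.map em.hom = e0.hom ≫ F.psi) :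
    E ≅ F where
  hom := { fm := em.hom, f0 := e0.hom, phi_f0 := h₁, psi_fm := h₂ }
  inv :=
    { fm := em.inv, f0 := e0.inv
      phi_f0 := by rw [Iso.eq_inv_comp, ← reassoc_of% h₁, Iso.hom_inv_id, Category.comp_id]
      psi_fm := by
        rw [Iso.eq_inv_comp, ← reassoc_of% h₂, ← Functor.map_comp, Iso.hom_inv_id]
        simp }
  hom_inv_id := by ext <;> exact Iso.hom_inv_id _
  inv_hom_id := by ext <;> exact Iso.inv_hom_id _

lemma phiNeg_comp_phi (E : Factorization P) :
    E.phiNeg ≫ E.phi = P.Φ.inverse.map (P.w.app E.X0) ≫ P.Φ.unitInv.app E.X0 := by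
  have := P.Φ.unitInv.naturality E.phi
  simp only [Functor.comp_map, Functor.id_map] at this
  rw [phiNeg, Category.assoc, ← this, ← Functor.map_comp_assoc, E.psi_phi]

lemma phi_comp_map_phiNeg (E : Factorization P) :
    E.phi ≫ P.Φ.counitInv.app E.X0 ≫ P.T.map E.phiNeg = P.w.app E.Xm := by
  have := P.Φ.counitInv.naturality E.psi
  simp only [Functor.comp_map, Functor.id_map] at this
  rw [phiNeg, Functor.map_comp, ← reassoc_of% this]
  simp

/-- The factorization given by objects `E⁻¹`, `E⁰` and morphisms `φ⁻¹`, `φ⁰`. -/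
def ofPhiNeg (Xm X0 : C) (phi : Xm ⟶ X0) (phiNeg : P.Φ.inverse.obj X0 ⟶ Xm)
    (h₁ : phiNeg ≫ phi = P.Φ.inverse.map (P.w.app X0) ≫ P.Φ.unitInv.app X0)
    (h₂ : phi ≫ P.Φ.counitInv.app X0 ≫ P.T.map phiNeg = P.w.app Xm) : Factorization P where
  Xm := Xm
  X0 := X0
  phi := phi
  psi := P.Φ.counitInv.app X0 ≫ P.T.map phiNeg
  phi_psi := h₂
  psi_phi := by
    have := P.Φ.counitInv.naturality (P.w.app X0)
    simp only [Functor.comp_map, Functor.id_map] at this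
    rw [Category.assoc, ← Functor.map_comp, h₁, Functor.map_comp, ← reassoc_of% this]
    simp

lemma inverse_map_w (A : C) :
    P.Φ.inverse.map (P.w.app A) ≫ P.Φ.unitInv.app A ≫ P.Φ.counitInv.app A =
      P.w.app (P.Φ.inverse.obj A) := by
  apply P.T.map_injective
  have h₁ : P.Φ.counit.app A ≫ P.w.app A = P.w.app _ ≫ P.T.map (P.Φ.counit.app A) :=
    P.w.naturality (P.Φ.counit.app A)
  have h₂ : P.w.app (P.T.obj (P.Φ.inverse.obj A)) =
      P.Φ.counit.app A ≫ P.w.app A ≫ P.T.map (P.Φ.counitInv.app A) := by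
    rw [reassoc_of% h₁, ← Functor.map_comp]
    simp
  have h₃ : P.w.app A ≫ P.Φ.counitInv.app (P.T.obj A) =
      P.Φ.counitInv.app A ≫ P.T.map (P.Φ.inverse.map (P.w.app A)) :=
    P.Φ.counitInv.naturality (P.w.app A)
  rw [← P.w_comm, h₂, Functor.map_comp, Functor.map_comp]
  have h₄ : P.T.map (P.Φ.inverse.map (P.w.app A)) =
      P.Φ.counit.app A ≫ P.w.app A ≫ P.Φ.counitInv.app (P.T.obj A) := by
    rw [h₃]; simp
  rw [h₄]
  simp

lemma w_naturality {A B : C} (f : A ⟶ B) : f ≫ P.w.app B = P.w.app A ≫ P.T.map f :=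
  P.w.naturality f

end Basic

section Additive

variable {C : Type u} [Category.{v} C] [Abelian C] {P : Potential C}

instance : P.T.Additive := Functor.additive_of_preserves_binary_products _

instance (E F : Factorization P) : Zero (E ⟶ F) := ⟨⟨0, 0, by simp, by simp⟩⟩
instance (E F : Factorization P) : Add (E ⟶ F) :=
  ⟨fun f g => ⟨f.fm + g.fm, f.f0 + g.f0, by simp, by simp [Functor.map_add]⟩⟩
instance (E F : Factorization P) : Neg (E ⟶ F) :=
  ⟨fun f => ⟨-f.fm, -f.f0, by simp, by simp [Functor.map_neg]⟩⟩

@[simp] lemma zero_fm (E F : Factorization P) : Hom.fm (0 : E ⟶ F) = 0 := rfl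
@[simp] lemma zero_f0 (E F : Factorization P) : Hom.f0 (0 : E ⟶ F) = 0 := rfl
@[simp] lemma add_fm {E F : Factorization P} (f g : E ⟶ F) : (f + g).fm = f.fm + g.fm := rfl
@[simp] lemma add_f0 {E F : Factorization P} (f g : E ⟶ F) : (f + g).f0 = f.f0 + g.f0 := rfl
@[simp] lemma neg_fm {E F : Factorization P} (f : E ⟶ F) : (-f).fm = -f.fm := rfl
@[simp] lemma neg_f0 {E F : Factorization P} (f : E ⟶ F) : (-f).f0 = -f.f0 := rfl

instance : Preadditive (Factorization P) where
  homGroup E F :=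
    { add_assoc := fun f g h => by ext <;> simp [add_assoc]
      zero_add := fun f => by ext <;> simp
      add_zero := fun f => by ext <;> simp
      add_comm := fun f g => by ext <;> simp [add_comm]
      neg_add_cancel := fun f => by ext <;> simp
      nsmul := nsmulRec
      zsmul := zsmulRec }
  add_comp _ _ _ _ _ _ := by ext <;> simp
  comp_add _ _ _ _ _ _ := by ext <;> simp

@[simp] lemma sub_fm {E F : Factorization P} (f g : E ⟶ F) : (f - g).fm = f.fm - g.fm := by
  simp [sub_eq_add_neg]
@[simp] lemma sub_f0 {E F : Factorization P} (f g : E ⟶ F) : (f - g).f0 = f.f0 - g.f0 := by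
  simp [sub_eq_add_neg]

variable (P) in
/-- The functor `E ↦ E⁻¹`. -/
@[simps]
def evm : Factorization P ⥤ C where
  obj E := E.Xm
  map f := f.fm

variable (P) in
/-- The functor `E ↦ E⁰`. -/
@[simps]
def ev0 : Factorization P ⥤ C where
  obj E := E.X0
  map f := f.f0

instance : (evm P).Additive where
instance : (ev0 P).Additive where

/-- The translation `E[1] = (E⁰, Φ(E⁻¹), -φ⁰, -Φ(φ⁻¹))`. -/
abbrev shiftObj (E : Factorization P) : Factorization P where
  Xm := E.X0
  X0 := P.T.obj E.Xm
  phi := -E.psi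
  psi := -P.T.map E.phi
  phi_psi := by simp
  psi_phi := by simp [← Functor.map_comp, P.w_comm]

variable (P) in
/-- The translation functor `[1]`. -/
def shift : Factorization P ⥤ Factorization P where
  obj E := E.shiftObj
  map {E F} f :=
    { fm := f.f0, f0 := P.T.map f.fm
      phi_f0 := by
        have : (-E.psi) ≫ P.T.map f.fm = f.f0 ≫ (-F.psi) := by simp
        exact this
      psi_fm := by
        have : (-P.T.map E.phi) ≫ P.T.map f.f0 = P.T.map f.fm ≫ (-P.T.map F.phi) := by
          simp [← Functor.map_comp]
        exact this }
  map_id _ := hom_ext rfl (P.T.map_id _)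
  map_comp _ _ := hom_ext rfl (P.T.map_comp _ _)

@[simp] lemma shift_map_fm {E F : Factorization P} (f : E ⟶ F) :
    ((shift P).map f).fm = f.f0 := rfl
@[simp] lemma shift_map_f0 {E F : Factorization P} (f : E ⟶ F) :
    ((shift P).map f).f0 = P.T.map f.fm := rfl

instance : (shift P).Faithful where
  map_injective {E F} f g h := by
    ext
    · exact P.T.map_injective (congrArg Hom.f0 h)
    · exact congrArg Hom.fm h

instance : (shift P).Full where
  map_surjective {E F} g := by
    let gm : E.X0 ⟶ F.X0 := g.fm
    let g0 : P.T.obj E.Xm ⟶ P.T.obj F.Xm := g.f0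
    obtain ⟨fm, hfm⟩ := P.T.map_surjective g0
    have h₁ : (-E.psi) ≫ g0 = gm ≫ (-F.psi) := g.phi_f0
    have h₂ : (-P.T.map E.phi) ≫ P.T.map gm = g0 ≫ (-P.T.map F.phi) := g.psi_fm
    rw [Preadditive.neg_comp, Preadditive.comp_neg, neg_inj] at h₁ h₂
    refine ⟨⟨fm, gm, P.T.map_injective ?_, ?_⟩, hom_ext rfl hfm⟩
    · rw [Functor.map_comp, h₂, Functor.map_comp, hfm]
    · rw [hfm, h₁]

instance : (shift P).EssSurj where
  mem_essImage F := by
    have hn : P.T.map F.phiNeg = P.Φ.counit.app F.X0 ≫ F.psi := by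
      have h : P.Φ.counit.app F.X0 ≫ F.psi =
          P.T.map (P.Φ.inverse.map F.psi) ≫ P.Φ.counit.app (P.T.obj F.Xm) :=
        (P.Φ.counit.naturality F.psi).symm
      rw [phiNeg, Functor.map_comp, h]
      simp
    let E : Factorization P :=
      { Xm := P.Φ.inverse.obj F.X0
        X0 := F.Xm
        phi := -F.phiNeg
        psi := -(F.phi ≫ P.Φ.counitInv.app F.X0)
        phi_psi := by
          rw [Preadditive.neg_comp, Preadditive.comp_neg, neg_neg, ← Category.assoc,
            phiNeg_comp_phi, Category.assoc, inverse_map_w]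
        psi_phi := by
          rw [Functor.map_neg, Preadditive.neg_comp, Preadditive.comp_neg, neg_neg,
            Category.assoc, phi_comp_map_phiNeg] }
    let e : P.T.obj (P.Φ.inverse.obj F.X0) ≅ F.X0 := P.Φ.counitIso.app F.X0
    have h₁ : (-(-(F.phi ≫ P.Φ.counitInv.app F.X0))) ≫ e.hom = 𝟙 _ ≫ F.phi := by
      simp [e]
    have h₂ : (-P.T.map (-F.phiNeg)) ≫ P.T.map (𝟙 _) = e.hom ≫ F.psi := by
      rw [Functor.map_neg, neg_neg, hn]
      simp [e]
    exact ⟨E, ⟨isoMk (E := E.shiftObj) (Iso.refl F.Xm) e h₁ h₂⟩⟩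

instance : (shift P).IsEquivalence where

variable (P) in
/-- The translation as an autoequivalence; `E[r]` is `(shiftEquiv P ^ r).functor.obj E`. -/
def shiftEquiv : Factorization P ≌ Factorization P := (shift P).asEquivalence

/-- Two morphisms `f`, `g` are homotopic if there are `h⁰ : E⁰ ⟶ F⁻¹` and
`h⁻¹ : E⁻¹ ⟶ Φ⁻¹(F⁰)`, the latter recorded through its transpose `k : Φ(E⁻¹) ⟶ F⁰`, with
`f⁰ - g⁰ = φ_F⁰ ∘ h⁰ + Φ(h⁻¹) ∘ Φ(φ_E⁻¹)` and `f⁻¹ - g⁻¹ = h⁰ ∘ φ_E⁰ + φ_F⁻¹ ∘ h⁻¹`; the last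
identity is written after application of the equivalence `Φ`. -/
def Homotopic : HomRel (Factorization P) := fun E F f g =>
  ∃ (h : E.X0 ⟶ F.Xm) (k : P.T.obj E.Xm ⟶ F.X0),
    f.f0 - g.f0 = h ≫ F.phi + E.psi ≫ k ∧
    P.T.map (f.fm - g.fm) = P.T.map (E.phi ≫ h) + k ≫ F.psi

instance : Congruence (Homotopic (P := P)) where
  equivalence :=
    { refl := fun f => ⟨0, 0, by simp, by simp⟩
      symm := by
        rintro f g ⟨h, k, h₁, h₂⟩
        refine ⟨-h, -k, ?_, ?_⟩
        · rw [← neg_sub, h₁]; simp; abel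
        · rw [← neg_sub, Functor.map_neg, h₂]; simp; abel
      trans := by
        rintro f g l ⟨h, k, h₁, h₂⟩ ⟨h', k', h₁', h₂'⟩
        refine ⟨h + h', k + k', ?_, ?_⟩
        · rw [← sub_add_sub_cancel _ g.f0, h₁, h₁']; simp; abel
        · rw [← sub_add_sub_cancel _ g.fm, Functor.map_add, h₂, h₂']; simp; abel }
  comp_left := by
    rintro E F G f g g' ⟨h, k, h₁, h₂⟩
    refine ⟨f.f0 ≫ h, P.T.map f.fm ≫ k, ?_, ?_⟩
    · simp [← Preadditive.comp_sub, h₁]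
    · simp only [comp_fm, ← Preadditive.comp_sub, Functor.map_comp, h₂]
      simp [← Functor.map_comp]
  comp_right := by
    rintro E F G f f' g ⟨h, k, h₁, h₂⟩
    refine ⟨h ≫ g.fm, k ≫ g.f0, ?_, ?_⟩
    · simp [← Preadditive.sub_comp, h₁]
    · simp only [comp_fm, ← Preadditive.sub_comp, Functor.map_comp, h₂]
      simp

lemma Homotopic.add {E F : Factorization P} (f₁ f₂ g₁ g₂ : E ⟶ F)
    (h : Homotopic f₁ f₂) (h' : Homotopic g₁ g₂) : Homotopic (f₁ + g₁) (f₂ + g₂) := by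
  obtain ⟨h, k, h₁, h₂⟩ := h
  obtain ⟨h', k', h₁', h₂'⟩ := h'
  refine ⟨h + h', k + k', ?_, ?_⟩
  · rw [add_f0, add_f0, add_sub_add_comm, h₁, h₁']; simp; abel
  · rw [add_fm, add_fm, add_sub_add_comm, Functor.map_add, h₂, h₂']; simp; abel

variable (P) in
/-- The homotopy category `K(Fact w)`. -/
abbrev HoFact := CategoryTheory.Quotient (Homotopic (P := P))

variable (P) in
/-- The functor `Fact(w) ⥤ K(Fact w)`. -/
abbrev toHo : Factorization P ⥤ HoFact P := CategoryTheory.Quotient.functor _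

instance : Preadditive (HoFact P) :=
  CategoryTheory.Quotient.preadditive _ (fun _ _ f₁ f₂ g₁ g₂ => Homotopic.add f₁ f₂ g₁ g₂)

instance : (toHo P).Additive :=
  CategoryTheory.Quotient.functor_additive _ (fun _ _ f₁ f₂ g₁ g₂ => Homotopic.add f₁ f₂ g₁ g₂)

/-- The cone of a morphism of factorizations, with components `E⁰ ⊕ F⁻¹` and `Φ(E⁻¹) ⊕ F⁰`. -/
abbrev cone {E F : Factorization P} (g : E ⟶ F) : Factorization P where
  Xm := E.X0 ⊞ F.Xm
  X0 := P.T.obj E.Xm ⊞ F.X0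
  phi := biprod.desc (biprod.lift (-E.psi) g.f0) (biprod.lift 0 F.phi)
  psi := biprod.desc (-P.T.map (E.phi ≫ biprod.inl) + P.T.map (g.fm ≫ biprod.inr))
    (F.psi ≫ P.T.map biprod.inr)
  phi_psi := by
    apply biprod.hom_ext'
    · rw [w_naturality]; simp
    · rw [w_naturality]; simp
  psi_phi := by
    apply biprod.hom_ext'
    · rw [w_naturality]
      rw [P.w_comm]
      simp only [biprod.inl_desc_assoc, Preadditive.add_comp, Preadditive.neg_comp,
        ← Functor.map_comp, Category.assoc, biprod.inl_desc, biprod.inr_desc, ← Functor.map_neg,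
        ← Functor.map_add]
      congr 1
      ext <;> simp
    · rw [w_naturality]
      simp only [biprod.inr_desc_assoc, Category.assoc,
        ← Functor.map_comp, biprod.inr_desc]
      rw [show biprod.lift 0 F.phi = F.phi ≫ (biprod.inr : _ ⟶ P.T.obj E.Xm ⊞ F.X0) by
        ext <;> simp]
      simp

lemma cone_phi {E F : Factorization P} (g : E ⟶ F) :
    (cone g).phi = biprod.desc (biprod.lift (-E.psi) g.f0) (biprod.lift 0 F.phi) := rfl

lemma cone_psi {E F : Factorization P} (g : E ⟶ F) :
    (cone g).psi = biprod.desc (-P.T.map (E.phi ≫ biprod.inl) + P.T.map (g.fm ≫ biprod.inr))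
      (F.psi ≫ P.T.map biprod.inr) := rfl

/-- A morphism out of the cone of `g : E ⟶ F`, from a morphism `f : F ⟶ Z` and a homotopy
from `g ≫ f` to zero. -/
def coneDesc {E F Z : Factorization P} (g : E ⟶ F) (f : F ⟶ Z) (h : E.X0 ⟶ Z.Xm)
    (k : P.T.obj E.Xm ⟶ Z.X0) (h₁ : g.f0 ≫ f.f0 = h ≫ Z.phi + E.psi ≫ k)
    (h₂ : P.T.map (g.fm ≫ f.fm) = P.T.map (E.phi ≫ h) + k ≫ Z.psi) : cone g ⟶ Z where
  fm := (biprod.desc h f.fm : E.X0 ⊞ F.Xm ⟶ Z.Xm)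
  f0 := (biprod.desc k f.f0 : P.T.obj E.Xm ⊞ F.X0 ⟶ Z.X0)
  phi_f0 := by
    rw [cone_phi]
    apply biprod.hom_ext'
    · simp [h₁]
    · simp
  psi_fm := by
    rw [cone_psi]
    apply biprod.hom_ext'
    · simp only [biprod.inl_desc_assoc, Preadditive.add_comp, Preadditive.neg_comp,
        ← Functor.map_comp, Category.assoc, biprod.inl_desc, biprod.inr_desc, h₂]
      abel
    · simp [← Functor.map_comp]

/-- The inclusion `F ⟶ C(g)`. -/
def coneInr {E F : Factorization P} (g : E ⟶ F) : F ⟶ cone g where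
  fm := (biprod.inr : F.Xm ⟶ E.X0 ⊞ F.Xm)
  f0 := (biprod.inr : F.X0 ⟶ P.T.obj E.Xm ⊞ F.X0)
  phi_f0 := by
    rw [cone_phi, biprod.inr_desc]
    apply biprod.hom_ext <;> simp
  psi_fm := by rw [cone_psi, biprod.inr_desc]

lemma coneInr_desc {E F Z : Factorization P} (g : E ⟶ F) (f : F ⟶ Z) (h : E.X0 ⟶ Z.Xm)
    (k : P.T.obj E.Xm ⟶ Z.X0) (h₁ : g.f0 ≫ f.f0 = h ≫ Z.phi + E.psi ≫ k)
    (h₂ : P.T.map (g.fm ≫ f.fm) = P.T.map (E.phi ≫ h) + k ≫ Z.psi) :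
    coneInr g ≫ coneDesc g f h k h₁ h₂ = f := by
  ext <;> simp [coneDesc, coneInr]

instance : HasZeroObject (Factorization P) where
  zero := by
    let Z : Factorization P :=
      { Xm := 0, X0 := 0, phi := 0, psi := 0
        phi_psi := (isZero_zero C).eq_of_src _ _
        psi_phi := (isZero_zero C).eq_of_src _ _ }
    refine ⟨Z, ?_⟩
    rw [IsZero.iff_id_eq_zero]
    exact hom_ext ((isZero_zero C).eq_of_src _ _) ((isZero_zero C).eq_of_src _ _)

/-- The extension `0 ⟶ Y ⟶ X ⟶ B ⟶ 0` twisted by a morphism of degree one from `B` to `Y`. -/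
abbrev ext (B Y : Factorization P) (θm : B.Xm ⟶ Y.X0) (θ0 : B.X0 ⟶ P.T.obj Y.Xm)
    (h₁ : B.phi ≫ θ0 + θm ≫ Y.psi = 0)
    (h₂ : B.psi ≫ P.T.map θm + θ0 ≫ P.T.map Y.phi = 0) : Factorization P where
  Xm := B.Xm ⊞ Y.Xm
  X0 := B.X0 ⊞ Y.X0
  phi := biprod.desc (biprod.lift B.phi θm) (biprod.lift 0 Y.phi)
  psi := biprod.desc (B.psi ≫ P.T.map biprod.inl + θ0 ≫ P.T.map biprod.inr)
    (Y.psi ≫ P.T.map biprod.inr)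
  phi_psi := by
    apply biprod.hom_ext'
    · rw [w_naturality]
      have := congrArg (fun f => f ≫ P.T.map (biprod.inr : _ ⟶ B.Xm ⊞ Y.Xm)) h₁
      simp only [Preadditive.add_comp, Category.assoc, zero_comp] at this
      simp [add_assoc, this]
    · rw [w_naturality]; simp
  psi_phi := by
    apply biprod.hom_ext'
    · rw [w_naturality]
      have := congrArg (fun f => f ≫ P.T.map (biprod.inr : _ ⟶ B.X0 ⊞ Y.X0)) h₂
      simp only [Preadditive.add_comp, Category.assoc, zero_comp] at this
      have e₁ : biprod.lift B.phi θm = B.phi ≫ (biprod.inl : _ ⟶ B.X0 ⊞ Y.X0) + θm ≫ biprod.inr := by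
        ext <;> simp
      have e₂ : biprod.lift 0 Y.phi = Y.phi ≫ (biprod.inr : _ ⟶ B.X0 ⊞ Y.X0) := by
        ext <;> simp
      simp only [biprod.inl_desc_assoc, Preadditive.add_comp, Category.assoc, ← Functor.map_comp,
        biprod.inl_desc, biprod.inr_desc, e₁, e₂]
      simp only [Functor.map_comp, Functor.map_add, Preadditive.comp_add, psi_phi_assoc,
        add_assoc, this, add_zero]
    · rw [w_naturality]
      have e₂ : biprod.lift 0 Y.phi = Y.phi ≫ (biprod.inr : _ ⟶ B.X0 ⊞ Y.X0) := by
        ext <;> simp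
      simp only [biprod.inr_desc_assoc, Category.assoc, ← Functor.map_comp, biprod.inr_desc, e₂]
      simp

lemma map_inl_fst (A B : C) :
    P.T.map (biprod.inl : A ⟶ A ⊞ B) ≫ P.T.map biprod.fst = 𝟙 _ := by
  rw [← Functor.map_comp]; simp

lemma map_inl_fst_assoc (A B : C) {Z : C} (h : P.T.obj A ⟶ Z) :
    P.T.map (biprod.inl : A ⟶ A ⊞ B) ≫ P.T.map biprod.fst ≫ h = h := by
  rw [← Category.assoc, map_inl_fst]; simp

lemma map_inl_snd (A B : C) :
    P.T.map (biprod.inl : A ⟶ A ⊞ B) ≫ P.T.map biprod.snd = 0 := by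
  rw [← Functor.map_comp]; simp

lemma map_inl_snd_assoc (A B : C) {Z : C} (h : P.T.obj B ⟶ Z) :
    P.T.map (biprod.inl : A ⟶ A ⊞ B) ≫ P.T.map biprod.snd ≫ h = 0 := by
  rw [← Category.assoc, map_inl_snd]; simp

lemma map_inr_fst (A B : C) :
    P.T.map (biprod.inr : B ⟶ A ⊞ B) ≫ P.T.map biprod.fst = 0 := by
  rw [← Functor.map_comp]; simp

lemma map_inr_fst_assoc (A B : C) {Z : C} (h : P.T.obj A ⟶ Z) :
    P.T.map (biprod.inr : B ⟶ A ⊞ B) ≫ P.T.map biprod.fst ≫ h = 0 := by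
  rw [← Category.assoc, map_inr_fst]; simp

lemma map_inr_snd (A B : C) :
    P.T.map (biprod.inr : B ⟶ A ⊞ B) ≫ P.T.map biprod.snd = 𝟙 _ := by
  rw [← Functor.map_comp]; simp

lemma map_inr_snd_assoc (A B : C) {Z : C} (h : P.T.obj B ⟶ Z) :
    P.T.map (biprod.inr : B ⟶ A ⊞ B) ≫ P.T.map biprod.snd ≫ h = h := by
  rw [← Category.assoc, map_inr_snd]; simp

section Ext

variable (B Y : Factorization P) (θm : B.Xm ⟶ Y.X0) (θ0 : B.X0 ⟶ P.T.obj Y.Xm)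
    (h₁ : B.phi ≫ θ0 + θm ≫ Y.psi = 0)
    (h₂ : B.psi ≫ P.T.map θm + θ0 ≫ P.T.map Y.phi = 0)

/-- The inclusion of `Y` in an extension. -/
def extInr : Y ⟶ ext B Y θm θ0 h₁ h₂ where
  fm := (biprod.inr : Y.Xm ⟶ B.Xm ⊞ Y.Xm)
  f0 := (biprod.inr : Y.X0 ⟶ B.X0 ⊞ Y.X0)
  phi_f0 := by rw [biprod.inr_desc]; ext <;> simp
  psi_fm := by rw [biprod.inr_desc]

/-- The cone of the inclusion of `Y` in an extension of `B` by `Y` is homotopy equivalent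
to `B`. -/
lemma nonempty_iso_cone_extInr :
    Nonempty ((toHo P).obj (cone (extInr B Y θm θ0 h₁ h₂)) ≅ (toHo P).obj B) := by
  let π : cone (extInr B Y θm θ0 h₁ h₂) ⟶ B :=
    { fm := biprod.snd ≫ biprod.fst
      f0 := biprod.snd ≫ biprod.fst
      phi_f0 := by
        apply biprod.hom_ext'
        · simp [extInr]
        · apply biprod.hom_ext' <;> simp
      psi_fm := by
        apply biprod.hom_ext'
        · simp [extInr, ← Functor.map_comp]
        · apply biprod.hom_ext' <;> simp [← Functor.map_comp] }
  let σ : B ⟶ cone (extInr B Y θm θ0 h₁ h₂) :=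
    { fm := biprod.lift (-θm) (biprod.lift (𝟙 _) 0)
      f0 := biprod.lift (-θ0) (biprod.lift (𝟙 _) 0)
      phi_f0 := by
        apply biprod.hom_ext
        · have h := eq_neg_of_add_eq_zero_left h₁
          simp [h]
        · apply biprod.hom_ext <;> simp [extInr]
      psi_fm := by
        have h := eq_neg_of_add_eq_zero_left h₂
        have h' : B.psi ≫ P.T.map (biprod.lift (-θm) (biprod.lift (𝟙 B.Xm) (0 : B.Xm ⟶ Y.Xm))) =
            -(B.psi ≫ P.T.map θm) ≫ P.T.map biprod.inl +
              B.psi ≫ P.T.map (biprod.inl ≫ biprod.inr) := by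
          simp [biprod.lift_eq]
        rw [h', h]
        simp [biprod.lift_eq, extInr]
        abel }
  have hσπ : σ ≫ π = 𝟙 _ := by ext <;> simp [σ, π]
  have hπσ : Homotopic (𝟙 _) (π ≫ σ) := by
    refine ⟨biprod.snd ≫ biprod.snd ≫ biprod.inl,
      P.T.map (biprod.snd ≫ biprod.snd) ≫ biprod.inl, ?_, ?_⟩
    · apply biprod.hom_ext'
      · apply biprod.hom_ext
        · simp [π, σ, extInr, map_inl_fst, map_inl_snd, map_inr_fst, map_inr_snd, map_inl_fst_assoc,
            map_inl_snd_assoc, map_inr_fst_assoc, map_inr_snd_assoc]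
        · apply biprod.hom_ext <;> simp [π, σ, extInr]
      · apply biprod.hom_ext'
        · apply biprod.hom_ext
          · simp [π, σ, extInr, map_inl_fst, map_inl_snd, map_inr_fst, map_inr_snd, map_inl_fst_assoc,
            map_inl_snd_assoc, map_inr_fst_assoc, map_inr_snd_assoc]
          · apply biprod.hom_ext <;> simp [π, σ, extInr]
        · apply biprod.hom_ext
          · simp [π, σ, extInr, map_inl_fst, map_inl_snd, map_inr_fst, map_inr_snd, map_inl_fst_assoc,
            map_inl_snd_assoc, map_inr_fst_assoc, map_inr_snd_assoc]
          · apply biprod.hom_ext <;> simp [π, σ, extInr]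
    · simp only [Category.assoc, biprod.inl_desc, ← Functor.map_comp,
        ← Functor.map_add, ← Functor.map_neg]
      congr 1
      apply biprod.hom_ext'
      · apply biprod.hom_ext
        · simp [π, σ, extInr]
        · apply biprod.hom_ext <;> simp [π, σ, extInr]
      · apply biprod.hom_ext'
        · apply biprod.hom_ext
          · simp [π, σ, extInr]
          · apply biprod.hom_ext <;> simp [π, σ, extInr]
        · apply biprod.hom_ext
          · simp [π, σ, extInr]
          · apply biprod.hom_ext <;> simp [π, σ, extInr]
  exact ⟨{
    hom := (toHo P).map π
    inv := (toHo P).map σ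
    hom_inv_id := by
      rw [← Functor.map_comp, ← (toHo P).map_id]
      exact (CategoryTheory.Quotient.sound _ hπσ).symm
    inv_hom_id := by rw [← Functor.map_comp, hσπ, (toHo P).map_id] }⟩

end Ext

/-- Every pair of morphisms `s : X ⟶ X'`, `f : X ⟶ Y` embeds in a homotopy commutative square
whose side opposite to `s` has a cone homotopy equivalent to the one of `s`. -/
lemma exists_square {X X' Y : Factorization P} (s : X ⟶ X') (f : X ⟶ Y) :
    ∃ (Z : Factorization P) (t : Y ⟶ Z) (f' : X' ⟶ Z),
      (toHo P).map (f ≫ t) = (toHo P).map (s ≫ f') ∧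
      Nonempty ((toHo P).obj (cone t) ≅ (toHo P).obj (cone s)) := by
  have h₁ : (cone s).phi ≫ (biprod.fst ≫ P.T.map f.fm) + (biprod.fst ≫ f.f0) ≫ Y.psi = 0 := by
    apply biprod.hom_ext' <;> simp
  have h₂ : (cone s).psi ≫ P.T.map (biprod.fst ≫ f.f0) +
      (biprod.fst ≫ P.T.map f.fm) ≫ P.T.map Y.phi = 0 := by
    apply biprod.hom_ext'
    · simp [← Functor.map_comp]
    · simp [← Functor.map_comp]
  let Z := ext (cone s) Y (biprod.fst ≫ f.f0) (biprod.fst ≫ P.T.map f.fm) h₁ h₂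
  let f' : X' ⟶ Z :=
    { fm := biprod.inr ≫ biprod.inl
      f0 := biprod.inr ≫ biprod.inl
      phi_f0 := by
        apply biprod.hom_ext
        · apply biprod.hom_ext <;> simp [Z]
        · simp [Z]
      psi_fm := by simp [Z] }
  refine ⟨Z, extInr _ _ _ _ h₁ h₂, -f', CategoryTheory.Quotient.sound _ ?_,
    nonempty_iso_cone_extInr _ _ _ _ h₁ h₂⟩
  refine ⟨biprod.inl ≫ biprod.inl, biprod.inl ≫ biprod.inl, ?_, ?_⟩
  · apply biprod.hom_ext
    · apply biprod.hom_ext <;> simp [Z, f', extInr]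
    · simp [Z, f', extInr]
  · have e : (biprod.inl ≫ biprod.inl) ≫ Z.psi = P.T.map ((-(X.phi ≫ biprod.inl) +
        s.fm ≫ biprod.inr) ≫ biprod.inl + f.fm ≫ biprod.inr) := by
      simp [Z]
    rw [e, ← Functor.map_add]
    congr 1
    apply biprod.hom_ext
    · apply biprod.hom_ext <;> simp [f', extInr]
    · simp [f', extInr]

/-- A full subcategory of `K(Fact w)`, given by a class `S` of objects, is thick if it is a
triangulated subcategory closed under direct summands: it contains the zero objects, is stable
under `[1]` and `[-1]`, under cones and under retracts. -/
structure IsThick (S : ObjectProperty (HoFact P)) : Prop where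
  zero : ∀ X, IsZero X → S X
  shift : ∀ E : Factorization P,
    S ((toHo P).obj ((Factorization.shift P).obj E)) ↔ S ((toHo P).obj E)
  cone : ∀ ⦃E F : Factorization P⦄ (g : E ⟶ F), S ((toHo P).obj E) → S ((toHo P).obj F) →
    S ((toHo P).obj (Factorization.cone g))
  retract : ∀ X Y : HoFact P, Retract X Y → S Y → S X

/-- The morphisms of `K(Fact w)` with cone in `S`. -/
def verdierW (S : ObjectProperty (HoFact P)) : MorphismProperty (HoFact P) := fun X Y s =>
  ∃ g : X.as ⟶ Y.as, (toHo P).map g = s ∧ S ((toHo P).obj (cone g))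

/-- The Verdier quotient of `K(Fact w)` by `S`: the localization at the morphisms with cone
in `S`. -/
abbrev VerdierQuotient (S : ObjectProperty (HoFact P)) := (verdierW S).Localization

/-- The functor `Fact(w) ⥤ K(Fact w) ⥤ K(Fact w) / S`. -/
abbrev toVerdier (S : ObjectProperty (HoFact P)) : Factorization P ⥤ VerdierQuotient S :=
  toHo P ⋙ (verdierW S).Q

lemma IsThick.of_iso {S : ObjectProperty (HoFact P)} (hS : IsThick S) {X Y : HoFact P}
    (e : X ≅ Y) (h : S Y) : S X := hS.retract _ _ e.retract h

lemma IsThick.exists_square {S : ObjectProperty (HoFact P)} (hS : IsThick S)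
    {X X' Y : HoFact P} (s : X ⟶ X') (hs : verdierW S s) (f : X ⟶ Y) :
    ∃ (Z : HoFact P) (t : Y ⟶ Z) (f' : X' ⟶ Z), verdierW S t ∧ f ≫ t = s ≫ f' := by
  obtain ⟨s, rfl, hs⟩ := hs
  obtain ⟨f, rfl⟩ := (toHo P).map_surjective (X := X.as) (Y := Y.as) f
  obtain ⟨Z, t, f', h, ⟨e⟩⟩ := Factorization.exists_square s f
  exact ⟨(toHo P).obj Z, (toHo P).map t, (toHo P).map f', ⟨t, rfl, hS.of_iso e hs⟩, h⟩

lemma IsThick.exists_comp_eq {S : ObjectProperty (HoFact P)} (hS : IsThick S)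
    {X X' Y : HoFact P} (s : X ⟶ X') (hs : verdierW S s) (f : X' ⟶ Y) (hf : s ≫ f = 0) :
    ∃ (Z : HoFact P) (t : Y ⟶ Z), verdierW S t ∧ f ≫ t = 0 := by
  obtain ⟨s, rfl, hs⟩ := hs
  obtain ⟨f, rfl⟩ := (toHo P).map_surjective (X := X'.as) (Y := Y.as) f
  have hf' : Homotopic (s ≫ f) 0 := by
    refine (CategoryTheory.Quotient.functor_map_eq_iff (Homotopic (P := P)) _ _).1 ?_
    exact hf
  obtain ⟨h, k, h₁, h₂⟩ := hf'
  let d : Factorization.cone s ⟶ Y.as :=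
    coneDesc s f h k (by simpa using h₁) (by simpa using h₂)
  have hO : IsZero ((toHo P).obj (0 : Factorization P)) :=
    (toHo P).map_isZero (isZero_zero _)
  have h0 : verdierW S ((toHo P).map (0 : Factorization.cone s ⟶ 0)) :=
    ⟨0, rfl, hS.cone _ hs (hS.zero _ hO)⟩
  obtain ⟨Z, t, f', ht, h⟩ := hS.exists_square _ h0 ((toHo P).map d)
  refine ⟨Z, t, ht, ?_⟩
  have hd : (toHo P).map f = (toHo P).map (coneInr s) ≫ (toHo P).map d := by
    rw [← Functor.map_comp, coneInr_desc]
  have : (toHo P).map f ≫ t = 0 := by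
    rw [hd, Category.assoc, h, Functor.map_zero, zero_comp, comp_zero]
  exact this

section Localization

variable {S : ObjectProperty (HoFact P)}

open MorphismProperty

lemma isInvertedBy_multiplicativeClosure {D E : Type*} [Category* D] [Category* E]
    (W : MorphismProperty D) (F : D ⥤ E) (hF : W.IsInvertedBy F) :
    W.multiplicativeClosure.IsInvertedBy F := by
  intro X Y f hf
  induction hf with
  | of f hf => exact hF f hf
  | id X => infer_instance
  | comp_of f g _ hg h =>
    have := hF g hg
    rw [F.map_comp]
    infer_instance

/-- Localizing at a class of morphisms is the same as localizing at its closure under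
composition. -/
instance isLocalization_multiplicativeClosure {D : Type*} [Category* D]
    (W : MorphismProperty D) : W.Q.IsLocalization W.multiplicativeClosure :=
  Functor.IsLocalization.mk' _ _
    { inverts := isInvertedBy_multiplicativeClosure W W.Q W.Q_inverts
      lift := fun F hF => Localization.Construction.lift F
        (fun _ _ f hf => hF f (W.le_multiplicativeClosure f hf))
      fac := fun _ _ => Localization.Construction.fac _ _
      uniq := fun _ _ h => Localization.Construction.uniq _ _ h }
    { inverts := isInvertedBy_multiplicativeClosure W W.Q W.Q_inverts
      lift := fun F hF => Localization.Construction.lift F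
        (fun _ _ f hf => hF f (W.le_multiplicativeClosure f hf))
      fac := fun _ _ => Localization.Construction.fac _ _
      uniq := fun _ _ h => Localization.Construction.uniq _ _ h }

lemma IsThick.closure_square (hS : IsThick S) {X X' : HoFact P} (s : X ⟶ X')
    (hs : (verdierW S).multiplicativeClosure s) : ∀ {Y : HoFact P} (f : X ⟶ Y),
    ∃ (Z : HoFact P) (t : Y ⟶ Z) (f' : X' ⟶ Z),
      (verdierW S).multiplicativeClosure t ∧ f ≫ t = s ≫ f' := by
  induction hs with
  | of s hs =>
    intro Y f
    obtain ⟨Z, t, f', ht, h⟩ := hS.exists_square s hs f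
    exact ⟨Z, t, f', .of _ ht, h⟩
  | id X => intro Y f; exact ⟨Y, 𝟙 _, f, .id _, by simp⟩
  | comp_of s s' _ hs' ih =>
    intro Y f
    obtain ⟨Z, t, f', ht, h⟩ := ih f
    obtain ⟨Z', t', f'', ht', h'⟩ := hS.exists_square s' hs' f'
    exact ⟨Z', t ≫ t', f'', .comp_of _ _ ht ht', by
      rw [← Category.assoc, h, Category.assoc, h', Category.assoc]⟩

lemma IsThick.closure_comp_eq (hS : IsThick S) {X X' : HoFact P} (s : X ⟶ X')
    (hs : (verdierW S).multiplicativeClosure s) : ∀ {Y : HoFact P} (f : X' ⟶ Y), s ≫ f = 0 →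
    ∃ (Z : HoFact P) (t : Y ⟶ Z), (verdierW S).multiplicativeClosure t ∧ f ≫ t = 0 := by
  induction hs with
  | of s hs =>
    intro Y f hf
    obtain ⟨Z, t, ht, h⟩ := hS.exists_comp_eq s hs f hf
    exact ⟨Z, t, .of _ ht, h⟩
  | id X => intro Y f hf; exact ⟨Y, 𝟙 _, .id _, by simpa using hf⟩
  | comp_of s s' _ hs' ih =>
    intro Y f hf
    obtain ⟨Z, t, ht, h⟩ := ih (s' ≫ f) (by simpa using hf)
    obtain ⟨Z', t', ht', h'⟩ := hS.exists_comp_eq s' hs' (f ≫ t) (by simpa using h)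
    exact ⟨Z', t ≫ t', .comp_of _ _ ht ht', by simpa using h'⟩

lemma IsThick.hasLeftCalculusOfFractions (hS : IsThick S) :
    (verdierW S).multiplicativeClosure.HasLeftCalculusOfFractions where
  exists_leftFraction := by
    intro X Y φ
    obtain ⟨Z, t, f', ht, h⟩ := hS.closure_square φ.s φ.hs φ.f
    exact ⟨⟨f', t, ht⟩, h⟩
  ext := by
    intro X' X Y f₁ f₂ s hs h
    obtain ⟨Z, t, ht, h'⟩ := hS.closure_comp_eq s hs (f₁ - f₂) (by simp [h])
    exact ⟨Z, t, ht, by simpa [sub_eq_zero] using h'⟩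

/-- The additive structure of the Verdier quotient by a thick subcategory: the unique one for
which the localization functor is additive. -/
abbrev IsThick.preadditive (hS : IsThick S) : Preadditive (VerdierQuotient S) :=
  letI := hS.hasLeftCalculusOfFractions
  Localization.preadditive (verdierW S).Q (verdierW S).multiplicativeClosure

lemma IsThick.additive (hS : IsThick S) :
    letI := hS.preadditive
    (verdierW S).Q.Additive :=
  letI := hS.hasLeftCalculusOfFractions
  Localization.functor_additive (verdierW S).Q (verdierW S).multiplicativeClosure

end Localization

/-! ### Totalizations and acyclic factorizations -/

/-- A factorization `T` with the data of the morphisms `T ⟶ Z` induced by morphisms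
`f : X 0 ⟶ Z` with `d 0 ≫ f = 0`. -/
structure TotData {X₀ X₁ : Factorization P} (d : X₁ ⟶ X₀) where
  /-- the factorization -/
  T : Factorization P
  /-- the induced morphisms -/
  desc : ∀ {Z : Factorization P} (f : X₀ ⟶ Z), d ≫ f = 0 → (T ⟶ Z)
  desc_comp : ∀ {Z Z' : Factorization P} (f : X₀ ⟶ Z) (hf : d ≫ f = 0) (g : Z ⟶ Z'),
    f ≫ g = 0 → desc f hf ≫ g = 0

/-- The totalization of a complex `X n ⟶ ... ⟶ X 1 ⟶ X 0`, where `X l` is placed in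
cohomological degree `-l`, as an iterated cone: it is the cone of the
morphism `tot (X n ⟶ ... ⟶ X 1) ⟶ X 0` induced by the differential `X 1 ⟶ X 0`. As an object
of `C ⨯ C` it is the direct sum of the `(X l)[l]`. -/
def totData : ∀ (_ : ℕ) (X : ℕ → Factorization P) (d : ∀ l, X (l + 1) ⟶ X l)
    (_ : ∀ l, d (l + 1) ≫ d l = 0), TotData (d 0)
  | 0, X, d, _ =>
    { T := X 0
      desc := fun f _ => f
      desc_comp := fun _ _ _ h => h }
  | n + 1, X, d, hd =>
    let A := totData n (fun l => X (l + 1)) (fun l => d (l + 1)) (fun l => hd (l + 1))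
    { T := cone (A.desc (d 0) (hd 0))
      desc := fun f hf => coneDesc _ f 0 0
        (by
          have h := congrArg Hom.f0 (A.desc_comp (d 0) (hd 0) f hf)
          rw [comp_f0, zero_f0] at h
          simp [h])
        (by
          have h := congrArg Hom.fm (A.desc_comp (d 0) (hd 0) f hf)
          rw [comp_fm, zero_fm] at h
          simp [h])
      desc_comp := fun f hf g h => by
        have hm := congrArg Hom.fm h
        have h0 := congrArg Hom.f0 h
        rw [comp_fm, zero_fm] at hm
        rw [comp_f0, zero_f0] at h0
        ext <;> simp [coneDesc, hm, h0] }

/-- The totalization `⨁ K^l[-l]` of a complex `K` of factorizations concentrated in the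
degrees `a - n, ..., a`. -/
def tot (K : CochainComplex (Factorization P) ℤ) (a : ℤ) (n : ℕ) : Factorization P :=
  (shiftEquiv P ^ (-a)).functor.obj
    (totData n (fun l => K.X (a - l)) (fun l => K.d (a - (l + 1 : ℕ)) (a - l))
      (fun _ => K.d_comp_d _ _ _)).T

/-- `T` is the totalization of a bounded exact complex of factorizations. Exactness in the
abelian category of factorizations is exactness of both components. -/
def IsTotOfBoundedExact (T : Factorization P) : Prop :=
  ∃ (K : CochainComplex (Factorization P) ℤ) (a : ℤ) (n : ℕ),
    (∀ i : ℤ, i < a - n ∨ a < i → IsZero (K.X i)) ∧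
    (((evm P).mapHomologicalComplex _).obj K).Acyclic ∧
    (((ev0 P).mapHomologicalComplex _).obj K).Acyclic ∧
    T = tot K a n

variable (P) in
/-- The totally acyclic factorizations: the smallest thick subcategory of `K(Fact w)` containing
the totalizations of all bounded exact complexes. -/
def acycl : ObjectProperty (HoFact P) := fun X =>
  ∀ S : ObjectProperty (HoFact P), IsThick S →
    (∀ T : Factorization P, IsTotOfBoundedExact T → S ((toHo P).obj T)) → S X

variable (P) in
/-- The co-acyclic factorizations: the smallest thick subcategory of `K(Fact w)` containing
the totalizations of all bounded exact complexes and closed under small coproducts. -/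
def coacycl : ObjectProperty (HoFact P) := fun X =>
  ∀ S : ObjectProperty (HoFact P), IsThick S →
    (∀ T : Factorization P, IsTotOfBoundedExact T → S ((toHo P).obj T)) →
    (∀ ι : Type v, S.IsClosedUnderColimitsOfShape (Discrete ι)) → S X

lemma isThick_acycl : IsThick (acycl P) where
  zero X hX _ hS _ := hS.zero X hX
  shift E :=
    ⟨fun h S hS hT => (hS.shift E).1 (h S hS hT), fun h S hS hT => (hS.shift E).2 (h S hS hT)⟩
  cone _ _ g hE hF S hS hT := hS.cone g (hE S hS hT) (hF S hS hT)
  retract X Y r hY S hS hT := hS.retract X Y r (hY S hS hT)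

lemma isThick_coacycl : IsThick (coacycl P) where
  zero X hX _ hS _ _ := hS.zero X hX
  shift E :=
    ⟨fun h S hS hT hc => (hS.shift E).1 (h S hS hT hc),
      fun h S hS hT hc => (hS.shift E).2 (h S hS hT hc)⟩
  cone _ _ g hE hF S hS hT hc := hS.cone g (hE S hS hT hc) (hF S hS hT hc)
  retract X Y r hY S hS hT hc := hS.retract X Y r (hY S hS hT hc)

variable (P) in
/-- The absolute derived category of factorizations. -/
abbrev DAbs := VerdierQuotient (acycl P)

variable (P) in
/-- The co-derived category of factorizations. -/
abbrev DCo := VerdierQuotient (coacycl P)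

instance : Preadditive (DAbs P) := isThick_acycl.preadditive
instance : Preadditive (DCo P) := isThick_coacycl.preadditive

/-- The group `Hom(E, F[r])` in the absolute derived category. -/
abbrev HomAbs (E F : Factorization P) (r : ℤ) : Type (max u v) :=
  (toVerdier (acycl P)).obj E ⟶ (toVerdier (acycl P)).obj ((shiftEquiv P ^ r).functor.obj F)

/-- The group `Hom(E, F[r])` in the co-derived category. -/
abbrev HomCo (E F : Factorization P) (r : ℤ) : Type (max u v) :=
  (toVerdier (coacycl P)).obj E ⟶ (toVerdier (coacycl P)).obj ((shiftEquiv P ^ r).functor.obj F)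

end Additive

end Factorization

/-- The group `Ext^n(X, Y)` for `n : ℤ`, which is zero for `n < 0`. -/
def extGroup {C : Type u} [Category.{v} C] [Abelian C] (X Y : C) :
    ℤ → AddCommGrpCat.{max u v}
  | Int.ofNat n =>
    letI : HasExt.{max u v} C := HasExt.standard C
    AddCommGrpCat.of (Abelian.Ext.{max u v} X Y n)
  | Int.negSucc _ => AddCommGrpCat.of PUnit

/-- Spectral sequences of abelian groups, starting at the first page, with differentials
`d_r : E_r^{p,q} ⟶ E_r^{p-r,q+1}`, as for an increasing filtration of a cochain complex with
`E_0^{p,q}` the degree `q` part of the `p`-th graded piece. -/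
abbrev FiltSpectralSequence :=
  SpectralSequence AddCommGrpCat.{w} (fun r : ℤ => ComplexShape.up' ((-r, 1) : ℤ × ℤ)) 1

/-- A spectral sequence converges strongly to graded abelian groups `H^n` if there is an
exhaustive, separated and complete increasing filtration `F_p H^n` such that every `E_r^{p,q}`
eventually becomes stationary, with value isomorphic to `F_p H^q / F_{p-1} H^q`. -/
structure StronglyConvergesTo (E : FiltSpectralSequence.{w}) (H : ℤ → Type w)
    [∀ n, AddCommGroup (H n)] : Prop where
  exists_filtration : ∃ F : ∀ n : ℤ, ℤ → AddSubgroup (H n),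
    (∀ n, Monotone (F n)) ∧
    (∀ n (x : H n), ∃ p, x ∈ F n p) ∧
    (∀ n (x : H n), (∀ p, x ∈ F n p) → x = 0) ∧
    (∀ n (x : ℤ → H n), (∀ p p', p' ≤ p → x p' - x p ∈ F n p) →
      ∃ y : H n, ∀ p, y - x p ∈ F n p) ∧
    (∀ p q : ℤ, ∃ (r : ℤ) (hr : 1 ≤ r),
      (∀ (r' : ℤ) (hr' : r ≤ r') (i : ℤ × ℤ),
        (E.page r' (hr.trans hr')).d (p, q) i = 0 ∧
        (E.page r' (hr.trans hr')).d i (p, q) = 0) ∧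
      Nonempty ((E.page r hr).X (p, q) ≃+
        F q p ⧸ (F q (p - 1)).addSubgroupOf (F q p)))

end

set_option linter.unusedSectionVars false

noncomputable section

/-! ### The spectral sequence of a filtered differential group -/

/-! Resolve `F` inside `Fact(w)` by factorizations `I n` with injective components; the cofree
factorization on injective hulls of the components receives a componentwise monomorphism, so such a
resolution exists (`exists_injRes`). Let `Gr E G` be the pairs of component maps subject to no
compatibility. The defect `Gr.δ : Gr E G ⟶ Gr E G[1]` has square zero because `w` is natural; its
kernel consists of the morphisms `E ⟶ G`, its image of the null-homotopic morphisms `E ⟶ G[1]`.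
Hence the groups `Gr E (I n)[m]` form a double complex, placed in total degree `n + m` and filtered
by `-m`. On graded pieces only the differential of the resolution survives, and each component of it
is an injective resolution of a component of `F[-p]`. The first page therefore consists of Ext
groups, and since `[2]` acts on components as `Φ`, it has one shape for even `p` and another for odd
`p`.

If the components of `F` have finite injective dimension, the resolution can be taken bounded. The
filtration is then finite in each degree, and the spectral sequence converges to the cohomology of
the total complex (`FiltDiff.stronglyConvergesTo`). It remains to identify this cohomology with
`Hom(E, F[q])` in a Verdier quotient by a thick `S`, for which two facts suffice.

A bounded resolution has a totalization `J` with injective components, an iterated twisted extension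
of translates of the `I n`. It represents a degree of the total complex, and the augmentation `F[q]
⟶ J[1]` has its cone in `S` as soon as `S` contains the totalizations of bounded exact complexes
(`exists_totalization`).

Factorizations with injective components receive only zero maps from such totalizations
(`isOrthIso_totData`). The objects with this property form a thick subcategory closed under
coproducts, so it contains the totally acyclic and the co-acyclic factorizations. Consequently maps
into `J[1]` are the same in `K(Fact w)` and in the quotient (`bijective_toVerdier_map`). Both
quotients are thus instances of a single argument in `S`. -/

lemma nonempty_quotient_addEquiv {A B : Type*} [AddCommGroup A] [AddCommGroup B] (f : A →+ B)
    (hf : Function.Surjective f) (N : AddSubgroup A) (hN : ∀ x, f x = 0 ↔ x ∈ N) :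
    Nonempty (A ⧸ N ≃+ B) := by
  obtain rfl : f.ker = N := by ext x; exact hN x
  exact ⟨QuotientAddGroup.quotientKerEquivOfSurjective f hf⟩

/-- Homology is presented by any group `G` of cycles that meets every class, divided by the elements
that become boundaries. Here `G` will be `Z (r + 1) p q`, so the cycles of a page, themselves
classes in a quotient, need not be described. -/
lemma nonempty_homology_iso_quotient (S : ShortComplex AddCommGrpCat.{w}) {G : Type w}
    [AddCommGroup G] (φ : G →+ S.X₂) (h₁ : ∀ x, S.g (φ x) = 0)
    (h₂ : ∀ z : S.X₂, S.g z = 0 → ∃ x y, z = φ x + S.f y)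
    (N : AddSubgroup G) (hN : ∀ x, x ∈ N ↔ ∃ y, S.f y = φ x) :
    Nonempty (S.homology ≅ AddCommGrpCat.of (G ⧸ N)) := by
  let ψ : G →+ (AddMonoidHom.ker S.g.hom) ⧸ AddMonoidHom.range S.abToCycles :=
    (QuotientAddGroup.mk' _).comp (φ.codRestrict _ h₁)
  obtain ⟨e⟩ := nonempty_quotient_addEquiv ψ (by
    intro z
    obtain ⟨⟨z, hz⟩, rfl⟩ := QuotientAddGroup.mk_surjective z
    obtain ⟨x, y, rfl⟩ := h₂ z hz
    refine ⟨x, ?_⟩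
    refine QuotientAddGroup.eq.2 ⟨y, ?_⟩
    apply Subtype.ext
    change S.f y = -φ x + (φ x + S.f y)
    abel) N (by
    intro x
    rw [hN]
    refine (QuotientAddGroup.eq_zero_iff _).trans ⟨?_, ?_⟩
    · rintro ⟨y, hy⟩
      exact ⟨y, congrArg Subtype.val hy⟩
    · rintro ⟨y, hy⟩
      exact ⟨y, Subtype.ext hy⟩)
  exact ⟨S.abHomologyIso ≪≫ e.symm.toAddCommGrpIso⟩

/-- An abelian group with a differential and an increasing filtration of its graded pieces. -/
structure FiltDiff (M : Type w) [AddCommGroup M] where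
  /-- the differential -/
  d : M →+ M
  d_d : ∀ x, d (d x) = 0
  /-- `F p q` is the `p`-th step of the filtration of the piece of degree `q` -/
  F : ℤ → ℤ → AddSubgroup M
  mono : ∀ {p p' : ℤ} (q : ℤ), p ≤ p' → F p q ≤ F p' q
  d_mem : ∀ {p q q' : ℤ} {x : M}, q' = q + 1 → x ∈ F p q → d x ∈ F p q'

namespace FiltDiff

variable {M : Type w} [AddCommGroup M] (X : FiltDiff M)

/-- The elements `x ∈ F_p` with `d x ∈ F_{p-r}`. -/
def Z (r p q : ℤ) : AddSubgroup M := X.F p q ⊓ (X.F (p - r) (q + 1)).comap X.d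

/-- The subgroup by which `Z r p q` is divided in the `r`-th page. -/
def B (r p q : ℤ) : AddSubgroup M :=
  X.Z (r - 1) (p - 1) q ⊔ (X.Z (r - 1) (p + r - 1) (q - 1)).map X.d

lemma mem_Z {r p q : ℤ} {x : M} : x ∈ X.Z r p q ↔ x ∈ X.F p q ∧ X.d x ∈ X.F (p - r) (q + 1) :=
  Iff.rfl

lemma mem_B {r p q : ℤ} {x : M} : x ∈ X.B r p q ↔
    ∃ z ∈ X.Z (r - 1) (p - 1) q, ∃ y ∈ X.Z (r - 1) (p + r - 1) (q - 1), x = z + X.d y := by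
  rw [B, AddSubgroup.mem_sup]
  constructor
  · rintro ⟨z, hz, _, ⟨y, hy, rfl⟩, rfl⟩
    exact ⟨z, hz, y, hy, rfl⟩
  · rintro ⟨z, hz, y, hy, rfl⟩
    exact ⟨z, hz, _, ⟨y, hy, rfl⟩, rfl⟩

/-- The entry `(p, q)` of the `r`-th page. -/
abbrev E (r p q : ℤ) : Type w := X.Z r p q ⧸ (X.B r p q).addSubgroupOf (X.Z r p q)

lemma d_mem_Z {r p q p' q' : ℤ} (hp : p' = p - r) (hq : q' = q + 1) {x : M}
    (hx : x ∈ X.Z r p q) : X.d x ∈ X.Z r p' q' := by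
  subst hp hq
  exact ⟨hx.2, by simp [X.d_d]⟩

lemma d_mem_B {r p q p' q' : ℤ} (hp : p' = p - r) (hq : q' = q + 1) {x : M}
    (hx : x ∈ X.B r p q) : X.d x ∈ X.B r p' q' := by
  subst hp hq
  obtain ⟨z, hz, y, hy, rfl⟩ := X.mem_B.1 hx
  refine X.mem_B.2 ⟨0, zero_mem _, z, ?_, by simp [X.d_d]⟩
  have h₁ : p - r + r - 1 = p - 1 := by ring
  have h₂ : q + 1 - 1 = q := by ring
  rwa [h₁, h₂]

/-- The differential of the `r`-th page. -/
def dE {r p q p' q' : ℤ} (hp : p' = p - r) (hq : q' = q + 1) : X.E r p q →+ X.E r p' q' :=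
  QuotientAddGroup.map _ _
    ((X.d.comp (X.Z r p q).subtype).codRestrict (X.Z r p' q') (fun x => X.d_mem_Z hp hq x.2))
    (fun _ hx => X.d_mem_B hp hq hx)

lemma dE_mk {r p q p' q' : ℤ} (hp : p' = p - r) (hq : q' = q + 1) (x : X.Z r p q) :
    X.dE hp hq (QuotientAddGroup.mk x) = QuotientAddGroup.mk ⟨X.d x, X.d_mem_Z hp hq x.2⟩ := rfl

lemma mk_eq_mk {r p q : ℤ} (x y : X.Z r p q) :
    (QuotientAddGroup.mk x : X.E r p q) = QuotientAddGroup.mk y ↔ -x.1 + y.1 ∈ X.B r p q :=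
  QuotientAddGroup.eq

lemma mk_eq_zero {r p q : ℤ} (x : X.Z r p q) :
    (QuotientAddGroup.mk x : X.E r p q) = 0 ↔ x.1 ∈ X.B r p q :=
  (QuotientAddGroup.eq_zero_iff _)

/-- The `r`-th page. -/
def page (r : ℤ) :
    HomologicalComplex AddCommGrpCat.{w} (ComplexShape.up' ((-r, 1) : ℤ × ℤ)) where
  X i := AddCommGrpCat.of (X.E r i.1 i.2)
  d i j := if h : j.1 = i.1 - r ∧ j.2 = i.2 + 1 then AddCommGrpCat.ofHom (X.dE h.1 h.2) else 0
  shape i j h := dif_neg (fun h' => h (Prod.ext (by simp [h'.1]; ring) (by simp [h'.2])))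
  d_comp_d' i j k h₁ h₂ := by
    obtain rfl : i + (-r, 1) = j := h₁
    obtain rfl : i + (-r, 1) + (-r, 1) = k := h₂
    rw [dif_pos ⟨by simp; ring, by simp⟩, dif_pos ⟨by simp; ring, by simp⟩]
    ext x
    change X.dE (p' := i.1 + -r + -r) (q' := i.2 + 1 + 1) (by ring) rfl
      (X.dE (p' := i.1 + -r) (q' := i.2 + 1) (by ring) rfl (QuotientAddGroup.mk x)) = 0
    rw [dE_mk, dE_mk, mk_eq_zero]
    simp [X.d_d]

lemma page_d {r : ℤ} {i j : ℤ × ℤ} (h₁ : j.1 = i.1 - r) (h₂ : j.2 = i.2 + 1) :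
    (X.page r).d i j = AddCommGrpCat.ofHom (X.dE h₁ h₂) := dif_pos ⟨h₁, h₂⟩

/-- The inclusion of `Z (r + 1)` in `Z r` induces the isomorphism. A class on page `r` is a cycle
when `d x` can be pushed one step further down after correcting `x` by an element of `B r`, and the
boundaries are exactly what `B (r + 1)` adds. -/
lemma nonempty_homology_page_iso (r r' : ℤ) (i : ℤ × ℤ) (h : r + 1 = r') :
    Nonempty ((X.page r).homology i ≅ (X.page r').X i) := by
  subst h
  obtain ⟨p, q⟩ := i
  have hprev : (ComplexShape.up' ((-r, 1) : ℤ × ℤ)).prev (p, q) = (p + r, q - 1) :=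
    ComplexShape.prev_eq' _ (show (p + r, q - 1) + (-r, 1) = (p, q) by ext <;> simp)
  have hnext : (ComplexShape.up' ((-r, 1) : ℤ × ℤ)).next (p, q) = (p - r, q + 1) :=
    ComplexShape.next_eq' _ (show (p, q) + (-r, 1) = (p - r, q + 1) by ext <;> simp; ring)
  have hZ : X.Z (r + 1) p q ≤ X.Z r p q := fun x hx => ⟨hx.1, X.mono _ (by lia) hx.2⟩
  let φ : X.Z (r + 1) p q →+ X.E r p q :=
    (QuotientAddGroup.mk' _).comp (AddSubgroup.inclusion hZ)
  have hφ : ∀ x, φ x = QuotientAddGroup.mk ⟨x.1, hZ x.2⟩ := fun _ => rfl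
  have key : Nonempty (((X.page r).sc' (p + r, q - 1) (p, q) (p - r, q + 1)).homology ≅
      AddCommGrpCat.of (X.E (r + 1) p q)) := by
    refine nonempty_homology_iso_quotient _ φ ?_ ?_ _ ?_
    · intro x
      change (X.page r).d (p, q) (p - r, q + 1) (φ x) = 0
      rw [page_d X rfl rfl]
      change X.dE (p' := p - r) (q' := q + 1) rfl rfl (φ x) = 0
      rw [hφ, dE_mk, mk_eq_zero, mem_B]
      refine ⟨X.d x, ⟨?_, by simp [X.d_d]⟩, 0, zero_mem _, by simp⟩
      have : p - (r + 1) = p - r - 1 := by ring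
      rw [← this]
      exact x.2.2
    · intro z hz
      obtain ⟨x, rfl⟩ := QuotientAddGroup.mk_surjective z
      have hz' : (X.page r).d (p, q) (p - r, q + 1) (QuotientAddGroup.mk x) = 0 := hz
      rw [page_d X rfl rfl] at hz'
      have hz'' : X.dE (p' := p - r) (q' := q + 1) rfl rfl (QuotientAddGroup.mk x) = 0 := hz'
      rw [dE_mk, mk_eq_zero, mem_B] at hz''
      obtain ⟨z, hz, y, hy, hxy⟩ := hz''
      have e₁ : p - r + r - 1 = p - 1 := by ring
      have e₂ : q + 1 - 1 = q := by ring
      have e₃ : p - (r + 1) = p - r - 1 := by ring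
      rw [e₁, e₂] at hy
      -- The element `y` lies in `Z (r - 1) (p - 1) q`, hence in `B r p q`: subtracting it keeps the
      -- class and leaves `d (x - y) = z` one filtration step lower.
      refine ⟨⟨x.1 - y, X.mem_Z.2 ⟨sub_mem x.2.1 (X.mono _ (by lia) hy.1), ?_⟩⟩, 0, ?_⟩
      · have hd : X.d (x.1 - y) = z := by
          rw [map_sub, sub_eq_iff_eq_add]
          exact hxy
        rw [hd, e₃]
        exact hz.1
      · rw [map_zero, add_zero]
        refine (X.mk_eq_mk _ _).2 ?_
        refine X.mem_B.2 ⟨-y, neg_mem hy, 0, zero_mem _, by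
          rw [map_zero, add_zero]
          change -x.1 + (x.1 - y) = -y
          abel⟩
    · intro x
      have : x ∈ (X.B (r + 1) p q).addSubgroupOf (X.Z (r + 1) p q) ↔ x.1 ∈ X.B (r + 1) p q := Iff.rfl
      rw [this, mem_B]
      have e₁ : r + 1 - 1 = r := by ring
      have e₂ : p + (r + 1) - 1 = p + r := by ring
      rw [e₁, e₂]
      constructor
      · rintro ⟨z, hz, y, hy, hx⟩
        refine ⟨QuotientAddGroup.mk ⟨y, hy⟩, ?_⟩
        change (X.page r).d (p + r, q - 1) (p, q) _ = φ x
        rw [page_d X (by simp) (by simp)]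
        refine (X.mk_eq_mk _ _).2 (X.mem_B.2 ⟨z, ⟨hz.1, X.mono _ (by lia) hz.2⟩, 0, zero_mem _, ?_⟩)
        change -X.d y + x.1 = _
        rw [hx]
        simp
      · rintro ⟨y, hy⟩
        obtain ⟨y, rfl⟩ := QuotientAddGroup.mk_surjective y
        have hy' : (X.page r).d (p + r, q - 1) (p, q) (QuotientAddGroup.mk y) = φ x := hy
        rw [page_d X (by simp) (by simp)] at hy'
        have hy'' : X.dE (p' := p) (q' := q) (by simp) (by simp) (QuotientAddGroup.mk y) = φ x := hy'
        rw [dE_mk, hφ] at hy''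
        have hb : -X.d y + x.1 ∈ X.B r p q := (X.mk_eq_mk _ _).1 hy''
        obtain ⟨z, hz, y', hy', e⟩ := X.mem_B.1 hb
        -- The preimage `y` bounds `x` only modulo `B r p q`; the part `y'` of the error is absorbed
        -- in the preimage.
        have hx : x.1 = z + X.d (y + y') := by
          rw [map_add, add_left_comm, ← e, add_neg_cancel_left]
        refine ⟨z, X.mem_Z.2 ⟨hz.1, ?_⟩, y + y', add_mem y.2 (X.mem_Z.2 ⟨X.mono _ (by lia) hy'.1, ?_⟩),
          hx⟩
        · have : X.d z = X.d x := by rw [hx]; simp [X.d_d]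
          rw [this]
          have e₃ : p - 1 - r = p - (r + 1) := by ring
          rw [e₃]
          exact x.2.2
        · have e₄ : p + r - r = p + r - 1 - (r - 1) := by ring
          rw [e₄]
          exact hy'.2
  obtain ⟨e⟩ := key
  exact ⟨ShortComplex.homologyMapIso ((X.page r).isoSc' _ _ _ hprev hnext) ≪≫ e⟩

/-- The spectral sequence of a filtered differential group. -/
def spectralSequence : FiltSpectralSequence.{w} where
  page r _ := X.page r
  iso r r' i h _ := (X.nonempty_homology_page_iso r r' i h).some

lemma subsingleton_E {r p q : ℤ} (h : X.Z r p q ≤ X.B r p q) (x : X.E r p q) : x = 0 := by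
  obtain ⟨x, rfl⟩ := QuotientAddGroup.mk_surjective x
  exact (X.mk_eq_zero x).2 (h x.2)

/-- The spectral sequence of a filtration that is finite in each degree converges strongly to the
cohomology of the differential. -/
lemma stronglyConvergesTo (K : ℤ → AddSubgroup M) (hK : ∀ p q, X.F p q ≤ K q)
    (a b : ℤ) (ha : ∀ p q, p + q < a → X.F p q = ⊥) (hb : ∀ p q, b ≤ p + q → X.F p q = K q)
    (H : ℤ → Type w) [∀ q, AddCommGroup (H q)]
    (f : ∀ q, (K q ⊓ X.d.ker : AddSubgroup M) →+ H q) (hf : ∀ q, Function.Surjective (f q))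
    (hf' : ∀ q x, f q x = 0 ↔ ∃ y ∈ K (q - 1), X.d y = x) :
    StronglyConvergesTo X.spectralSequence H := by
  -- The induced filtration: classes having a cocycle representative in `F p q`.
  let FH : ∀ q : ℤ, ℤ → AddSubgroup (H q) := fun q p =>
    ((X.F p q).addSubgroupOf (K q ⊓ X.d.ker)).map (f q)
  have hFH : ∀ {q p : ℤ} {x : H q}, x ∈ FH q p ↔ ∃ y, ∃ hy : y ∈ K q ⊓ X.d.ker,
      y ∈ X.F p q ∧ f q ⟨y, hy⟩ = x := by
    intro q p x
    constructor
    · rintro ⟨⟨y, hy⟩, hy', rfl⟩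
      exact ⟨y, hy, hy', rfl⟩
    · rintro ⟨y, hy, hy', rfl⟩
      exact ⟨⟨y, hy⟩, hy', rfl⟩
  have hmono : ∀ q, Monotone (FH q) := by
    intro q p p' h x hx
    obtain ⟨y, hy, hy', rfl⟩ := hFH.1 hx
    exact hFH.2 ⟨y, hy, X.mono _ h hy', rfl⟩
  have htop : ∀ (q p : ℤ), b ≤ p + q → ∀ x, x ∈ FH q p := by
    intro q p h x
    obtain ⟨⟨y, hy⟩, rfl⟩ := hf q x
    exact hFH.2 ⟨y, hy, by rw [hb _ _ h]; exact hy.1, rfl⟩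
  have hbot : ∀ (q p : ℤ), p + q < a → ∀ x ∈ FH q p, x = 0 := by
    intro q p h x hx
    obtain ⟨y, hy, hy', rfl⟩ := hFH.1 hx
    rw [ha _ _ h] at hy'
    obtain rfl : y = 0 := hy'
    exact (hf' q ⟨0, hy⟩).2 ⟨0, zero_mem _, by simp⟩
  refine ⟨FH, hmono, fun q x => ⟨b - q, htop _ _ (by lia) x⟩,
    fun q x hx => hbot q (a - q - 1) (by lia) x (hx _), ?_, ?_⟩
  · intro q x hx
    -- At index `a - q - 1` the filtration is already zero, so the family is constant from there
    -- downwards and this entry is its limit.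
    refine ⟨x (a - q - 1), fun p => ?_⟩
    rcases le_total (a - q - 1) p with h | h
    · exact hx p _ h
    · have := hbot q _ (by lia) _ (hx (a - q - 1) p h)
      rw [sub_eq_zero.1 this, sub_self]
      exact zero_mem _
  · intro p q
    -- From this `r` on, `F (p - r) (q + 1)` is zero and `F (p + r - 1) (q - 1)` is all of `K (q -
    -- 1)`: outgoing differentials land in zero, and every coboundary in degree `q` is seen by `B r
    -- p q`.
    let r : ℤ := max 1 (max (p + q - a + 3) (b - p - q + 3))
    have hr₁ : 1 ≤ r := le_max_left _ _
    have hr₂ : p + q - a + 3 ≤ r := (le_max_left _ _).trans (le_max_right _ _)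
    have hr₃ : b - p - q + 3 ≤ r := (le_max_right _ _).trans (le_max_right _ _)
    refine ⟨r, hr₁, fun r' hr' ⟨p', q'⟩ => ⟨?_, ?_⟩, ?_⟩
    · by_cases h : (ComplexShape.up' ((-r', 1) : ℤ × ℤ)).Rel (p, q) (p', q')
      · obtain ⟨h₁, h₂⟩ : p + -r' = p' ∧ q + 1 = q' := Prod.mk.inj h
        have : X.F p' q' = ⊥ := ha _ _ (by lia)
        ext x
        refine X.subsingleton_E ?_ _
        rintro y ⟨hy, -⟩
        rw [this] at hy
        obtain rfl : y = 0 := hy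
        exact zero_mem _
      · exact HomologicalComplex.shape _ _ _ h
    · by_cases h : (ComplexShape.up' ((-r', 1) : ℤ × ℤ)).Rel (p', q') (p, q)
      · obtain ⟨h₁, h₂⟩ : p' + -r' = p ∧ q' + 1 = q := Prod.mk.inj h
        have h₃ : ∀ x : X.E r' p' q', x = 0 := fun x => by
          refine X.subsingleton_E ?_ x
          rintro y ⟨hy₁, hy₂⟩
          -- The source entry is zero: the filtration is already full at `p' - 1`, so every `y` lies
          -- in the first summand of `B`.
          refine X.mem_B.2 ⟨y, ⟨?_, ?_⟩, 0, zero_mem _, by simp⟩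
          · rw [hb _ _ (by lia)]
            exact hK _ _ hy₁
          · have e : p' - 1 - (r' - 1) = p' - r' := by ring
            rw [e]
            exact hy₂
        ext x
        have hx : x = 0 := h₃ x
        rw [hx, map_zero, map_zero]
      · exact HomologicalComplex.shape _ _ _ h
    · have hZ : ∀ x ∈ X.Z r p q, x ∈ K q ⊓ X.d.ker := by
        rintro x ⟨h₁, h₂⟩
        have : X.F (p - r) (q + 1) = ⊥ := ha _ _ (by lia)
        rw [this] at h₂
        exact ⟨hK _ _ h₁, h₂⟩
      let g : X.Z r p q →+ FH q p :=
        ((f q).comp (AddSubgroup.inclusion hZ)).codRestrict _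
          (fun x => hFH.2 ⟨x.1, hZ _ x.2, x.2.1, rfl⟩)
      have hg : ∀ x, (g x).1 = f q ⟨x.1, hZ _ x.2⟩ := fun _ => rfl
      refine nonempty_quotient_addEquiv ((QuotientAddGroup.mk' _).comp g) ?_ _ ?_
      · intro z
        obtain ⟨⟨z, hz⟩, rfl⟩ := QuotientAddGroup.mk_surjective z
        obtain ⟨y, hy, hy', rfl⟩ := hFH.1 hz
        have hdy : X.d y = 0 := hy.2
        exact ⟨⟨y, hy', by simp [hdy]⟩, rfl⟩
      · intro x
        refine (QuotientAddGroup.eq_zero_iff _).trans ?_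
        change (g x).1 ∈ FH q (p - 1) ↔ x.1 ∈ X.B r p q
        rw [hg, hFH, mem_B]
        have hKb : X.F (p + r - 1) (q - 1) = K (q - 1) := hb _ _ (by lia)
        constructor
        · rintro ⟨y, hy, hy', e⟩
          have hdy : X.d y = 0 := hy.2
          rw [eq_comm, ← sub_eq_zero, ← map_sub] at e
          obtain ⟨t, ht, ht'⟩ := (hf' q _).1 e
          have ht'' : X.d t = x.1 - y := ht'
          refine ⟨y, ⟨hy', by simp [hdy]⟩, t, X.mem_Z.2 ⟨by rwa [hKb], ?_⟩, by rw [ht'']; abel⟩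
          rw [ht'']
          have e₁ : p + r - 1 - (r - 1) = p := by ring
          have e₂ : q - 1 + 1 = q := by ring
          rw [e₁, e₂]
          exact sub_mem x.2.1 (X.mono _ (by lia) hy')
        · rintro ⟨z, hz, y, hy, e⟩
          have hdx : X.d x.1 = 0 := (hZ _ x.2).2
          have hdz : X.d z = 0 := by
            rw [e] at hdx
            simpa [X.d_d] using hdx
          refine ⟨z, ⟨hK _ _ hz.1, hdz⟩, hz.1, ?_⟩
          rw [eq_comm, ← sub_eq_zero, ← map_sub, hf']
          refine ⟨y, by rw [← hKb]; exact hy.1, ?_⟩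
          change _ = x.1 - z
          rw [e]
          abel

end FiltDiff

/-! ### Powers of an autoequivalence -/

namespace CategoryTheory.Equivalence

variable {D : Type u} [Category.{v} D] (e : D ≌ D)

lemma nonempty_powNat_succ_iso (n : ℕ) :
    Nonempty ((e.powNat (n + 1)).functor ≅ e.functor ⋙ (e.powNat n).functor) := by
  cases n with
  | zero => exact ⟨Iso.refl _⟩
  | succ n => exact ⟨Iso.refl _⟩

/-- The recursion for powers composes on one side; this moves the new factor to the other side, as
needed to apply `e` after a power. -/
lemma nonempty_powNat_succ_iso' (n : ℕ) :
    Nonempty ((e.powNat (n + 1)).functor ≅ (e.powNat n).functor ⋙ e.functor) := by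
  induction n with
  | zero => exact ⟨Iso.refl _⟩
  | succ n ih =>
    obtain ⟨i⟩ := ih
    obtain ⟨j⟩ := e.nonempty_powNat_succ_iso n
    obtain ⟨k⟩ := e.nonempty_powNat_succ_iso (n + 1)
    exact ⟨k ≪≫ Functor.isoWhiskerLeft e.functor i ≪≫ (Functor.associator _ _ _).symm ≪≫
      Functor.isoWhiskerRight j.symm e.functor⟩

/-- For negative exponents the factor `e` cancels one copy of its inverse through the counit. Mere
existence of the isomorphism is enough, since only isomorphism classes of components matter later.
-/
lemma nonempty_pow_comp_iso (m m' : ℤ) (h : m + 1 = m') :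
    Nonempty ((e ^ m).functor ⋙ e.functor ≅ (e ^ m').functor) := by
  subst h
  rcases m with n | n
  · obtain ⟨i⟩ := e.nonempty_powNat_succ_iso' n
    exact ⟨i.symm⟩
  · obtain ⟨i⟩ := e.symm.nonempty_powNat_succ_iso' n
    have : (e ^ (Int.negSucc n + 1)).functor = (e.symm.powNat n).functor := by
      cases n <;> rfl
    rw [this]
    exact ⟨Functor.isoWhiskerRight i e.functor ≪≫ Functor.associator _ _ _ ≪≫
      Functor.isoWhiskerLeft _ e.counitIso ≪≫ Functor.rightUnitor _⟩

end CategoryTheory.Equivalence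

/-! ### Powers of the translation and their components. -/

namespace Factorization

variable {C : Type u} [Category.{v} C] [Abelian C] {P : Potential C}

variable (P) in
/-- The functor `[m]`. -/
abbrev shiftPow (m : ℤ) : Factorization P ⥤ Factorization P := (shiftEquiv P ^ m).functor

variable (P) in
/-- The isomorphism `E[m][1] ≅ E[m + 1]`. -/
def shiftPowIso (m m' : ℤ) (h : m + 1 = m') : shiftPow P m ⋙ shift P ≅ shiftPow P m' :=
  ((shiftEquiv P).nonempty_pow_comp_iso m m' h).some

/-- A double translation is `Φ` on both components, since its signs touch only the structure
morphisms. Induction on `t` goes up by composing with `Φ`, and down by cancelling the fully faithful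
`Φ`. -/
lemma nonempty_shiftPow_evm_ev0_iso (t : ℤ) :
    Nonempty (shiftPow P (2 * t) ⋙ evm P ≅ evm P ⋙ (P.Φ ^ t).functor) ∧
    Nonempty (shiftPow P (2 * t) ⋙ ev0 P ≅ ev0 P ⋙ (P.Φ ^ t).functor) := by
  have key : ∀ t t' : ℤ, t + 1 = t' →
      Nonempty (shiftPow P (2 * t) ⋙ evm P ⋙ P.T ≅ shiftPow P (2 * t') ⋙ evm P) ∧
      Nonempty (shiftPow P (2 * t) ⋙ ev0 P ⋙ P.T ≅ shiftPow P (2 * t') ⋙ ev0 P) := by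
    intro t t' h
    let i : (shiftPow P (2 * t) ⋙ shift P) ⋙ shift P ≅ shiftPow P (2 * t') :=
      Functor.isoWhiskerRight (shiftPowIso P (2 * t) (2 * t + 1) rfl) _ ≪≫
        shiftPowIso P _ _ (by lia)
    exact ⟨⟨Functor.isoWhiskerRight i (evm P)⟩, ⟨Functor.isoWhiskerRight i (ev0 P)⟩⟩
  induction t with
  | zero => exact ⟨⟨Iso.refl _⟩, ⟨Iso.refl _⟩⟩
  | succ n ih =>
    obtain ⟨⟨i⟩, ⟨j⟩⟩ := ih
    obtain ⟨⟨k⟩, ⟨l⟩⟩ := key n (n + 1) rfl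
    obtain ⟨p⟩ := P.Φ.nonempty_pow_comp_iso n (n + 1) rfl
    exact ⟨⟨k.symm ≪≫ Functor.isoWhiskerRight i P.T ≪≫ Functor.isoWhiskerLeft (evm P) p⟩,
      ⟨l.symm ≪≫ Functor.isoWhiskerRight j P.T ≪≫ Functor.isoWhiskerLeft (ev0 P) p⟩⟩
  | pred n ih =>
    obtain ⟨⟨i⟩, ⟨j⟩⟩ := ih
    obtain ⟨⟨k⟩, ⟨l⟩⟩ := key (-n - 1) (-n) (by ring)
    obtain ⟨p⟩ := P.Φ.nonempty_pow_comp_iso (-n - 1) (-n) (by ring)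
    exact ⟨⟨Functor.fullyFaithfulCancelRight P.T
        (k ≪≫ i ≪≫ Functor.isoWhiskerLeft (evm P) p.symm)⟩,
      ⟨Functor.fullyFaithfulCancelRight P.T
        (l ≪≫ j ≪≫ Functor.isoWhiskerLeft (ev0 P) p.symm)⟩⟩

/-- The morphism `E[1] ⟶ F[1]`. -/
def shiftMap {E F : Factorization P} (f : E ⟶ F) : E.shiftObj ⟶ F.shiftObj := (shift P).map f

@[simp] lemma shiftMap_fm {E F : Factorization P} (f : E ⟶ F) : (shiftMap f).fm = f.f0 := rfl
@[simp] lemma shiftMap_f0 {E F : Factorization P} (f : E ⟶ F) :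
    (shiftMap f).f0 = P.T.map f.fm := rfl

/-! ### Graded morphisms -/

/-- Pairs of morphisms between the components of two factorizations, not required to be
compatible with their structure morphisms. -/
@[ext]
structure Gr (E F : Factorization P) : Type (max u v) where
  /-- the component `E⁻¹ ⟶ F⁻¹` -/
  fm : E.Xm ⟶ F.Xm
  /-- the component `E⁰ ⟶ F⁰` -/
  f0 : E.X0 ⟶ F.X0

namespace Gr

variable {E F G H : Factorization P}

variable (E F) in
/-- Graded morphisms as pairs. -/
def equivProd : Gr E F ≃ (E.Xm ⟶ F.Xm) × (E.X0 ⟶ F.X0) where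
  toFun x := (x.fm, x.f0)
  invFun x := ⟨x.1, x.2⟩

instance : AddCommGroup (Gr E F) := (equivProd E F).addCommGroup

@[simp] lemma zero_fm : (0 : Gr E F).fm = 0 := rfl
@[simp] lemma zero_f0 : (0 : Gr E F).f0 = 0 := rfl
@[simp] lemma add_fm (x y : Gr E F) : (x + y).fm = x.fm + y.fm := rfl
@[simp] lemma add_f0 (x y : Gr E F) : (x + y).f0 = x.f0 + y.f0 := rfl
@[simp] lemma neg_fm (x : Gr E F) : (-x).fm = -x.fm := rfl
@[simp] lemma neg_f0 (x : Gr E F) : (-x).f0 = -x.f0 := rfl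
@[simp] lemma sub_fm (x y : Gr E F) : (x - y).fm = x.fm - y.fm := rfl
@[simp] lemma sub_f0 (x y : Gr E F) : (x - y).f0 = x.f0 - y.f0 := rfl

variable (E F) in
/-- Graded morphisms as pairs, additively. -/
def addEquivProd : Gr E F ≃+ (E.Xm ⟶ F.Xm) × (E.X0 ⟶ F.X0) where
  toEquiv := equivProd E F
  map_add' _ _ := rfl

/-- The graded morphism underlying a morphism. -/
@[simps]
def ofHom (f : E ⟶ F) : Gr E F := ⟨f.fm, f.f0⟩

lemma ofHom_injective {f g : E ⟶ F} (h : ofHom f = ofHom g) : f = g :=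
  Factorization.hom_ext (congrArg Gr.fm h) (congrArg Gr.f0 h)

/-- The composition of graded morphisms. -/
@[simps]
def comp (x : Gr E F) (y : Gr F G) : Gr E G := ⟨x.fm ≫ y.fm, x.f0 ≫ y.f0⟩

lemma comp_assoc (x : Gr E F) (y : Gr F G) (z : Gr G H) :
    (x.comp y).comp z = x.comp (y.comp z) := by ext <;> simp
lemma add_comp (x y : Gr E F) (z : Gr F G) : (x + y).comp z = x.comp z + y.comp z := by
  ext <;> simp
lemma comp_add (x : Gr E F) (y z : Gr F G) : x.comp (y + z) = x.comp y + x.comp z := by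
  ext <;> simp
@[simp] lemma zero_comp (z : Gr F G) : (0 : Gr E F).comp z = 0 := by ext <;> simp
@[simp] lemma comp_zero (z : Gr E F) : z.comp (0 : Gr F G) = 0 := by ext <;> simp
lemma sub_comp (x y : Gr E F) (z : Gr F G) : (x - y).comp z = x.comp z - y.comp z := by
  ext <;> simp
lemma comp_sub (x : Gr E F) (y z : Gr F G) : x.comp (y - z) = x.comp y - x.comp z := by
  ext <;> simp
lemma neg_comp (x : Gr E F) (z : Gr F G) : (-x).comp z = -(x.comp z) := by ext <;> simp
lemma comp_neg (x : Gr E F) (z : Gr F G) : x.comp (-z) = -(x.comp z) := by ext <;> simp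
@[simp] lemma ofHom_comp (f : E ⟶ F) (g : F ⟶ G) :
    ofHom (f ≫ g) = (ofHom f).comp (ofHom g) := rfl
@[simp] lemma ofHom_zero : ofHom (0 : E ⟶ F) = 0 := rfl
@[simp] lemma ofHom_add (f g : E ⟶ F) : ofHom (f + g) = ofHom f + ofHom g := rfl
@[simp] lemma ofHom_sub (f g : E ⟶ F) : ofHom (f - g) = ofHom f - ofHom g := by ext <;> simp
@[simp] lemma comp_id (x : Gr E F) : x.comp (ofHom (𝟙 F)) = x := by ext <;> simp
@[simp] lemma id_comp (x : Gr E F) : (ofHom (𝟙 E)).comp x = x := by ext <;> simp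

/-- The composition with a fixed graded morphism. -/
@[simps]
def postcomp (E : Factorization P) (y : Gr F G) : Gr E F →+ Gr E G where
  toFun x := x.comp y
  map_zero' := zero_comp y
  map_add' _ _ := add_comp _ _ y

/-- The composition with a fixed graded morphism, on the other side. -/
@[simps]
def precomp (x : Gr E F) (G : Factorization P) : Gr F G →+ Gr E G where
  toFun y := x.comp y
  map_zero' := comp_zero x
  map_add' _ _ := comp_add x _ _

lemma units_smul_comp (a : ℤˣ) (x : Gr E F) (y : Gr F G) : (a • x).comp y = a • x.comp y := by
  simp only [Units.smul_def]
  exact map_zsmul (postcomp E y) _ _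

lemma comp_units_smul (a : ℤˣ) (x : Gr E F) (y : Gr F G) : x.comp (a • y) = a • x.comp y := by
  simp only [Units.smul_def]
  exact map_zsmul (precomp x G) _ _

/-- The graded morphism `E[1] ⟶ F[1]`. -/
@[simps]
def sh (x : Gr E F) : Gr E.shiftObj F.shiftObj := ⟨x.f0, P.T.map x.fm⟩

lemma sh_comp (x : Gr E F) (y : Gr F G) : (x.comp y).sh = x.sh.comp y.sh := by ext <;> simp

lemma sh_ofHom (f : E ⟶ F) : (ofHom f).sh = ofHom (shiftMap f) := rfl

lemma sh_add (x y : Gr E F) : (x + y).sh = x.sh + y.sh := by ext <;> simp [Functor.map_add]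
lemma sh_sub (x y : Gr E F) : (x - y).sh = x.sh - y.sh := by ext <;> simp [Functor.map_sub]

@[simp] lemma sh_zero : (0 : Gr E F).sh = 0 := by ext <;> simp

lemma sh_units_smul (a : ℤˣ) (x : Gr E F) : (a • x).sh = a • x.sh := by
  rcases Int.units_eq_one_or a with rfl | rfl
  · rw [one_smul, one_smul]
  · rw [Units.neg_smul, Units.neg_smul, one_smul, one_smul]
    ext <;> simp

lemma sh_bijective : Function.Bijective (sh : Gr E F → _) := by
  constructor
  · intro x y h
    ext
    · exact P.T.map_injective (congrArg Gr.f0 h)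
    · exact congrArg Gr.fm h
  · intro y
    obtain ⟨f, hf⟩ := P.T.map_surjective y.f0
    exact ⟨⟨f, y.fm⟩, by ext; exacts [rfl, hf]⟩

/-- The obstruction for a graded morphism to be a morphism. -/
@[simps]
def δ (E F : Factorization P) : Gr E F →+ Gr E F.shiftObj where
  toFun x := ⟨E.phi ≫ x.f0 - x.fm ≫ F.phi, E.psi ≫ P.T.map x.fm - x.f0 ≫ F.psi⟩
  map_zero' := by ext <;> simp
  map_add' x y := by ext <;> simp [Functor.map_add] <;> abel

lemma δ_eq_zero_iff (x : Gr E F) : δ E F x = 0 ↔ ∃ f, ofHom f = x := by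
  constructor
  · intro h
    exact ⟨⟨x.fm, x.f0, sub_eq_zero.1 (congrArg Gr.fm h), sub_eq_zero.1 (congrArg Gr.f0 h)⟩, rfl⟩
  · rintro ⟨f, rfl⟩
    ext <;> simp

@[simp] lemma δ_ofHom (f : E ⟶ F) : δ E F (ofHom f) = 0 := (δ_eq_zero_iff _).2 ⟨f, rfl⟩

/-- The Leibniz rule, without sign: the sign of an operator of degree one shows up only in `δ_sh`.
-/
lemma δ_comp (x : Gr E F) (y : Gr F G) :
    δ E G (x.comp y) = (δ E F x).comp y.sh + x.comp (δ F G y) := by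
  ext <;> simp

lemma δ_ofHom_comp (f : E ⟶ F) (y : Gr F G) : δ E G ((ofHom f).comp y) = (ofHom f).comp (δ F G y) := by
  rw [δ_comp, δ_ofHom, zero_comp, zero_add]

lemma δ_comp_ofHom (x : Gr E F) (f : F ⟶ G) :
    δ E G (x.comp (ofHom f)) = (δ E F x).comp (ofHom (shiftMap f)) := by
  rw [δ_comp, δ_ofHom, comp_zero, add_zero, sh_ofHom]

/-- Although the structure morphisms compose to `w` and not to zero, the two resulting terms in `w`
cancel by naturality. -/
lemma δ_δ (x : Gr E F) : δ E F.shiftObj (δ E F x) = 0 := by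
  ext
  · simp [w_naturality]
  · simp [w_naturality]

end Gr

/-- The data `h`, `k` of a homotopy into `F[1]` are, after undoing `Φ` on `k`, a graded morphism `E
⟶ F`. Homotopy theory thus becomes the cohomology of `δ`. -/
lemma homotopic_zero_iff {E F : Factorization P} (f : E ⟶ F.shiftObj) :
    Homotopic f 0 ↔ ∃ x, Gr.δ E F x = Gr.ofHom f := by
  constructor
  · rintro ⟨h, k, h₁, h₂⟩
    obtain ⟨k, rfl⟩ := P.T.map_surjective k
    refine ⟨⟨k, h⟩, ?_⟩
    rw [zero_f0, sub_zero] at h₁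
    rw [zero_fm, sub_zero] at h₂
    ext
    · apply P.T.map_injective
      have : f.fm = f.fm := rfl
      simp only [Gr.ofHom_fm, h₂]
      simp [sub_eq_add_neg]
    · simp only [Gr.ofHom_f0, h₁]
      simp [sub_eq_add_neg, add_comm]
  · rintro ⟨x, hx⟩
    have h₁ := congrArg Gr.fm hx
    have h₂ := congrArg Gr.f0 hx
    simp only [Gr.ofHom_fm, Gr.ofHom_f0] at h₁ h₂
    refine ⟨x.f0, P.T.map x.fm, ?_, ?_⟩
    · rw [zero_f0, sub_zero, ← h₂]
      simp [sub_eq_add_neg, add_comm]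
    · rw [zero_fm, sub_zero, ← h₁]
      simp [sub_eq_add_neg]

lemma toHo_map_eq_zero_iff {E F : Factorization P} (f : E ⟶ F.shiftObj) :
    (toHo P).map f = 0 ↔ ∃ x, Gr.δ E F x = Gr.ofHom f := by
  rw [← homotopic_zero_iff]
  exact CategoryTheory.Quotient.functor_map_eq_iff (Homotopic (P := P)) f 0

end Factorization

namespace Factorization

variable {C : Type u} [Category.{v} C] [Abelian C] {P : Potential C}

/-! ### The total complex of graded morphisms into a resolution -/

/-- Short exact sequences of factorizations: both components are short exact. -/
structure IsShortExact {A B D : Factorization P} (f : A ⟶ B) (g : B ⟶ D) : Prop where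
  zero : f ≫ g = 0
  shortExact_m : (ShortComplex.mk f.fm g.fm (congrArg Hom.fm zero)).ShortExact
  shortExact_0 : (ShortComplex.mk f.f0 g.f0 (congrArg Hom.f0 zero)).ShortExact

variable (P) in
/-- Resolutions by factorizations with injective components, as sequences of short exact
sequences `0 ⟶ G n ⟶ I n ⟶ G (n + 1) ⟶ 0`. -/
structure InjRes where
  /-- the syzygies -/
  G : ℕ → Factorization P
  /-- the terms -/
  I : ℕ → Factorization P
  /-- the inclusions -/
  i : ∀ n, G n ⟶ I n
  /-- the projections -/
  π : ∀ n, I n ⟶ G (n + 1)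
  shortExact : ∀ n, IsShortExact (i n) (π n)
  injective_m : ∀ n, Injective (I n).Xm
  injective_0 : ∀ n, Injective (I n).X0

/-- The isomorphism `G[m][1] ≅ G[m + 1]`. -/
def τ (m m' : ℤ) (h : m + 1 = m') (G : Factorization P) :
    ((shiftPow P m).obj G).shiftObj ≅ (shiftPow P m').obj G :=
  (shiftPowIso P m m' h).app G

lemma τ_hom_naturality (m m' : ℤ) (h : m + 1 = m') {G H : Factorization P} (f : G ⟶ H) :
    shiftMap ((shiftPow P m).map f) ≫ (τ m m' h H).hom =
      (τ m m' h G).hom ≫ (shiftPow P m').map f :=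
  (shiftPowIso P m m' h).hom.naturality f

/-- The obstruction for a graded morphism `E ⟶ G[m]` to be a morphism, with values in `G[m + 1]`. -/
def δPow (E G : Factorization P) (m m' : ℤ) (h : m + 1 = m') :
    Gr E ((shiftPow P m).obj G) →+ Gr E ((shiftPow P m').obj G) :=
  (Gr.postcomp E (Gr.ofHom (τ m m' h G).hom)).comp (Gr.δ E _)

lemma δPow_apply {E G : Factorization P} (m m' : ℤ) (h : m + 1 = m')
    (x : Gr E ((shiftPow P m).obj G)) :
    δPow E G m m' h x = (Gr.δ E _ x).comp (Gr.ofHom (τ m m' h G).hom) := rfl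

lemma δPow_δPow {E G : Factorization P} (m m' m'' : ℤ) (h : m + 1 = m') (h' : m' + 1 = m'')
    (x : Gr E ((shiftPow P m).obj G)) :
    δPow E G m' m'' h' (δPow E G m m' h x) = 0 := by
  rw [δPow_apply, δPow_apply, Gr.δ_comp_ofHom, Gr.δ_δ, Gr.zero_comp, Gr.zero_comp]

lemma δPow_comp_map {E G H : Factorization P} (m m' : ℤ) (h : m + 1 = m')
    (x : Gr E ((shiftPow P m).obj G)) (f : G ⟶ H) :
    δPow E H m m' h (x.comp (Gr.ofHom ((shiftPow P m).map f))) =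
      (δPow E G m m' h x).comp (Gr.ofHom ((shiftPow P m').map f)) := by
  rw [δPow_apply, δPow_apply, Gr.δ_comp_ofHom, Gr.comp_assoc, Gr.comp_assoc, ← Gr.ofHom_comp,
    ← Gr.ofHom_comp]
  congr 2
  exact τ_hom_naturality m m' h f

namespace InjRes

variable (R : InjRes P)

/-- The resolution of the first syzygy. -/
abbrev tail : InjRes P where
  G n := R.G (n + 1)
  I n := R.I (n + 1)
  i n := R.i (n + 1)
  π n := R.π (n + 1)
  shortExact n := R.shortExact (n + 1)
  injective_m n := R.injective_m (n + 1)
  injective_0 n := R.injective_0 (n + 1)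

/-- The differential of a resolution. -/
def d (n : ℕ) : R.I n ⟶ R.I (n + 1) := R.π n ≫ R.i (n + 1)

lemma d_d (n : ℕ) : R.d n ≫ R.d (n + 1) = 0 := by
  rw [d, d, Category.assoc, ← Category.assoc (R.i (n + 1)), (R.shortExact (n + 1)).zero,
    zero_comp, comp_zero]

/-- Families of graded morphisms `E ⟶ (I n)[m]`. -/
abbrev Tot (E : Factorization P) : Type (max u v) :=
  ∀ (n : ℕ) (m : ℤ), Gr E ((shiftPow P m).obj (R.I n))

/-- The map induced by the differential of the resolution. -/
def vert (E : Factorization P) (m : ℤ) (n : ℕ) :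
    Gr E ((shiftPow P m).obj (R.I n)) →+ Gr E ((shiftPow P m).obj (R.I (n + 1))) :=
  Gr.postcomp E (Gr.ofHom ((shiftPow P m).map (R.d n)))

lemma vert_apply {E : Factorization P} {m : ℤ} {n : ℕ} (x : Gr E ((shiftPow P m).obj (R.I n))) :
    R.vert E m n x = x.comp (Gr.ofHom ((shiftPow P m).map (R.d n))) := rfl

lemma vert_vert {E : Factorization P} {m : ℤ} {n : ℕ} (x : Gr E ((shiftPow P m).obj (R.I n))) :
    R.vert E m (n + 1) (R.vert E m n x) = 0 := by
  rw [vert_apply, vert_apply, Gr.comp_assoc, ← Gr.ofHom_comp, ← Functor.map_comp, d_d,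
    Functor.map_zero, Gr.ofHom_zero, Gr.comp_zero]

/-- The component of the total differential coming from the resolution. -/
def vertPart (E : Factorization P) (x : R.Tot E) : R.Tot E
  | 0, _ => 0
  | n + 1, m => m.negOnePow • R.vert E m n (x n m)

/-- The differential of the total complex. -/
def totD (E : Factorization P) : R.Tot E →+ R.Tot E where
  toFun x n m := δPow E (R.I n) (m - 1) m (sub_add_cancel m 1) (x n (m - 1)) + R.vertPart E x n m
  map_zero' := by
    funext n m
    cases n <;> simp [vertPart]
  map_add' x y := by
    funext n m
    cases n
    · simp [vertPart]
    · simp only [vertPart, Pi.add_apply, map_add, smul_add]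
      abel

lemma totD_zero {E : Factorization P} (x : R.Tot E) (m : ℤ) :
    R.totD E x 0 m = δPow E (R.I 0) (m - 1) m (sub_add_cancel m 1) (x 0 (m - 1)) := add_zero _

lemma totD_succ {E : Factorization P} (x : R.Tot E) (n : ℕ) (m : ℤ) :
    R.totD E x (n + 1) m = δPow E (R.I (n + 1)) (m - 1) m (sub_add_cancel m 1) (x (n + 1) (m - 1)) +
      m.negOnePow • R.vert E m n (x n m) := rfl

/-- The defect commutes with the maps of the resolution and raises `m` by one, which reverses the
sign `(-1)^m`; the mixed terms cancel. -/
lemma totD_totD {E : Factorization P} (x : R.Tot E) : R.totD E (R.totD E x) = 0 := by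
  have hδ : ∀ n m, δPow E (R.I (n + 1)) (m - 1) m (sub_add_cancel m 1)
      ((m - 1).negOnePow • R.vert E (m - 1) n (x n (m - 1))) =
      (m - 1).negOnePow • R.vert E m n (δPow E (R.I n) (m - 1) m (sub_add_cancel m 1) (x n (m - 1))) := by
    intro n m
    rw [Units.smul_def, Units.smul_def, map_zsmul, vert_apply, δPow_comp_map, vert_apply]
  have hs : ∀ m : ℤ, (m - 1).negOnePow = -m.negOnePow := fun m => by
    rw [Int.negOnePow_sub]; simp
  funext n m
  cases n with
  | zero => rw [totD_zero, totD_zero, δPow_δPow]; rfl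
  | succ n =>
    rw [totD_succ, totD_succ, map_add, δPow_δPow, zero_add, hδ, hs]
    cases n with
    | zero =>
      rw [totD_zero, Units.neg_smul, neg_add_cancel]; rfl
    | succ n =>
      rw [totD_succ, map_add, smul_add, Units.smul_def (m.negOnePow) (R.vert E m n _), map_zsmul,
        vert_vert, smul_zero, smul_zero, add_zero, Units.neg_smul, neg_add_cancel]; rfl

/-- The filtered total complex. -/
def filtDiff (E : Factorization P) : FiltDiff (R.Tot E) where
  d := R.totD E
  d_d := R.totD_totD
  -- The entry `(n, m)` has degree `n + m` and filtration index `-m`. The defect lowers this index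
  -- by one and the resolution differential preserves it, so the latter alone governs the first
  -- page.
  F p q :=
    { carrier := {x | ∀ (n : ℕ) (m : ℤ), n + m ≠ q ∨ p < -m → x n m = 0}
      zero_mem' := fun _ _ _ => rfl
      add_mem' := fun hx hy n m h => by
        rw [Pi.add_apply, Pi.add_apply, hx n m h, hy n m h, add_zero]
      neg_mem' := fun hx n m h => by rw [Pi.neg_apply, Pi.neg_apply, hx n m h, neg_zero] }
  mono q h x hx n m h' := hx n m (h'.imp_right h.trans_lt)
  d_mem {p q q'} x hq hx n m h := by
    subst hq
    cases n with
    | zero =>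
      rw [totD_zero, hx 0 (m - 1) (by lia), map_zero]
    | succ n =>
      rw [totD_succ, hx (n + 1) (m - 1) (by lia), hx n m (by lia), map_zero, map_zero,
        smul_zero, add_zero]

lemma mem_F {E : Factorization P} {p q : ℤ} {x : R.Tot E} :
    x ∈ (R.filtDiff E).F p q ↔ ∀ (n : ℕ) (m : ℤ), n + m ≠ q ∨ p < -m → x n m = 0 := Iff.rfl

/-! ### The first page -/

/-- A family with a single entry. -/
def single {E : Factorization P} (n : ℕ) (m : ℤ) (y : Gr E ((shiftPow P m).obj (R.I n))) :
    R.Tot E := Pi.single n (Pi.single m y)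

lemma single_self {E : Factorization P} (n : ℕ) (m : ℤ) (y : Gr E ((shiftPow P m).obj (R.I n))) :
    R.single n m y n m = y := by simp [single]

lemma single_of_ne {E : Factorization P} {n n' : ℕ} {m m' : ℤ}
    (y : Gr E ((shiftPow P m).obj (R.I n))) (h : n' ≠ n ∨ m' ≠ m) :
    R.single n m y n' m' = 0 := by
  by_cases hn : n' = n
  · subst hn
    simp [single, Pi.single_eq_of_ne (h.resolve_left (by simp))]
  · simp [single, Pi.single_eq_of_ne hn]

/-- The boundaries in a column of the total complex. -/
def vertRange (E : Factorization P) (m : ℤ) :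
    ∀ n : ℕ, AddSubgroup (Gr E ((shiftPow P m).obj (R.I n)))
  | 0 => ⊥
  | n + 1 => (R.vert E m n).range

/-- The entry `(n + 1, -p)` of `d x` has filtration index `p`, so it vanishes. Its defect part comes
from an entry of `x` of index `p + 1`, which is zero, and only the resolution part remains. -/
lemma vert_eq_zero_of_mem_Z {E : Factorization P} {n : ℕ} {p q : ℤ} (h : p + q = n)
    {x : R.Tot E} (hx : x ∈ (R.filtDiff E).Z 1 p q) : R.vert E (-p) n (x n (-p)) = 0 := by
  have := (R.mem_F.1 hx.2) (n + 1) (-p) (by lia)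
  change R.totD E x (n + 1) (-p) = 0 at this
  rw [totD_succ, R.mem_F.1 hx.1 (n + 1) (-p - 1) (by lia), map_zero, zero_add] at this
  exact (smul_eq_zero_iff_eq _).1 this

/-- Once the resolution differential kills `y`, only the defect contributes to the differential of
the family, and it has index `p - 1`. -/
lemma single_mem_Z {E : Factorization P} {n : ℕ} {p q : ℤ} (h : p + q = n)
    (y : Gr E ((shiftPow P (-p)).obj (R.I n))) (hy : R.vert E (-p) n y = 0) :
    R.single n (-p) y ∈ (R.filtDiff E).Z 1 p q := by
  refine ⟨R.mem_F.2 fun n' m' _ => R.single_of_ne _ (by lia), R.mem_F.2 fun n' m' h' => ?_⟩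
  change R.totD E _ n' m' = 0
  cases n' with
  | zero => rw [totD_zero, single_of_ne _ _ (by lia), map_zero]
  | succ n' =>
    rw [totD_succ, single_of_ne _ (n' := n' + 1) _ (by lia), map_zero, zero_add]
    by_cases e : n' = n ∧ m' = -p
    · obtain ⟨rfl, rfl⟩ := e
      rw [single_self, hy, smul_zero]
    · rw [single_of_ne _ _ (by lia), map_zero, smul_zero]

/-- Modulo `F (p - 1) q`, an element of `F p q` is its leading entry at `(n, -p)`. If that entry is
a boundary in its column, subtracting the total differential of a one-entry family removes it. -/
lemma mem_vertRange_iff {E : Factorization P} {n : ℕ} {p q : ℤ} (h : p + q = n)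
    {x : R.Tot E} (hx : x ∈ (R.filtDiff E).Z 1 p q) :
    x n (-p) ∈ R.vertRange E (-p) n ↔ x ∈ (R.filtDiff E).B 1 p q := by
  have e₀ : (1 : ℤ) - 1 = 0 := rfl
  have e₁ : p + 1 - 1 = p := by ring
  rw [FiltDiff.mem_B, e₀, e₁]
  constructor
  · intro hx'
    cases n with
    | zero =>
      have hx' : x 0 (-p) = 0 := hx'
      have hz : x ∈ (R.filtDiff E).F (p - 1) q := by
        refine R.mem_F.2 fun n' m' h' => ?_
        by_cases e : n' = 0 ∧ m' = -p
        · obtain ⟨rfl, rfl⟩ := e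
          exact hx'
        · exact R.mem_F.1 hx.1 n' m' (by lia)
      refine ⟨x, (R.filtDiff E).mem_Z.2 ⟨hz, ?_⟩, 0, zero_mem _, by simp⟩
      rw [sub_zero]
      exact (R.filtDiff E).d_mem rfl hz
    | succ k =>
      obtain ⟨y, hy⟩ := hx'
      have hy : R.vert E (-p) k y = x (k + 1) (-p) := hy
      -- The sign compensates the factor `(-1)^m`, at `m = -p`, in the total differential.
      let Y : R.Tot E := R.single k (-p) ((-p).negOnePow • y)
      have hY : Y ∈ (R.filtDiff E).F p (q - 1) :=
        R.mem_F.2 fun n' m' h' => R.single_of_ne _ (by lia)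
      have hY₁ : Y (k + 1) (-p - 1) = 0 := R.single_of_ne _ (Or.inl (by lia))
      have hY₂ : Y k (-p) = (-p).negOnePow • y := R.single_self _ _ _
      have hdY : R.totD E Y ∈ (R.filtDiff E).F p q := (R.filtDiff E).d_mem (by ring) hY
      have hz : x - R.totD E Y ∈ (R.filtDiff E).F (p - 1) q := by
        refine R.mem_F.2 fun n' m' h' => ?_
        by_cases e : n' = k + 1 ∧ m' = -p
        · obtain ⟨rfl, rfl⟩ := e
          rw [Pi.sub_apply, Pi.sub_apply, totD_succ, hY₁, hY₂,
            map_zero, zero_add, Units.smul_def (_ : ℤˣ) y, map_zsmul, ← Units.smul_def, smul_smul,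
            Int.units_mul_self, one_smul, hy, sub_self]
        · rw [Pi.sub_apply, Pi.sub_apply, R.mem_F.1 hx.1 n' m' (by lia),
            R.mem_F.1 hdY n' m' (by lia), sub_zero]
      refine ⟨x - R.totD E Y, (R.filtDiff E).mem_Z.2 ⟨hz, ?_⟩, Y,
        (R.filtDiff E).mem_Z.2 ⟨hY, ?_⟩, (sub_add_cancel _ _).symm⟩
      · rw [sub_zero]
        exact (R.filtDiff E).d_mem rfl hz
      · rw [sub_zero]
        exact (R.filtDiff E).d_mem rfl hY
  · rintro ⟨z, hz, y, hy, rfl⟩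
    have hz' : z n (-p) = 0 := R.mem_F.1 hz.1 _ _ (by lia)
    have : (z + (R.filtDiff E).d y) n (-p) = R.totD E y n (-p) := by
      rw [Pi.add_apply, Pi.add_apply, hz', zero_add]; rfl
    rw [this]
    have hy' : y n (-p - 1) = 0 := R.mem_F.1 hy.1 _ _ (by lia)
    cases n with
    | zero =>
      rw [totD_zero, hy', map_zero]
      exact zero_mem _
    | succ k =>
      rw [totD_succ, hy', map_zero, zero_add, Units.smul_def]
      exact zsmul_mem (show _ ∈ (R.vert E (-p) k).range from ⟨_, rfl⟩) _

/-- Taking the leading entry identifies the first page with the cohomology of the columns. -/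
lemma nonempty_E_one_addEquiv {E : Factorization P} {n : ℕ} {p q : ℤ} (h : p + q = n) :
    Nonempty ((R.filtDiff E).E 1 p q ≃+
      (R.vert E (-p) n).ker ⧸ (R.vertRange E (-p) n).addSubgroupOf (R.vert E (-p) n).ker) := by
  let φ : (R.filtDiff E).Z 1 p q →+ (R.vert E (-p) n).ker :=
    { toFun := fun x => ⟨x.1 n (-p), R.vert_eq_zero_of_mem_Z h x.2⟩
      map_zero' := rfl
      map_add' := fun _ _ => rfl }
  refine nonempty_quotient_addEquiv ((QuotientAddGroup.mk' _).comp φ) ?_ _ ?_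
  · intro z
    obtain ⟨⟨y, hy⟩, rfl⟩ := QuotientAddGroup.mk_surjective z
    exact ⟨⟨_, R.single_mem_Z h y hy⟩,
      congrArg QuotientAddGroup.mk (Subtype.ext (R.single_self _ _ y))⟩
  · intro x
    exact (QuotientAddGroup.eq_zero_iff _).trans (R.mem_vertRange_iff h x.2)

lemma subsingleton_E_one {E : Factorization P} {p q : ℤ} (h : p + q < 0)
    (x : (R.filtDiff E).E 1 p q) : x = 0 := by
  refine (R.filtDiff E).subsingleton_E (fun y hy => ?_) x
  have : y = 0 := by
    funext n m
    exact R.mem_F.1 hy.1 n m (by lia)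
  rw [this]
  exact zero_mem _

end InjRes

end Factorization

/-! ### Ext groups by dimension shifting -/

open Abelian in
/-- The group `Ext^(n+1)(A, G 0)` is the quotient of `Hom(A, G (n + 1))`, for the syzygy
`G (n + 1)`, by the image of `Hom(A, I n)`. -/
lemma exists_hom_syzygy_to_ext {C : Type u} [Category.{v} C] [Abelian C] [HasExt.{w} C] (A : C)
    (n : ℕ) : ∀ (G I : ℕ → C) (i : ∀ n, G n ⟶ I n) (π : ∀ n, I n ⟶ G (n + 1))
    (_ : ∀ n, Injective (I n)) (h : ∀ n, i n ≫ π n = 0)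
    (_ : ∀ n, (ShortComplex.mk (i n) (π n) (h n)).ShortExact),
    ∃ f : (A ⟶ G (n + 1)) →+ Ext A (G 0) (n + 1), Function.Surjective f ∧
      ∀ x, f x = 0 ↔ ∃ y : A ⟶ I n, y ≫ π n = x := by
  -- Exactness of the long Ext sequence at `Ext A (G 1) n`.
  have key : ∀ (G I : ℕ → C) (i : ∀ n, G n ⟶ I n) (π : ∀ n, I n ⟶ G (n + 1))
      (h : ∀ n, i n ≫ π n = 0) (hex : ∀ n, (ShortComplex.mk (i n) (π n) (h n)).ShortExact)
      (n : ℕ) (x : Ext A (G 1) n), x.comp (hex 0).extClass rfl = 0 ↔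
        ∃ t : Ext A (I 0) n, t.comp (Ext.mk₀ (π 0)) (add_zero n) = x := by
    intro G I i π h hex n x
    constructor
    · intro hx
      exact Ext.covariant_sequence_exact₃ A (hex 0) x rfl hx
    · rintro ⟨t, rfl⟩
      have := (hex 0).comp_extClass
      dsimp only at this
      rw [Ext.comp_assoc t (Ext.mk₀ (π 0)) (hex 0).extClass (add_zero n) (zero_add 1) rfl, this,
        Ext.comp_zero]
  induction n with
  | zero =>
    intro G I i π hI h hex
    refine ⟨((hex 0).extClass.postcomp A rfl).comp
      (Ext.addEquiv₀ (X := A) (Y := G 1)).symm.toAddMonoidHom, ?_, fun x => ?_⟩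
    · intro z
      obtain ⟨y, rfl⟩ := Ext.covariant_sequence_exact₁ A (hex 0) z
        (have := hI 0; Ext.eq_zero_of_injective _) rfl
      obtain ⟨x, rfl⟩ := (Ext.addEquiv₀ (X := A) (Y := G 1)).symm.surjective y
      exact ⟨x, rfl⟩
    · refine (key G I i π h hex 0 (Ext.mk₀ x)).trans ⟨?_, ?_⟩
      · rintro ⟨t, ht⟩
        obtain ⟨y, rfl⟩ := (Ext.addEquiv₀ (X := A) (Y := I 0)).symm.surjective t
        refine ⟨y, (Ext.addEquiv₀ (X := A) (Y := G 1)).symm.injective ?_⟩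
        exact (Ext.mk₀_comp_mk₀ y (π 0)).symm.trans ht
      · rintro ⟨y, rfl⟩
        exact ⟨Ext.mk₀ y, Ext.mk₀_comp_mk₀ y (π 0)⟩
  | succ n ih =>
    intro G I i π hI h hex
    obtain ⟨f, hf, hf'⟩ := ih (fun n => G (n + 1)) (fun n => I (n + 1)) (fun n => i (n + 1))
      (fun n => π (n + 1)) (fun n => hI _) (fun n => h _) (fun n => hex _)
    -- In positive degree `Ext A (I 0)` vanishes, so the connecting map is bijective and leaves
    -- surjectivity and the kernel of `f` unchanged.
    refine ⟨((hex 0).extClass.postcomp A rfl).comp f, ?_, fun x => ?_⟩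
    · intro z
      obtain ⟨y, rfl⟩ := Ext.covariant_sequence_exact₁ A (hex 0) z
        (have := hI 0; Ext.eq_zero_of_injective _) rfl
      obtain ⟨x, rfl⟩ := hf y
      exact ⟨x, rfl⟩
    · rw [← hf']
      refine (key G I i π h hex (n + 1) (f x)).trans ⟨?_, ?_⟩
      · rintro ⟨t, ht⟩
        have := hI 0
        rw [← ht, Ext.eq_zero_of_injective t, Ext.zero_comp]
      · intro hx
        exact ⟨0, by rw [hx, Ext.zero_comp]⟩

namespace Factorization

variable {C : Type u} [Category.{v} C] [Abelian C] {P : Potential C}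

/-! ### Translations preserve resolutions -/

lemma shortExact_of_natIso {A B : Factorization P ⥤ C} (e : A ≅ B) {X Y Z : Factorization P}
    {f : X ⟶ Y} {g : Y ⟶ Z} (w₁ : A.map f ≫ A.map g = 0) (w₂ : B.map f ≫ B.map g = 0)
    (h : (ShortComplex.mk _ _ w₁).ShortExact) : (ShortComplex.mk _ _ w₂).ShortExact :=
  ShortComplex.shortExact_of_iso (ShortComplex.isoMk (e.app X) (e.app Y) (e.app Z)
    (e.hom.naturality f).symm (e.hom.naturality g).symm) h

lemma shortExact_map_equivalence (Φ : C ≌ C) {S : ShortComplex C} (h : S.ShortExact)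
    (w' : Φ.functor.map S.f ≫ Φ.functor.map S.g = 0) :
    (ShortComplex.mk _ _ w').ShortExact := by
  have : Φ.functor.Additive := Functor.additive_of_preserves_binary_products _
  exact h.map_of_exact Φ.functor

/-- The functors which preserve short exact sequences and factorizations with injective
components. -/
structure IsExactInj (A : Factorization P ⥤ Factorization P) : Prop where
  shortExact : ∀ {X Y Z : Factorization P} {f : X ⟶ Y} {g : Y ⟶ Z}, IsShortExact f g →
    IsShortExact (A.map f) (A.map g)
  injective_m : ∀ {X : Factorization P}, Injective X.Xm → Injective X.X0 →
    Injective (A.obj X).Xm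
  injective_0 : ∀ {X : Factorization P}, Injective X.Xm → Injective X.X0 →
    Injective (A.obj X).X0

lemma IsExactInj.of_iso {A B : Factorization P ⥤ Factorization P} (e : A ≅ B)
    (hA : IsExactInj A) : IsExactInj B where
  shortExact {X Y Z f g} h := by
    have h' := hA.shortExact h
    have hz : B.map f ≫ B.map g = 0 := by
      rw [← cancel_epi (e.hom.app X), ← e.hom.naturality_assoc, ← e.hom.naturality,
        reassoc_of% h'.zero, zero_comp, comp_zero]
    exact ⟨hz, shortExact_of_natIso (Functor.isoWhiskerRight e (evm P)) _ _ h'.shortExact_m,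
      shortExact_of_natIso (Functor.isoWhiskerRight e (ev0 P)) _ _ h'.shortExact_0⟩
  injective_m h h' := Injective.of_iso ((evm P).mapIso (e.app _)) (hA.injective_m h h')
  injective_0 h h' := Injective.of_iso ((ev0 P).mapIso (e.app _)) (hA.injective_0 h h')

lemma IsExactInj.comp {A B : Factorization P ⥤ Factorization P} (hA : IsExactInj A)
    (hB : IsExactInj B) : IsExactInj (A ⋙ B) where
  shortExact h := hB.shortExact (hA.shortExact h)
  injective_m h h' := hB.injective_m (hA.injective_m h h') (hA.injective_0 h h')
  injective_0 h h' := hB.injective_0 (hA.injective_m h h') (hA.injective_0 h h')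

lemma isExactInj_shift : IsExactInj (shift P) where
  shortExact {X Y Z f g} h :=
    { zero := by rw [← Functor.map_comp, h.zero]; ext <;> simp
      shortExact_m := h.shortExact_0
      shortExact_0 := shortExact_map_equivalence P.Φ h.shortExact_m
        (by
          have := congrArg Hom.fm h.zero
          rw [comp_fm, zero_fm] at this
          dsimp only
          rw [← Functor.map_comp, this, Functor.map_zero]) }
  injective_m _ h' := h'
  injective_0 h _ := (P.Φ.map_injective_iff _).2 h

lemma isExactInj_shiftPow_two_mul (t : ℤ) : IsExactInj (shiftPow P (2 * t)) := by
  obtain ⟨⟨e⟩, ⟨e'⟩⟩ := nonempty_shiftPow_evm_ev0_iso (P := P) t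
  constructor
  · intro X Y Z f g h
    have hz : (shiftPow P (2 * t)).map f ≫ (shiftPow P (2 * t)).map g = 0 := by
      rw [← Functor.map_comp, h.zero, Functor.map_zero]
    have hm : (P.Φ ^ t).functor.map f.fm ≫ (P.Φ ^ t).functor.map g.fm = 0 := by
      rw [← Functor.map_comp, ← comp_fm, h.zero, zero_fm, Functor.map_zero]
    have h0 : (P.Φ ^ t).functor.map f.f0 ≫ (P.Φ ^ t).functor.map g.f0 = 0 := by
      rw [← Functor.map_comp, ← comp_f0, h.zero, zero_f0, Functor.map_zero]
    exact ⟨hz,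
      shortExact_of_natIso e.symm _ _ (shortExact_map_equivalence (P.Φ ^ t) h.shortExact_m hm),
      shortExact_of_natIso e'.symm _ _ (shortExact_map_equivalence (P.Φ ^ t) h.shortExact_0 h0)⟩
  · intro X h _
    exact Injective.of_iso (e.symm.app X) (((P.Φ ^ t).map_injective_iff _).2 h)
  · intro X _ h
    exact Injective.of_iso (e'.symm.app X) (((P.Φ ^ t).map_injective_iff _).2 h)

/-- Even translations act on components through powers of `Φ`, an equivalence; an odd one is an even
one followed by `[1]`. -/
lemma isExactInj_shiftPow (m : ℤ) : IsExactInj (shiftPow P m) := by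
  rcases Int.even_or_odd' m with ⟨t, rfl | rfl⟩
  · exact isExactInj_shiftPow_two_mul t
  · exact ((isExactInj_shiftPow_two_mul t).comp isExactInj_shift).of_iso
      (shiftPowIso P (2 * t) (2 * t + 1) rfl)

/-! ### The first page in terms of Ext groups -/

namespace InjRes

variable (R : InjRes P)

/-- A graded morphism to a syzygy gives a cocycle of graded morphisms to the resolution. -/
def toKer (E : Factorization P) (m : ℤ) (n : ℕ) :
    Gr E ((shiftPow P m).obj (R.G n)) →+ (R.vert E m n).ker :=
  (Gr.postcomp E (Gr.ofHom ((shiftPow P m).map (R.i n)))).codRestrict _ fun x => by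
    change (x.comp _).comp _ = 0
    rw [Gr.comp_assoc, ← Gr.ofHom_comp, ← Functor.map_comp, d, ← Category.assoc,
      (R.shortExact n).zero, zero_comp, Functor.map_zero, Gr.ofHom_zero, Gr.comp_zero]

lemma toKer_apply {E : Factorization P} {m : ℤ} {n : ℕ}
    (x : Gr E ((shiftPow P m).obj (R.G n))) :
    (R.toKer E m n x).1 = x.comp (Gr.ofHom ((shiftPow P m).map (R.i n))) := rfl

lemma mono_map_i_fm (m : ℤ) (n : ℕ) : Mono ((shiftPow P m).map (R.i n)).fm :=
  ((isExactInj_shiftPow m).shortExact (R.shortExact n)).shortExact_m.mono_f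

lemma mono_map_i_f0 (m : ℤ) (n : ℕ) : Mono ((shiftPow P m).map (R.i n)).f0 :=
  ((isExactInj_shiftPow m).shortExact (R.shortExact n)).shortExact_0.mono_f

lemma comp_map_i_injective {E : Factorization P} {m : ℤ} {n : ℕ}
    {x y : Gr E ((shiftPow P m).obj (R.G n))}
    (h : x.comp (Gr.ofHom ((shiftPow P m).map (R.i n))) =
      y.comp (Gr.ofHom ((shiftPow P m).map (R.i n)))) : x = y := by
  have := R.mono_map_i_fm m n
  have := R.mono_map_i_f0 m n
  ext
  · exact (cancel_mono ((shiftPow P m).map (R.i n)).fm).1 (congrArg Gr.fm h)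
  · exact (cancel_mono ((shiftPow P m).map (R.i n)).f0).1 (congrArg Gr.f0 h)

lemma map_d (m : ℤ) (n : ℕ) : (shiftPow P m).map (R.d n) =
    (shiftPow P m).map (R.π n) ≫ (shiftPow P m).map (R.i (n + 1)) := Functor.map_comp _ _ _

/-- Left exactness: since `i (n + 1)` is a monomorphism, the kernel of `I n ⟶ I (n + 1)` is `G n`.
Graded morphisms carry no compatibility, so the two components are lifted independently. -/
lemma toKer_bijective (E : Factorization P) (m : ℤ) (n : ℕ) :
    Function.Bijective (R.toKer E m n) := by
  constructor
  · intro x y h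
    exact R.comp_map_i_injective (congrArg Subtype.val h)
  · rintro ⟨y, hy⟩
    have hy' : (y.comp (Gr.ofHom ((shiftPow P m).map (R.π n)))) = 0 := by
      apply R.comp_map_i_injective
      rw [Gr.comp_assoc, ← Gr.ofHom_comp, ← map_d, Gr.zero_comp]
      exact hy
    have h := (isExactInj_shiftPow m).shortExact (R.shortExact n)
    have h₁ := h.shortExact_m
    have h₂ := h.shortExact_0
    have := h₁.mono_f
    have := h₂.mono_f
    refine ⟨⟨h₁.exact.lift y.fm (congrArg Gr.fm hy'), h₂.exact.lift y.f0 (congrArg Gr.f0 hy')⟩, ?_⟩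
    apply Subtype.ext
    rw [toKer_apply]
    ext
    · exact h₁.exact.lift_f y.fm (congrArg Gr.fm hy')
    · exact h₂.exact.lift_f y.f0 (congrArg Gr.f0 hy')

-- Cocycles are graded morphisms into the syzygy, and boundaries are those factoring through the
-- preceding injective term. Dimension shifting applies to each component; for `n = 0` there are no
-- boundaries and the result is plain Hom.
open Abelian in
lemma nonempty_quotient_vert_addEquiv [HasExt.{w} C] (E : Factorization P) (m : ℤ) (n : ℕ) :
    Nonempty ((R.vert E m n).ker ⧸ (R.vertRange E m n).addSubgroupOf (R.vert E m n).ker ≃+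
      Ext E.Xm ((shiftPow P m).obj (R.G 0)).Xm n × Ext E.X0 ((shiftPow P m).obj (R.G 0)).X0 n) := by
  let e := AddEquiv.ofBijective _ (R.toKer_bijective E m n)
  have he : ∀ x, e x = R.toKer E m n x := fun _ => rfl
  cases n with
  | zero =>
    let f := e.symm.trans ((Gr.addEquivProd E ((shiftPow P m).obj (R.G 0))).trans
      (AddEquiv.prodCongr (Ext.addEquiv₀ (X := E.Xm) (Y := ((shiftPow P m).obj (R.G 0)).Xm)).symm
        (Ext.addEquiv₀ (X := E.X0) (Y := ((shiftPow P m).obj (R.G 0)).X0)).symm))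
    refine nonempty_quotient_addEquiv f.toAddMonoidHom f.surjective _ fun x => ?_
    exact f.map_eq_zero_iff.trans Subtype.ext_iff
  | succ n =>
    have hs := fun k => (isExactInj_shiftPow m).shortExact (R.shortExact k)
    obtain ⟨f₁, hf₁, hf₁'⟩ := exists_hom_syzygy_to_ext E.Xm n
      (fun k => ((shiftPow P m).obj (R.G k)).Xm) (fun k => ((shiftPow P m).obj (R.I k)).Xm)
      (fun k => ((shiftPow P m).map (R.i k)).fm) (fun k => ((shiftPow P m).map (R.π k)).fm)
      (fun k => (isExactInj_shiftPow m).injective_m (R.injective_m k) (R.injective_0 k))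
      (fun k => congrArg Hom.fm (hs k).zero) (fun k => (hs k).shortExact_m)
    obtain ⟨f₂, hf₂, hf₂'⟩ := exists_hom_syzygy_to_ext E.X0 n
      (fun k => ((shiftPow P m).obj (R.G k)).X0) (fun k => ((shiftPow P m).obj (R.I k)).X0)
      (fun k => ((shiftPow P m).map (R.i k)).f0) (fun k => ((shiftPow P m).map (R.π k)).f0)
      (fun k => (isExactInj_shiftPow m).injective_0 (R.injective_m k) (R.injective_0 k))
      (fun k => congrArg Hom.f0 (hs k).zero) (fun k => (hs k).shortExact_0)
    let f := ((f₁.prodMap f₂).comp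
      (Gr.addEquivProd E ((shiftPow P m).obj (R.G (n + 1)))).toAddMonoidHom).comp
        e.symm.toAddMonoidHom
    have hfe : ∀ y, f (e y) = (f₁ y.fm, f₂ y.f0) := fun y =>
      congrArg (fun z : Gr _ _ => (f₁ z.fm, f₂ z.f0)) (e.symm_apply_apply y)
    refine nonempty_quotient_addEquiv f ?_ _ fun x => ?_
    · rintro ⟨a, b⟩
      obtain ⟨a, rfl⟩ := hf₁ a
      obtain ⟨b, rfl⟩ := hf₂ b
      exact ⟨e ⟨a, b⟩, hfe _⟩
    · obtain ⟨y, rfl⟩ := e.surjective x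
      rw [hfe, Prod.mk_eq_zero, hf₁', hf₂']
      change _ ↔ (e y).1 ∈ (R.vert E m n).range
      rw [he, toKer_apply]
      constructor
      · rintro ⟨⟨a, ha⟩, ⟨b, hb⟩⟩
        refine ⟨⟨a, b⟩, ?_⟩
        rw [vert_apply, map_d, Gr.ofHom_comp, ← Gr.comp_assoc]
        congr 1
        ext
        exacts [ha, hb]
      · rintro ⟨z, hz⟩
        rw [vert_apply, map_d, Gr.ofHom_comp, ← Gr.comp_assoc] at hz
        have := R.comp_map_i_injective hz
        exact ⟨⟨z.fm, congrArg Gr.fm this⟩, ⟨z.f0, congrArg Gr.f0 this⟩⟩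

end InjRes

lemma InjRes.nonempty_addEquiv_extGroup_prod (R : InjRes P) {E : Factorization P} {A B : C}
    (p q : ℤ) (e : ((shiftPow P (-p)).obj (R.G 0)).Xm ≅ A)
    (e' : ((shiftPow P (-p)).obj (R.G 0)).X0 ≅ B) :
    Nonempty ((R.filtDiff E).E 1 p q ≃+ extGroup E.Xm A (p + q) × extGroup E.X0 B (p + q)) := by
  rcases h : p + q with n | n
  · let : HasExt.{max u v} C := HasExt.standard C
    obtain ⟨f⟩ := R.nonempty_E_one_addEquiv (E := E) (p := p) (q := q) h
    obtain ⟨g⟩ := R.nonempty_quotient_vert_addEquiv E (-p) n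
    let k₁ : Abelian.Ext E.Xm ((shiftPow P (-p)).obj (R.G 0)).Xm n ≃+ Abelian.Ext E.Xm A n :=
      (((Abelian.extFunctorObj E.Xm n).mapIso e)).addCommGroupIsoToAddEquiv
    let k₂ : Abelian.Ext E.X0 ((shiftPow P (-p)).obj (R.G 0)).X0 n ≃+ Abelian.Ext E.X0 B n :=
      (((Abelian.extFunctorObj E.X0 n).mapIso e')).addCommGroupIsoToAddEquiv
    exact ⟨(f.trans g).trans (k₁.prodCongr k₂)⟩
  · have h0 := R.subsingleton_E_one (E := E) (p := p) (q := q) (by rw [h]; exact Int.negSucc_lt_zero n)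
    refine ⟨⟨⟨fun _ => 0, fun _ => 0, fun x => (h0 x).symm, fun x => ?_⟩, fun _ _ => ?_⟩⟩
    · exact Prod.ext (Subsingleton.elim (α := PUnit) _ _) (Subsingleton.elim (α := PUnit) _ _)
    · exact Prod.ext (Subsingleton.elim (α := PUnit) _ _) (Subsingleton.elim (α := PUnit) _ _)

end Factorization

namespace Factorization

variable {C : Type u} [Category.{v} C] [Abelian C] {P : Potential C}

/-! ### Existence of resolutions -/

/-- The cokernel of a morphism of factorizations. -/
abbrev coker {A B : Factorization P} (f : A ⟶ B) : Factorization P where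
  Xm := cokernel f.fm
  X0 := cokernel f.f0
  phi := cokernel.desc f.fm (B.phi ≫ cokernel.π f.f0) (by
    rw [← Hom.phi_f0_assoc, cokernel.condition, comp_zero])
  psi := cokernel.desc f.f0 (B.psi ≫ P.T.map (cokernel.π f.fm)) (by
    rw [← Hom.psi_fm_assoc, ← Functor.map_comp, cokernel.condition, Functor.map_zero, comp_zero])
  phi_psi := by
    apply coequalizer.hom_ext
    simp [w_naturality]
  psi_phi := by
    rw [← cancel_epi (cokernel.π f.f0), cokernel.π_desc_assoc, Category.assoc,
      ← Functor.map_comp, cokernel.π_desc, Functor.map_comp, psi_phi_assoc, w_naturality]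

/-- The projection to the cokernel. -/
@[simps]
def cokerπ {A B : Factorization P} (f : A ⟶ B) : B ⟶ coker f where
  fm := cokernel.π f.fm
  f0 := cokernel.π f.f0
  phi_f0 := by simp
  psi_fm := by simp

lemma isShortExact_cokerπ {A B : Factorization P} (f : A ⟶ B) (hm : Mono f.fm) (h0 : Mono f.f0) :
    IsShortExact f (cokerπ f) where
  zero := by ext <;> simp
  shortExact_m :=
    { exact := ShortComplex.exact_cokernel f.fm
      mono_f := hm
      epi_g := (inferInstance : Epi (cokernel.π f.fm)) }
  shortExact_0 :=
    { exact := ShortComplex.exact_cokernel f.f0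
      mono_f := h0
      epi_g := (inferInstance : Epi (cokernel.π f.f0)) }

/-- The sum of the factorizations `(A, Φ(A), w, 1)` and `(B, B, 1, w)`. -/
abbrev cofree (P : Potential C) (A B : C) : Factorization P where
  Xm := A ⊞ B
  X0 := P.T.obj A ⊞ B
  phi := biprod.map (P.w.app A) (𝟙 B)
  psi := biprod.desc (P.T.map biprod.inl) (P.w.app B ≫ P.T.map biprod.inr)
  phi_psi := by
    apply biprod.hom_ext' <;> simp [w_naturality]
  psi_phi := by
    apply biprod.hom_ext'
    · simp [w_naturality, ← Functor.map_comp, P.w_comm]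
    · simp [w_naturality, ← Functor.map_comp]

/-- The morphism to a cofree factorization given by two morphisms in `C`. -/
@[simps]
def toCofree (E : Factorization P) {A B : C} (a : E.Xm ⟶ A) (b : E.X0 ⟶ B) :
    E ⟶ cofree P A B where
  fm := biprod.lift a (E.phi ≫ b)
  f0 := biprod.lift (E.psi ≫ P.T.map a) b
  phi_f0 := by
    apply biprod.hom_ext
    · simpa using (w_naturality a).symm
    · simp
  psi_fm := by
    have := w_naturality (P := P) b
    simp [biprod.lift_eq, reassoc_of% this]

/-- Arbitrary maps from the two components to injectives extend to a morphism into the cofree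
factorization, whose components are again injective because `Φ` preserves injectives. -/
lemma exists_mono_injective [EnoughInjectives C] (G : Factorization P) :
    ∃ (I : Factorization P) (i : G ⟶ I), Injective I.Xm ∧ Injective I.X0 ∧ Mono i.fm ∧
      Mono i.f0 ∧ (Injective G.Xm → Injective G.X0 → Epi i.fm ∧ Epi i.f0) := by
  -- When the components are already injective, the identity is chosen. This makes resolutions of
  -- finite injective dimension stop, as the cofree embedding would not.
  by_cases h : Injective G.Xm ∧ Injective G.X0
  · exact ⟨G, 𝟙 G, h.1, h.2, inferInstanceAs (Mono (𝟙 G.Xm)), inferInstanceAs (Mono (𝟙 G.X0)),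
      fun _ _ => ⟨inferInstanceAs (Epi (𝟙 G.Xm)), inferInstanceAs (Epi (𝟙 G.X0))⟩⟩
  · have : Injective (P.T.obj (Injective.under G.Xm)) := (P.Φ.map_injective_iff _).2 inferInstance
    refine ⟨cofree P (Injective.under G.Xm) (Injective.under G.X0),
      toCofree G (Injective.ι _) (Injective.ι _), inferInstance, inferInstance, ?_, ?_,
      fun h₁ h₂ => (h ⟨h₁, h₂⟩).elim⟩
    · have : Mono ((toCofree G (Injective.ι G.Xm) (Injective.ι G.X0)).fm ≫ biprod.fst) := by
        rw [toCofree_fm, biprod.lift_fst]; infer_instance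
      exact mono_of_mono _ (biprod.fst : Injective.under G.Xm ⊞ Injective.under G.X0 ⟶ _)
    · have : Mono ((toCofree G (Injective.ι G.Xm) (Injective.ι G.X0)).f0 ≫ biprod.snd) := by
        rw [toCofree_f0, biprod.lift_snd]; infer_instance
      exact mono_of_mono _
        (biprod.snd : P.T.obj (Injective.under G.Xm) ⊞ Injective.under G.X0 ⟶ _)

/-- The terms of a resolution with index at least `N` are zero. -/
structure InjRes.IsBounded (R : InjRes P) (N : ℕ) : Prop where
  isZero_G_m : ∀ n, N ≤ n → IsZero (R.G n).Xm
  isZero_G_0 : ∀ n, N ≤ n → IsZero (R.G n).X0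
  isZero_I_m : ∀ n, N ≤ n → IsZero (R.I n).Xm
  isZero_I_0 : ∀ n, N ≤ n → IsZero (R.I n).X0

/-- Passing to a syzygy lowers injective dimension by one. Once both components are injective, the
chosen embedding is an epimorphism and all later syzygies vanish. -/
lemma exists_injRes [EnoughInjectives C] (F : Factorization P) :
    ∃ R : InjRes P, R.G 0 = F ∧
      ((∃ n : ℕ, HasInjectiveDimensionLT F.Xm n) → (∃ n : ℕ, HasInjectiveDimensionLT F.X0 n) →
        ∃ N, R.IsBounded N) := by
  choose I i hIm hI0 him hi0 he using exists_mono_injective (P := P)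
  let G : ℕ → Factorization P := fun n => Nat.rec F (fun _ X => coker (i X)) n
  have hs : ∀ n, IsShortExact (i (G n)) (cokerπ (i (G n)) : _ ⟶ G (n + 1)) := fun n =>
    isShortExact_cokerπ _ (him _) (hi0 _)
  let R : InjRes P :=
    { G := G
      I := fun n => I (G n)
      i := fun n => i (G n)
      π := fun n => cokerπ (i (G n))
      shortExact := hs
      injective_m := fun n => hIm _
      injective_0 := fun n => hI0 _ }
  refine ⟨R, rfl, ?_⟩
  rintro ⟨n₁, h₁⟩ ⟨n₂, h₂⟩
  -- A common strict bound `k + 1` for both components, so that the `k`-th syzygy is injective in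
  -- both and the terms vanish from `k + 1` on.
  have h₁ : HasInjectiveDimensionLT F.Xm (n₁ + n₂ + 1) := hasInjectiveDimensionLT_of_ge _ n₁ _ (by lia)
  have h₂ : HasInjectiveDimensionLT F.X0 (n₁ + n₂ + 1) := hasInjectiveDimensionLT_of_ge _ n₂ _ (by lia)
  generalize n₁ + n₂ = k at h₁ h₂
  have hdim : ∀ l j : ℕ, l + j = k → HasInjectiveDimensionLT (G l).Xm (j + 1) ∧
      HasInjectiveDimensionLT (G l).X0 (j + 1) := by
    intro l
    induction l with
    | zero =>
      intro j hj
      obtain rfl : j = k := by lia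
      exact ⟨h₁, h₂⟩
    | succ l ih =>
      intro j hj
      obtain ⟨h, h'⟩ := ih (j + 1) (by lia)
      exact ⟨((hs l).shortExact_m.hasInjectiveDimensionLT_X₃_iff j (hIm _)).2 h,
        ((hs l).shortExact_0.hasInjectiveDimensionLT_X₃_iff j (hI0 _)).2 h'⟩
  have hstep : ∀ l, Injective (G l).Xm → Injective (G l).X0 →
      IsZero (G (l + 1)).Xm ∧ IsZero (G (l + 1)).X0 := by
    intro l h h'
    obtain ⟨e, e'⟩ := he (G l) h h'
    exact ⟨isZero_cokernel_of_epi _, isZero_cokernel_of_epi _⟩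
  have hG : ∀ n, IsZero (G (k + 1 + n)).Xm ∧ IsZero (G (k + 1 + n)).X0 := by
    intro n
    induction n with
    | zero =>
      obtain ⟨h, h'⟩ := hdim k 0 (by lia)
      exact hstep k inferInstance inferInstance
    | succ n ih => exact hstep _ ih.1.injective ih.2.injective
  have hG' : ∀ n, k + 1 ≤ n → IsZero (G n).Xm ∧ IsZero (G n).X0 := by
    intro n hn
    obtain ⟨m, rfl⟩ := Nat.exists_eq_add_of_le hn
    exact hG m
  refine ⟨k + 1, fun n hn => (hG' n hn).1, fun n hn => (hG' n hn).2, fun n hn => ?_, fun n hn => ?_⟩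
  · have := (he (G n) (hG' n hn).1.injective (hG' n hn).2.injective).1
    have := him (G n)
    have := isIso_of_mono_of_epi (i (G n)).fm
    exact (hG' n hn).1.of_iso (asIso (i (G n)).fm).symm
  · have := (he (G n) (hG' n hn).1.injective (hG' n hn).2.injective).2
    have := hi0 (G n)
    have := isIso_of_mono_of_epi (i (G n)).f0
    exact (hG' n hn).2.of_iso (asIso (i (G n)).f0).symm

end Factorization

namespace Factorization

variable {C : Type u} [Category.{v} C] [Abelian C] {P : Potential C}

/-! ### Graded morphisms from short exact sequences and from cones -/

namespace Gr

/-- Translation negates both structure morphisms, so it anticommutes with the defect. -/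
lemma δ_sh {E F : Factorization P} (x : Gr E F) : δ _ _ x.sh = -(δ E F x).sh := by
  ext <;> simp [Functor.map_sub] <;> abel

lemma ofHom_comp_id_comp {E F G : Factorization P} {f : E ⟶ F} {g : F ⟶ E} (h : f ≫ g = 𝟙 E)
    (x : Gr E G) : (ofHom f).comp ((ofHom g).comp x) = x := by
  rw [← comp_assoc, ← ofHom_comp, h, id_comp]

lemma comp_ofHom_comp_id {E F G : Factorization P} {f : E ⟶ F} {g : F ⟶ E} (h : f ≫ g = 𝟙 E)
    (x : Gr G E) : (x.comp (ofHom f)).comp (ofHom g) = x := by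
  rw [comp_assoc, ← ofHom_comp, h, comp_id]

end Gr

lemma shiftMap_hom_inv_id {E F : Factorization P} (e : E ≅ F) :
    shiftMap e.hom ≫ shiftMap e.inv = 𝟙 E.shiftObj :=
  ((shift P).map_comp _ _).symm.trans
    ((congrArg (shift P).map e.hom_inv_id).trans ((shift P).map_id _))

namespace IsShortExact

variable {A B D : Factorization P} {f : A ⟶ B} {g : B ⟶ D} (h : IsShortExact f g)

include h

/-- Injectivity of components extends graded morphisms, not morphisms of factorizations; this
suffices, as compatibility is tracked by `δ`. -/
lemma exists_extension {J : Factorization P} (hm : Injective J.Xm) (h0 : Injective J.X0)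
    (z : Gr A J) : ∃ z' : Gr B J, (Gr.ofHom f).comp z' = z := by
  have := h.shortExact_m.mono_f
  have := h.shortExact_0.mono_f
  dsimp only at *
  refine ⟨⟨Injective.factorThru z.fm f.fm, Injective.factorThru z.f0 f.f0⟩, ?_⟩
  ext <;> simp

lemma exists_desc {J : Factorization P} (x : Gr B J) (hx : (Gr.ofHom f).comp x = 0) :
    ∃ c : Gr D J, (Gr.ofHom g).comp c = x := by
  have := h.shortExact_m.epi_g
  have := h.shortExact_0.epi_g
  refine ⟨⟨h.shortExact_m.exact.desc x.fm (congrArg Gr.fm hx),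
    h.shortExact_0.exact.desc x.f0 (congrArg Gr.f0 hx)⟩, ?_⟩
  ext
  · exact h.shortExact_m.exact.g_desc x.fm _
  · exact h.shortExact_0.exact.g_desc x.f0 _

lemma comp_cancel {J : Factorization P} {x y : Gr D J}
    (hxy : (Gr.ofHom g).comp x = (Gr.ofHom g).comp y) : x = y := by
  have := h.shortExact_m.epi_g
  have := h.shortExact_0.epi_g
  dsimp only at *
  ext
  · exact (cancel_epi g.fm).1 (congrArg Gr.fm hxy)
  · exact (cancel_epi g.f0).1 (congrArg Gr.f0 hxy)

end IsShortExact

section Cone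

variable {A B : Factorization P} (g : A ⟶ B)

/-- The graded inclusion of `A[1]` in the cone of a morphism `A ⟶ B`. -/
@[simps]
def coneInl : Gr A.shiftObj (cone g) := ⟨biprod.inl, biprod.inl⟩

/-- The projection of the cone of a morphism `A ⟶ B` to `A[1]`. -/
@[simps]
def coneFst : cone g ⟶ A.shiftObj where
  fm := (biprod.fst : A.X0 ⊞ B.Xm ⟶ A.X0)
  f0 := (biprod.fst : P.T.obj A.Xm ⊞ B.X0 ⟶ P.T.obj A.Xm)
  phi_f0 := by apply biprod.hom_ext' <;> simp
  psi_fm := by apply biprod.hom_ext' <;> simp [← Functor.map_comp]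

/-- The graded projection of the cone of a morphism `A ⟶ B` to `B`. -/
@[simps]
def coneSnd : Gr (cone g) B := ⟨biprod.snd, biprod.snd⟩

@[simp] lemma coneInr_fm : (coneInr g).fm = (biprod.inr : B.Xm ⟶ A.X0 ⊞ B.Xm) := rfl
@[simp] lemma coneInr_f0 : (coneInr g).f0 = (biprod.inr : B.X0 ⟶ P.T.obj A.Xm ⊞ B.X0) := rfl

variable {K : Factorization P}

/-- As a graded object the cone is `A[1] ⊕ B`. Of the four structural maps, `coneFst` and `coneInr`
are morphisms, while `coneInl` and `coneSnd` are only graded. -/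
lemma cone_decomposition (x : Gr (cone g) K) :
    (Gr.ofHom (coneFst g)).comp ((coneInl g).comp x) +
      (coneSnd g).comp ((Gr.ofHom (coneInr g)).comp x) = x := by
  apply Gr.ext <;> apply biprod.hom_ext' <;> simp

lemma coneInl_comp_fst (x : Gr A.shiftObj K) :
    (coneInl g).comp ((Gr.ofHom (coneFst g)).comp x) = x := by ext <;> simp

lemma coneInl_comp_snd (x : Gr B K) : (coneInl g).comp ((coneSnd g).comp x) = 0 := by
  ext <;> simp

lemma coneInr_comp_snd (x : Gr B K) :
    (Gr.ofHom (coneInr g)).comp ((coneSnd g).comp x) = x := by ext <;> simp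

lemma coneInr_comp_fst (x : Gr A.shiftObj K) :
    (Gr.ofHom (coneInr g)).comp ((Gr.ofHom (coneFst g)).comp x) = 0 := by ext <;> simp

/-- The failure of the splitting to be compatible is `g` itself; all cone computations below follow
from this and the Leibniz rule. -/
lemma δ_coneSnd : Gr.δ _ _ (coneSnd g) = (Gr.ofHom (coneFst g)).comp (Gr.ofHom g).sh := by
  apply Gr.ext
  · apply biprod.hom_ext' <;> simp
  · apply biprod.hom_ext' <;> simp [← Functor.map_comp]

lemma δ_coneSnd_comp (x : Gr B K) : Gr.δ _ _ ((coneSnd g).comp x) =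
    (Gr.ofHom (coneFst g)).comp ((Gr.ofHom g).comp x).sh + (coneSnd g).comp (Gr.δ _ _ x) := by
  rw [Gr.δ_comp, δ_coneSnd, Gr.comp_assoc, Gr.sh_comp]

lemma δ_coneFst_comp_sh (x : Gr A K) : Gr.δ _ _ ((Gr.ofHom (coneFst g)).comp x.sh) =
    -(Gr.ofHom (coneFst g)).comp (Gr.δ _ _ x).sh := by
  rw [Gr.δ_ofHom_comp, Gr.δ_sh, Gr.comp_neg]

/-- A cocycle vanishing on `B` comes from `A[1]`, hence is a translate of a cocycle on `A`. -/
lemma exists_of_coneInr_comp_eq_zero {K : Factorization P} {x : Gr (cone g) K.shiftObj}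
    (hx : (Gr.ofHom (coneInr g)).comp x = 0) (hδ : Gr.δ _ _ x = 0) :
    ∃ y : Gr A K, Gr.δ _ _ y = 0 ∧ x = (Gr.ofHom (coneFst g)).comp y.sh := by
  obtain ⟨y, hy⟩ := Gr.sh_bijective.2 ((coneInl g).comp x)
  have h := cone_decomposition g x
  rw [hx, Gr.comp_zero, add_zero, ← hy] at h
  refine ⟨y, Gr.sh_bijective.1 ?_, h.symm⟩
  rw [← h, δ_coneFst_comp_sh, neg_eq_zero] at hδ
  rw [Gr.sh_zero, ← coneInl_comp_fst g (Gr.sh _), hδ, Gr.comp_zero]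

end Cone

/-! ### Objects orthogonal to the factorizations with injective components -/

/-- The components are injective. -/
structure IsInj (J : Factorization P) : Prop where
  injective_m : Injective J.Xm
  injective_0 : Injective J.X0

lemma IsInj.of_iso {J J' : Factorization P} (e : J ≅ J') (h : IsInj J) : IsInj J' where
  injective_m := Injective.of_iso ((evm P).mapIso e) h.injective_m
  injective_0 := Injective.of_iso ((ev0 P).mapIso e) h.injective_0

lemma isInj_shiftObj_iff (J : Factorization P) : IsInj J.shiftObj ↔ IsInj J :=
  ⟨fun h => ⟨(P.Φ.map_injective_iff _).1 h.injective_0, h.injective_m⟩,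
    fun h => ⟨h.injective_0, (P.Φ.map_injective_iff _).2 h.injective_m⟩⟩

lemma IsInj.exists_iso_shiftObj {J : Factorization P} (h : IsInj J) :
    ∃ J' : Factorization P, IsInj J' ∧ Nonempty (J'.shiftObj ≅ J) := by
  let e : ((shift P).objPreimage J).shiftObj ≅ J := (shift P).objObjPreimageIso J
  exact ⟨_, (isInj_shiftObj_iff _).1 (h.of_iso e.symm), ⟨e⟩⟩

/-- There are no nonzero maps in the homotopy category to factorizations with injective
components. -/
def IsOrth (E : Factorization P) : Prop :=
  ∀ J, IsInj J → ∀ x : Gr E J.shiftObj, Gr.δ _ _ x = 0 → ∃ z, Gr.δ E J z = x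

variable (P) in
/-- The objects of the homotopy category without nonzero maps to factorizations with injective
components. -/
def orth : ObjectProperty (HoFact P) := fun X =>
  ∀ J, IsInj J → ∀ f : X ⟶ (toHo P).obj J, f = 0

/-- Every factorization with injective components is a translate of another, so vanishing of
homotopy classes can be tested as exactness of `δ`. -/
lemma orth_iff (E : Factorization P) : orth P ((toHo P).obj E) ↔ IsOrth E := by
  constructor
  · intro h J hJ x hx
    obtain ⟨f, rfl⟩ := (Gr.δ_eq_zero_iff x).1 hx
    exact (toHo_map_eq_zero_iff f).1 (h _ ((isInj_shiftObj_iff _).2 hJ) _)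
  · intro h J hJ f
    obtain ⟨J', hJ', ⟨e⟩⟩ := hJ.exists_iso_shiftObj
    obtain ⟨f, rfl⟩ := (toHo P).map_surjective f
    have : (toHo P).map (f ≫ e.inv) = 0 :=
      (toHo_map_eq_zero_iff _).2 (h J' hJ' _ (Gr.δ_ofHom _))
    rw [← cancel_mono ((toHo P).map e.inv), ← Functor.map_comp, this, zero_comp]

/-- Testing on double translates leaves room to undo a translation on both source and target. -/
lemma IsOrth.of_forall_shiftObj {E : Factorization P}
    (h : ∀ J, IsInj J → ∀ x : Gr E J.shiftObj.shiftObj, Gr.δ _ _ x = 0 →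
      ∃ z, Gr.δ E J.shiftObj z = x) : IsOrth E := by
  intro J hJ x hx
  obtain ⟨J', hJ', ⟨e⟩⟩ := hJ.exists_iso_shiftObj
  obtain ⟨z, hz⟩ := h J' hJ' (x.comp (Gr.ofHom (shiftMap e.inv)))
    (by rw [Gr.δ_comp_ofHom, hx, Gr.zero_comp])
  refine ⟨z.comp (Gr.ofHom e.hom), ?_⟩
  rw [Gr.δ_comp_ofHom, hz]
  exact Gr.comp_ofHom_comp_id (shiftMap_hom_inv_id e.symm) x

lemma isOrth_shiftObj_iff (E : Factorization P) : IsOrth E.shiftObj ↔ IsOrth E := by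
  constructor
  · intro h J hJ x hx
    obtain ⟨z, hz⟩ := h J.shiftObj ((isInj_shiftObj_iff _).2 hJ) x.sh
      (by rw [Gr.δ_sh, hx, Gr.sh_zero, neg_zero])
    obtain ⟨z, rfl⟩ := Gr.sh_bijective.2 z
    refine ⟨-z, Gr.sh_bijective.1 ?_⟩
    rw [← hz, Gr.δ_sh, map_neg]
    ext <;> simp
  · intro h
    refine .of_forall_shiftObj fun J hJ x hx => ?_
    obtain ⟨x, rfl⟩ := Gr.sh_bijective.2 x
    obtain ⟨z, hz⟩ := h J hJ x (Gr.sh_bijective.1 (by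
      rw [← neg_inj, ← Gr.δ_sh, hx, Gr.sh_zero, neg_zero]))
    refine ⟨-z.sh, ?_⟩
    rw [map_neg, Gr.δ_sh, neg_neg, hz]

/-- The long exact sequence at the level of cochains: correct a cocycle to vanish on `B`, then bound
the remaining cocycle on `A`. -/
lemma IsOrth.cone {A B : Factorization P} (g : A ⟶ B) (hA : IsOrth A) (hB : IsOrth B) :
    IsOrth (cone g) := by
  refine .of_forall_shiftObj fun J hJ x hx => ?_
  obtain ⟨z, hz⟩ := hB _ ((isInj_shiftObj_iff J).2 hJ) ((Gr.ofHom (coneInr g)).comp x)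
    (by rw [Gr.δ_ofHom_comp, hx, Gr.comp_zero])
  obtain ⟨y, hy, hxy⟩ := exists_of_coneInr_comp_eq_zero g
    (x := x - Gr.δ _ _ ((coneSnd g).comp z))
    (by rw [Gr.comp_sub, ← Gr.δ_ofHom_comp, coneInr_comp_snd, hz, sub_self])
    (by rw [map_sub, hx, Gr.δ_δ, sub_zero])
  obtain ⟨t, rfl⟩ := hA J hJ y hy
  refine ⟨(coneSnd g).comp z - (Gr.ofHom (coneFst g)).comp t.sh, ?_⟩
  rw [map_sub, δ_coneFst_comp_sh, ← hxy]
  abel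

lemma shiftPow_iff_of_isThick {S : ObjectProperty (HoFact P)} (hS : IsThick S) (m : ℤ)
    (E : Factorization P) :
    S ((toHo P).obj ((shiftPow P m).obj E)) ↔ S ((toHo P).obj E) := by
  have key : ∀ m m' : ℤ, m + 1 = m' → (S ((toHo P).obj ((shiftPow P m').obj E)) ↔
      S ((toHo P).obj ((shiftPow P m).obj E))) := fun m m' h =>
    Iff.trans ⟨hS.of_iso ((toHo P).mapIso (τ m m' h E)),
      hS.of_iso ((toHo P).mapIso (τ m m' h E).symm)⟩ (hS.shift _)
  induction m with
  | zero => exact Iff.rfl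
  | succ n ih => exact (key n (n + 1) rfl).trans ih
  | pred n ih => exact (key (-n - 1) (-n) (by ring)).symm.trans ih

lemma isThick_orth : IsThick (orth P) where
  zero X hX J _ f := hX.eq_of_src f 0
  shift E := (orth_iff _).trans ((isOrth_shiftObj_iff E).trans (orth_iff E).symm)
  cone A B g hA hB :=
    (orth_iff _).2 (.cone g ((orth_iff _).1 hA) ((orth_iff _).1 hB))
  retract X Y r hY J hJ f := by
    rw [← Category.id_comp f, ← r.retract, Category.assoc, hY J hJ (r.r ≫ f), comp_zero]

/-- A map out of a coproduct is determined on the summands. -/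
lemma isClosedUnderColimitsOfShape_orth {ι : Type w} :
    (orth P).IsClosedUnderColimitsOfShape (Discrete ι) where
  colimitsOfShape_le := by
    rintro X ⟨h⟩ J hJ f
    refine h.isColimit.hom_ext fun j => ?_
    rw [comp_zero]
    exact h.prop_diag_obj j J hJ _

/-! ### Totalizations of exact complexes -/

/-- A morphism inducing isomorphisms on homotopy classes of maps to factorizations with injective
components. -/
structure IsOrthIso {T Q : Factorization P} (p : T ⟶ Q) : Prop where
  exists_eq : ∀ J, IsInj J → ∀ x : Gr T J.shiftObj, Gr.δ _ _ x = 0 →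
    ∃ (c : Gr Q J.shiftObj) (z : Gr T J), Gr.δ _ _ c = 0 ∧ x = (Gr.ofHom p).comp c + Gr.δ _ _ z
  exists_δ_eq : ∀ J, IsInj J → ∀ (c : Gr Q J.shiftObj) (y : Gr T J),
    (Gr.ofHom p).comp c = Gr.δ _ _ y → ∃ z, Gr.δ Q J z = c

lemma isOrthIso_of_iso {T Q : Factorization P} (e : T ≅ Q) : IsOrthIso e.hom where
  exists_eq J _ x hx := ⟨(Gr.ofHom e.inv).comp x, 0, by rw [Gr.δ_ofHom_comp, hx, Gr.comp_zero], by
    rw [Gr.ofHom_comp_id_comp e.hom_inv_id, map_zero, add_zero]⟩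
  exists_δ_eq J _ c y h := ⟨(Gr.ofHom e.inv).comp y, by
    rw [Gr.δ_ofHom_comp, ← h, Gr.ofHom_comp_id_comp e.inv_hom_id]⟩

lemma IsOrthIso.isOrth {T Q : Factorization P} {p : T ⟶ Q} (h : IsOrthIso p) (hQ : IsZero Q.Xm)
    (hQ' : IsZero Q.X0) : IsOrth T := by
  intro J hJ x hx
  obtain ⟨c, z, -, rfl⟩ := h.exists_eq J hJ x hx
  obtain rfl : c = 0 := Gr.ext (hQ.eq_of_src _ _) (hQ'.eq_of_src _ _)
  exact ⟨z, by rw [Gr.comp_zero, zero_add]⟩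

lemma IsOrthIso.of_forall_shiftObj {T Q : Factorization P} {p : T ⟶ Q}
    (h₁ : ∀ J, IsInj J → ∀ x : Gr T J.shiftObj.shiftObj, Gr.δ _ _ x = 0 →
      ∃ (c : Gr Q J.shiftObj.shiftObj) (z : Gr T J.shiftObj),
        Gr.δ _ _ c = 0 ∧ x = (Gr.ofHom p).comp c + Gr.δ _ _ z)
    (h₂ : ∀ J, IsInj J → ∀ (c : Gr Q J.shiftObj.shiftObj) (y : Gr T J.shiftObj),
      (Gr.ofHom p).comp c = Gr.δ _ _ y → ∃ z, Gr.δ Q J.shiftObj z = c) : IsOrthIso p := by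
  constructor
  all_goals
    intro J hJ
    obtain ⟨J', hJ', ⟨e⟩⟩ := hJ.exists_iso_shiftObj
    have he : shiftMap e.inv ≫ shiftMap e.hom = 𝟙 J.shiftObj := shiftMap_hom_inv_id e.symm
  · intro x hx
    obtain ⟨c, z, hc, h⟩ := h₁ J' hJ' (x.comp (Gr.ofHom (shiftMap e.inv)))
      (by rw [Gr.δ_comp_ofHom, hx, Gr.zero_comp])
    refine ⟨c.comp (Gr.ofHom (shiftMap e.hom)), z.comp (Gr.ofHom e.hom), ?_, ?_⟩
    · rw [Gr.δ_comp_ofHom, hc, Gr.zero_comp]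
    · rw [Gr.δ_comp_ofHom, ← Gr.comp_assoc, ← Gr.add_comp, ← h, Gr.comp_ofHom_comp_id he]
  · intro c y h
    obtain ⟨z, hz⟩ := h₂ J' hJ' (c.comp (Gr.ofHom (shiftMap e.inv))) (y.comp (Gr.ofHom e.inv))
      (by rw [Gr.δ_comp_ofHom, ← h, Gr.comp_assoc])
    exact ⟨z.comp (Gr.ofHom e.hom), by rw [Gr.δ_comp_ofHom, hz, Gr.comp_ofHom_comp_id he]⟩

/-- A five lemma written with cochains. If `T` looks like `Q` from the point of view of injective
`J`, the cone of `T ⟶ X` looks like the cokernel `R` of `Q ⟶ X`. Injectivity of `J` makes graded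
maps extend along `i`, which supplies the long exact sequence of `0 ⟶ Q ⟶ X ⟶ R ⟶ 0`. -/
lemma IsOrthIso.cone {T Q X R : Factorization P} {p : T ⟶ Q} (hp : IsOrthIso p) {i : Q ⟶ X}
    {π : X ⟶ R} (h : IsShortExact i π) (g : T ⟶ X) (hg : g = p ≫ i) (r : cone g ⟶ R)
    (hr : Gr.ofHom r = (coneSnd g).comp (Gr.ofHom π)) : IsOrthIso r := by
  have hg' : Gr.ofHom g = (Gr.ofHom p).comp (Gr.ofHom i) := by rw [hg, Gr.ofHom_comp]
  have hir : ∀ {J : Factorization P} (c : Gr R J), (Gr.ofHom (coneInr g)).comp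
      ((Gr.ofHom r).comp c) = (Gr.ofHom π).comp c := fun c => by
    rw [hr, Gr.comp_assoc, coneInr_comp_snd]
  have hδ : ∀ {J : Factorization P} (c : Gr R J), Gr.δ _ _ ((Gr.ofHom π).comp c) = 0 →
      Gr.δ _ _ c = 0 := fun c hc => h.comp_cancel (by rw [← Gr.δ_ofHom_comp, hc, Gr.comp_zero])
  have hd : ∀ {J : Factorization P} (x : Gr X J), Gr.δ _ _ ((Gr.ofHom i).comp x) = 0 →
      ∃ c, Gr.δ _ _ c = 0 ∧ (Gr.ofHom π).comp c = Gr.δ _ _ x := fun x hx => by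
    obtain ⟨c, hc⟩ := h.exists_desc (Gr.δ _ _ x) (by rw [← Gr.δ_ofHom_comp, hx])
    exact ⟨c, hδ c (by rw [hc, Gr.δ_δ]), hc⟩
  -- The `T[1]`-component of the differential of a graded map on the cone with parts `y` and `b`.
  have hin : ∀ {J : Factorization P} (y : Gr T J) (b : Gr X J.shiftObj),
      (coneInl g).comp (Gr.δ _ _ ((Gr.ofHom (coneFst g)).comp y.sh + (coneSnd g).comp b)) =
        ((Gr.ofHom g).comp b - Gr.δ _ _ y).sh := fun y b => by
    rw [map_add, δ_coneFst_comp_sh, δ_coneSnd_comp, Gr.comp_add, Gr.comp_add, Gr.comp_neg,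
      coneInl_comp_fst, coneInl_comp_fst, coneInl_comp_snd, Gr.sh_sub]
    abel
  refine .of_forall_shiftObj (fun K hK x hx => ?_) (fun K hK c y hy => ?_)
  · have hK' := (isInj_shiftObj_iff K).2 hK
    obtain ⟨b, hb⟩ : ∃ b, b = (Gr.ofHom (coneInr g)).comp x := ⟨_, rfl⟩
    obtain ⟨y, hy⟩ := Gr.sh_bijective.2 ((coneInl g).comp x)
    have hxyb := cone_decomposition g x
    rw [← hb, ← hy] at hxyb
    have hyb := hin y b
    rw [hxyb, hx, Gr.comp_zero, ← Gr.sh_zero] at hyb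
    -- The part `y` of `x` bounds `b` restricted to `T`, so `b` is already a boundary on `Q`.
    -- Extending a primitive to `X` and subtracting its defect makes `b` descend to `R`.
    obtain ⟨w, hw⟩ := hp.exists_δ_eq _ hK' ((Gr.ofHom i).comp b) y
      (by rw [← Gr.comp_assoc, ← hg', ← sub_eq_zero, ← Gr.sh_bijective.1 hyb])
    obtain ⟨w, rfl⟩ := h.exists_extension hK'.1 hK'.2 w
    have hb' : Gr.δ _ _ b = 0 := by rw [hb, Gr.δ_ofHom_comp, hx, Gr.comp_zero]
    obtain ⟨c, hc⟩ := h.exists_desc (b - Gr.δ _ _ w)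
      (by rw [Gr.comp_sub, ← Gr.δ_ofHom_comp, hw, sub_self])
    have hc' : Gr.δ _ _ c = 0 := hδ c (by rw [hc, map_sub, hb', Gr.δ_δ, sub_zero])
    -- After removing the class on `R`, the rest vanishes on `X` and is a cocycle on `T`.
    obtain ⟨y, hy, hx'⟩ := exists_of_coneInr_comp_eq_zero g
      (x := x - Gr.δ _ _ ((coneSnd g).comp w) - (Gr.ofHom r).comp c)
      (by rw [Gr.comp_sub, Gr.comp_sub, hir, hc, ← Gr.δ_ofHom_comp, coneInr_comp_snd, ← hb,
        sub_self])
      (by rw [map_sub, map_sub, hx, Gr.δ_δ, Gr.δ_ofHom_comp, hc', Gr.comp_zero, sub_zero,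
        sub_zero])
    obtain ⟨c₁, z, hc₁, rfl⟩ := hp.exists_eq _ hK y hy
    -- The class `c₁` on `Q` need not extend to `X` as a cocycle; the defect of a graded extension
    -- `e` descends to `c₂` on `R`, the image of `c₁` under the connecting map. This is why `c - c₂`
    -- is the answer.
    obtain ⟨e, rfl⟩ := h.exists_extension hK'.1 hK'.2 c₁
    obtain ⟨c₂, hc₂, he⟩ := hd e hc₁
    refine ⟨c - c₂, (coneSnd g).comp w + (coneSnd g).comp e - (Gr.ofHom (coneFst g)).comp z.sh,
      by rw [map_sub, hc', hc₂, sub_zero], ?_⟩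
    rw [map_sub, map_add, δ_coneFst_comp_sh, δ_coneSnd_comp g e, ← he, ← Gr.comp_assoc _ _ c₂, ← hr,
      hg', Gr.comp_sub, Gr.comp_assoc (Gr.ofHom p)]
    rw [Gr.sh_add, Gr.comp_add, sub_eq_iff_eq_add, sub_eq_iff_eq_add] at hx'
    rw [hx']
    abel
  · obtain ⟨b, hb⟩ : ∃ b, b = (Gr.ofHom (coneInr g)).comp y := ⟨_, rfl⟩
    obtain ⟨t, ht⟩ := Gr.sh_bijective.2 ((coneInl g).comp y)
    have hytb := cone_decomposition g y
    rw [← hb, ← ht] at hytb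
    have htb := hin t b
    rw [hytb, ← hy, hr, Gr.comp_assoc, coneInl_comp_snd, ← Gr.sh_zero] at htb
    -- The same descent, one degree lower: `t` shows that `b` is a boundary on `Q`, and the
    -- corrected `b` descends to a primitive `v` of `c`.
    obtain ⟨w, hw⟩ := hp.exists_δ_eq _ hK ((Gr.ofHom i).comp b) t
      (by rw [← Gr.comp_assoc, ← hg', ← sub_eq_zero, ← Gr.sh_bijective.1 htb])
    obtain ⟨w, rfl⟩ := h.exists_extension hK.1 hK.2 w
    obtain ⟨v, hv⟩ := h.exists_desc (b - Gr.δ _ _ w)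
      (by rw [Gr.comp_sub, ← Gr.δ_ofHom_comp, hw, sub_self])
    refine ⟨v, h.comp_cancel ?_⟩
    rw [← Gr.δ_ofHom_comp, hv, map_sub, Gr.δ_δ, sub_zero, hb, Gr.δ_ofHom_comp, ← hy, hir]

section Totalization

lemma totData_desc_comp (n : ℕ) (X : ℕ → Factorization P) (d : ∀ l, X (l + 1) ⟶ X l)
    (hd : ∀ l, d (l + 1) ≫ d l = 0) {Z Z' : Factorization P} (f : X 0 ⟶ Z) (hf : d 0 ≫ f = 0)
    (k : Z ⟶ Z') (hf' : d 0 ≫ f ≫ k = 0) :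
    (totData n X d hd).desc (f ≫ k) hf' = (totData n X d hd).desc f hf ≫ k := by
  cases n with
  | zero => rfl
  | succ n =>
    apply Factorization.hom_ext <;> apply biprod.hom_ext' <;> simp [totData, coneDesc]

/-- The morphism from the cokernel of `X₂ ⟶ X₁` to `X₀` is part of a short exact sequence. -/
lemma exists_isShortExact_of_exact {X₂ X₁ X₀ : Factorization P} (d₁ : X₂ ⟶ X₁) (d₀ : X₁ ⟶ X₀)
    (hd : d₁ ≫ d₀ = 0) (hm : (ShortComplex.mk d₁.fm d₀.fm (congrArg Hom.fm hd)).Exact)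
    (h0 : (ShortComplex.mk d₁.f0 d₀.f0 (congrArg Hom.f0 hd)).Exact) :
    ∃ i : coker d₁ ⟶ X₀, cokerπ d₁ ≫ i = d₀ ∧ IsShortExact i (cokerπ d₀) := by
  have hdm : d₁.fm ≫ d₀.fm = 0 := congrArg Hom.fm hd
  have hd0 : d₁.f0 ≫ d₀.f0 = 0 := congrArg Hom.f0 hd
  let i : coker d₁ ⟶ X₀ :=
    { fm := cokernel.desc d₁.fm d₀.fm hdm
      f0 := cokernel.desc d₁.f0 d₀.f0 hd0
      phi_f0 := by rw [← cancel_epi (cokernel.π d₁.fm)]; simp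
      psi_fm := by
        rw [← cancel_epi (cokernel.π d₁.f0)]
        simp [← Functor.map_comp] }
  have hi : cokerπ d₁ ≫ i = d₀ := by ext <;> simp [i]
  have hz : i ≫ cokerπ d₀ = 0 := by
    ext <;> simp [i]
  refine ⟨i, hi, hz, ?_, ?_⟩
  · exact
      { mono_f := hm.mono_cokernelDesc
        epi_g := (inferInstance : Epi (cokernel.π d₀.fm))
        exact := by
          let φ : ShortComplex.mk d₀.fm (cokernel.π d₀.fm) (cokernel.condition _) ⟶
              ShortComplex.mk i.fm (cokerπ d₀).fm (congrArg Hom.fm hz) :=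
            { τ₁ := cokernel.π d₁.fm, τ₂ := 𝟙 _, τ₃ := 𝟙 _ }
          have : Epi φ.τ₁ := inferInstanceAs (Epi (cokernel.π _))
          exact (ShortComplex.exact_iff_of_epi_of_isIso_of_mono φ).1
            (ShortComplex.exact_cokernel d₀.fm) }
  · exact
      { mono_f := h0.mono_cokernelDesc
        epi_g := (inferInstance : Epi (cokernel.π d₀.f0))
        exact := by
          let φ : ShortComplex.mk d₀.f0 (cokernel.π d₀.f0) (cokernel.condition _) ⟶
              ShortComplex.mk i.f0 (cokerπ d₀).f0 (congrArg Hom.f0 hz) :=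
            { τ₁ := cokernel.π d₁.f0, τ₂ := 𝟙 _, τ₃ := 𝟙 _ }
          have : Epi φ.τ₁ := inferInstanceAs (Epi (cokernel.π _))
          exact (ShortComplex.exact_iff_of_epi_of_isIso_of_mono φ).1
            (ShortComplex.exact_cokernel d₀.f0) }

lemma cokerπ_comp_self {A B : Factorization P} (f : A ⟶ B) : f ≫ cokerπ f = 0 := by
  ext <;> simp

/-- Induction on the length, peeling off `X 0`: the shorter complex computes `coker (d 1)`, which
embeds in `X 0` with cokernel `coker (d 0)`. Exactness at `X 0` is not imposed, so this cokernel may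
be nonzero at intermediate stages. -/
lemma isOrthIso_totData (n : ℕ) : ∀ (X : ℕ → Factorization P) (d : ∀ l, X (l + 1) ⟶ X l)
    (hd : ∀ l, d (l + 1) ≫ d l = 0) (_ : ∀ l, n < l → IsZero (X l))
    (_ : ∀ l, (ShortComplex.mk (d (l + 1)).fm (d l).fm (congrArg Hom.fm (hd l))).Exact)
    (_ : ∀ l, (ShortComplex.mk (d (l + 1)).f0 (d l).f0 (congrArg Hom.f0 (hd l))).Exact),
    IsOrthIso ((totData n X d hd).desc (cokerπ (d 0)) (cokerπ_comp_self _)) := by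
  induction n with
  | zero =>
    intro X d hd hX _ _
    have h : d 0 = 0 := (hX 1 one_pos).eq_of_src _ _
    have hm : (d 0).fm = 0 := by rw [h]; rfl
    have h0 : (d 0).f0 = 0 := by rw [h]; rfl
    let em : (X 0).Xm ≅ cokernel (d 0).fm :=
      (cokernelZeroIsoTarget ≪≫ Iso.refl _).symm ≪≫ cokernelIsoOfEq hm.symm
    let e0 : (X 0).X0 ≅ cokernel (d 0).f0 := cokernelZeroIsoTarget.symm ≪≫ cokernelIsoOfEq h0.symm
    have hem : em.hom = (cokerπ (d 0)).fm := by simp [em]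
    have he0 : e0.hom = (cokerπ (d 0)).f0 := by simp [e0]
    let e : X 0 ≅ coker (d 0) := isoMk em e0
      (by rw [hem, he0, Hom.phi_f0]) (by rw [hem, he0, Hom.psi_fm])
    have he : e.hom = cokerπ (d 0) := hom_ext hem he0
    have := isOrthIso_of_iso e
    rwa [he] at this
  | succ n ih =>
    intro X d hd hX hm h0
    obtain ⟨i, hi, hs⟩ := exists_isShortExact_of_exact (d 1) (d 0) (hd 0) (hm 0) (h0 0)
    refine (ih (fun l => X (l + 1)) (fun l => d (l + 1)) (fun l => hd (l + 1))
      (fun l hl => hX _ (by lia)) (fun l => hm _) (fun l => h0 _)).cone hs _ ?_ _ ?_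
    · rw [← totData_desc_comp _ _ _ _ _ _ _ (by rw [hi, hd])]
      congr 1
      exact hi.symm
    · apply Gr.ext
      · apply biprod.hom_ext' <;> simp [totData, coneDesc]
      · apply biprod.hom_ext' <;> simp [totData, coneDesc]

lemma exact_of_acyclic {A : Factorization P ⥤ C} [A.Additive]
    {K : CochainComplex (Factorization P) ℤ} (h : ((A.mapHomologicalComplex _).obj K).Acyclic)
    (i j k : ℤ) (hij : i + 1 = j) (hjk : j + 1 = k) (hz : A.map (K.d i j) ≫ A.map (K.d j k) = 0) :
    (ShortComplex.mk _ _ hz).Exact :=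
  (HomologicalComplex.exactAt_iff' _ i j k (by simp [← hij]) (by simp [hjk])).1 (h j)

lemma isZero_cokernel_of_acyclic {A : Factorization P ⥤ C} [A.Additive]
    {K : CochainComplex (Factorization P) ℤ} (h : ((A.mapHomologicalComplex _).obj K).Acyclic)
    (i j : ℤ) (hij : i + 1 = j) (hK : IsZero (K.X (j + 1))) :
    IsZero (cokernel (A.map (K.d i j))) := by
  have hz : A.map (K.d i j) ≫ A.map (K.d j (j + 1)) = 0 := by
    rw [← Functor.map_comp, K.d_comp_d, Functor.map_zero]
  have := (ShortComplex.exact_iff_epi _ ((A.map_isZero hK).eq_of_tgt _ _)).1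
    (exact_of_acyclic h i j (j + 1) hij rfl hz)
  exact isZero_cokernel_of_epi _

/-- Exactness in the top degree `a` makes the cokernel of the last differential zero, and the
totalization has the same maps to injective factorizations as that cokernel. -/
lemma orth_of_isTotOfBoundedExact {T : Factorization P} (hT : IsTotOfBoundedExact T) :
    orth P ((toHo P).obj T) := by
  obtain ⟨K, a, n, hK, hm, h0, rfl⟩ := hT
  refine (shiftPow_iff_of_isThick isThick_orth _ _).2 ((orth_iff _).2 ?_)
  have hK' : IsZero (K.X ((a - (0 : ℕ)) + 1)) := hK _ (Or.inr (by simp))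
  exact (isOrthIso_totData n _ _ _ (fun l hl => hK _ (Or.inl (by lia)))
    (fun l => exact_of_acyclic hm _ _ _ (by lia) (by lia) _)
    (fun l => exact_of_acyclic h0 _ _ _ (by lia) (by lia) _)).isOrth
    (isZero_cokernel_of_acyclic hm _ _ (by lia) hK') (isZero_cokernel_of_acyclic h0 _ _ (by lia) hK')

end Totalization

lemma acycl_le_orth : acycl P ≤ orth P := fun _ h =>
  h _ isThick_orth fun _ => orth_of_isTotOfBoundedExact

lemma coacycl_le_orth : coacycl P ≤ orth P := fun _ h =>
  h _ isThick_orth (fun _ => orth_of_isTotOfBoundedExact)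
    fun _ => isClosedUnderColimitsOfShape_orth

end Factorization

namespace Factorization

variable {C : Type u} [Category.{v} C] [Abelian C] {P : Potential C}

/-! ### Cones of short exact sequences -/

/-- Rotation of a triangle: `cone g` is an extension of `U[1]` by `V`, so the cone of `V ⟶ cone g`
is homotopy equivalent to `U[1]`. -/
lemma IsThick.of_cone {S : ObjectProperty (HoFact P)} (hS : IsThick S) {U V : Factorization P}
    (g : U ⟶ V) (hg : S ((toHo P).obj (Factorization.cone g))) (hV : S ((toHo P).obj V)) :
    S ((toHo P).obj U) := by
  have h₁ : U.shiftObj.phi ≫ P.T.map g.fm + g.f0 ≫ V.psi = 0 := by simp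
  have h₂ : U.shiftObj.psi ≫ P.T.map g.f0 + P.T.map g.fm ≫ P.T.map V.phi = 0 := by
    simp [← Functor.map_comp]
  let e : ext U.shiftObj V g.f0 (P.T.map g.fm) h₁ h₂ ≅ Factorization.cone g :=
    isoMk (Iso.refl _) (Iso.refl _) (by simp) (by
      apply biprod.hom_ext' <;> simp)
  obtain ⟨i⟩ := nonempty_iso_cone_extInr U.shiftObj V g.f0 (P.T.map g.fm) h₁ h₂
  exact (hS.shift U).1 (hS.of_iso i.symm
    (hS.cone (extInr U.shiftObj V g.f0 (P.T.map g.fm) h₁ h₂) hV (hS.of_iso ((toHo P).mapIso e) hg)))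

/-- The terms of the complex `A ⟶ B ⟶ D` with `D` in degree `0`. -/
def threeTermObj (A B D : Factorization P) : ℤ → Factorization P
  | .ofNat 0 => D
  | .negSucc 0 => B
  | .negSucc 1 => A
  | _ => 0

/-- The differential of the complex `A ⟶ B ⟶ D` with `D` in degree `0`. -/
def threeTermD {A B D : Factorization P} (f : A ⟶ B) (g : B ⟶ D) :
    ∀ i j : ℤ, threeTermObj A B D i ⟶ threeTermObj A B D j
  | .negSucc 0, .ofNat 0 => g
  | .negSucc 1, .negSucc 0 => f
  | _, _ => 0

/-- The complex `A ⟶ B ⟶ D` with `D` in degree `0`. -/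
def threeTerm {A B D : Factorization P} (f : A ⟶ B) (g : B ⟶ D) (h : f ≫ g = 0) :
    CochainComplex (Factorization P) ℤ where
  X := threeTermObj A B D
  d := threeTermD f g
  shape i j hij := by
    rcases i with i | _ | _ | i <;> rcases j with (_ | j) | _ | _ | j <;>
      first | rfl | exact (hij rfl).elim
  d_comp_d' i j k hij hjk := by
    obtain rfl : i + 1 = j := hij
    obtain rfl : i + 1 + 1 = k := hjk
    rcases i with i | _ | _ | i
    · exact zero_comp
    · exact comp_zero
    · exact h
    · exact zero_comp

lemma isZero_threeTermObj (A B D : Factorization P) (i : ℤ) (hi : i < -2 ∨ 0 < i) :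
    IsZero (threeTermObj A B D i) := by
  rcases i with (_ | i) | _ | _ | i
  · simp at hi
  · exact isZero_zero _
  · simp at hi
  · simp at hi
  · exact isZero_zero _

lemma acyclic_threeTerm {A B D : Factorization P} (f : A ⟶ B) (g : B ⟶ D) (h : f ≫ g = 0)
    (F : Factorization P ⥤ C) [F.Additive] (hz : F.map f ≫ F.map g = 0)
    (hex : (ShortComplex.mk _ _ hz).ShortExact) :
    ((F.mapHomologicalComplex _).obj (threeTerm f g h)).Acyclic := by
  have := hex.mono_f
  have := hex.epi_g
  intro i
  rw [HomologicalComplex.exactAt_iff' _ (i - 1) i (i + 1) (by simp) (by simp)]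
  rcases i with (_ | i) | _ | _ | i
  · refine (ShortComplex.exact_iff_epi _ ?_).2 hex.epi_g
    exact (F.map_isZero (isZero_zero _)).eq_of_tgt _ _
  · exact ShortComplex.exact_of_isZero_X₂ _ (F.map_isZero (isZero_zero _))
  · exact hex.exact
  · refine (ShortComplex.exact_iff_mono _ ?_).2 hex.mono_f
    exact (F.map_isZero (isZero_zero _)).eq_of_src _ _
  · exact ShortComplex.exact_of_isZero_X₂ _ (F.map_isZero (isZero_zero _))

/-- A short exact sequence is a bounded exact complex. Its totalization is a cone of a morphism
`cone f ⟶ D`, so `cone f` belongs to `S` along with `D`. -/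
lemma IsShortExact.cone_mem {A B D : Factorization P} {f : A ⟶ B} {g : B ⟶ D}
    (h : IsShortExact f g) {S : ObjectProperty (HoFact P)} (hS : IsThick S)
    (hT : ∀ T : Factorization P, IsTotOfBoundedExact T → S ((toHo P).obj T))
    (hD : S ((toHo P).obj D)) : S ((toHo P).obj (cone f)) := by
  have h₁ := hT (tot (threeTerm f g h.zero) 0 2) ⟨_, 0, 2,
    fun i hi => isZero_threeTermObj A B D i hi,
    acyclic_threeTerm f g h.zero (evm P) _ h.shortExact_m,
    acyclic_threeTerm f g h.zero (ev0 P) _ h.shortExact_0, rfl⟩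
  have h₂ := (shiftPow_iff_of_isThick hS _ _).1 h₁
  -- The recursion for totalizations of length two unfolds to exactly this iterated cone.
  exact hS.of_cone (U := cone f) (V := D) _ h₂ hD

/-! ### Twisted extensions -/

section

variable {B Y : Factorization P} (θ : B ⟶ Y.shiftObj)

/-- The extension of `B` by `Y` given by a morphism `B ⟶ Y[1]`. -/
abbrev twist : Factorization P :=
  ext B Y θ.fm θ.f0
    (by
      have h : B.phi ≫ θ.f0 = θ.fm ≫ (-Y.psi) := θ.phi_f0
      rw [h]; simp)
    (by
      have h : B.psi ≫ P.T.map θ.fm = θ.f0 ≫ (-P.T.map Y.phi) := θ.psi_fm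
      rw [h]; simp)

/-- The projection of an extension of `B` by `Y` to `B`. -/
@[simps]
def twistFst : twist θ ⟶ B where
  fm := (biprod.fst : B.Xm ⊞ Y.Xm ⟶ B.Xm)
  f0 := (biprod.fst : B.X0 ⊞ Y.X0 ⟶ B.X0)
  phi_f0 := by apply biprod.hom_ext' <;> simp
  psi_fm := by apply biprod.hom_ext' <;> simp [← Functor.map_comp]

/-- The graded projection of an extension of `B` by `Y` to `Y`. -/
@[simps]
def twistSnd : Gr (twist θ) Y := ⟨biprod.snd, biprod.snd⟩

/-- The graded inclusion of `B` in an extension of `B` by `Y`. -/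
@[simps]
def twistInl : Gr B (twist θ) := ⟨biprod.inl, biprod.inl⟩

/-- The inclusion of `Y` in an extension of `B` by `Y`. -/
@[simps]
def twistInr : Gr Y (twist θ) := ⟨biprod.inr, biprod.inr⟩

variable {K : Factorization P}

lemma twist_decomposition (x : Gr K (twist θ)) :
    (x.comp (Gr.ofHom (twistFst θ))).comp (twistInl θ) +
      (x.comp (twistSnd θ)).comp (twistInr θ) = x := by
  apply Gr.ext <;> apply biprod.hom_ext <;> simp

lemma twistInl_comp_fst : (twistInl θ).comp (Gr.ofHom (twistFst θ)) = Gr.ofHom (𝟙 B) := by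
  apply Gr.ext <;> simp

lemma twistInl_comp_snd : (twistInl θ).comp (twistSnd θ) = 0 := by
  apply Gr.ext <;> simp

lemma twistInr_comp_fst : (twistInr θ).comp (Gr.ofHom (twistFst θ)) = 0 := by
  apply Gr.ext <;> simp

lemma twistInr_comp_snd : (twistInr θ).comp (twistSnd θ) = Gr.ofHom (𝟙 Y) := by
  apply Gr.ext <;> simp

/-- The twist `θ` is the obstruction to splitting the extension by morphisms; `δ_twistInl` is the
same fact for the section, with opposite sign. -/
lemma δ_twistSnd : Gr.δ _ _ (twistSnd θ) = Gr.ofHom (twistFst θ ≫ θ) := by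
  apply Gr.ext
  · apply biprod.hom_ext' <;> simp
  · apply biprod.hom_ext' <;> simp [← Functor.map_comp]

lemma δ_twistInl : Gr.δ _ _ (twistInl θ) = -(Gr.ofHom θ).comp (twistInr θ).sh := by
  apply Gr.ext
  · apply biprod.hom_ext <;> simp
  · simp

end

lemma δ_coneInl {A B : Factorization P} (g : A ⟶ B) :
    Gr.δ _ _ (coneInl g) = -(Gr.ofHom g).sh.comp (Gr.ofHom (coneInr g)).sh := by
  apply Gr.ext
  · apply biprod.hom_ext <;> simp
  · simp

/-- The direct sum of a short exact sequence and a trivial one. -/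
lemma shortExact_biprod {A I G Y Z : C} {a : A ⟶ I} {b : I ⟶ G} {hz : a ≫ b = 0}
    (h : (ShortComplex.mk a b hz).ShortExact) (f : A ⟶ Z) (g : Z ⟶ G ⊞ Y) (p : Z ⟶ I) (q : Z ⟶ Y)
    [IsIso (biprod.lift p q)] (hp : f ≫ p = a) (hq : f ≫ q = 0) (hg : g ≫ biprod.fst = p ≫ b)
    (hg' : g ≫ biprod.snd = q) (hfg : f ≫ g = 0) : (ShortComplex.mk f g hfg).ShortExact where
  exact := by
    have := h.mono_f
    rw [ShortComplex.exact_iff_exact_up_to_refinements]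
    intro W x hx
    dsimp only at x hx
    refine ⟨W, 𝟙 W, inferInstance, h.exact.lift (x ≫ p) ?_, ?_⟩
    · dsimp only
      rw [Category.assoc, ← hg, reassoc_of% hx, zero_comp]
    · dsimp only
      rw [Category.id_comp, ← cancel_mono (biprod.lift p q)]
      apply biprod.hom_ext
      · simp only [Category.assoc, biprod.lift_fst, hp]
        exact (h.exact.lift_f (x ≫ p) _).symm
      · simp only [Category.assoc, biprod.lift_snd, hq, comp_zero]
        rw [← hg', reassoc_of% hx, zero_comp]
  mono_f := by
    have := h.mono_f
    have : Mono (f ≫ p) := by rw [hp]; exact h.mono_f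
    exact mono_of_mono f p
  epi_g := by
    have : Epi b := h.epi_g
    have : g = biprod.lift p q ≫ biprod.map b (𝟙 Y) := by
      apply biprod.hom_ext <;> simp [hg, hg']
    dsimp only
    rw [this]
    infer_instance

lemma IsShortExact.of_iso {A B D A' B' D' : Factorization P} {f : A ⟶ B} {g : B ⟶ D}
    {f' : A' ⟶ B'} {g' : B' ⟶ D'} (h : IsShortExact f g) (e₁ : A ≅ A') (e₂ : B ≅ B') (e₃ : D ≅ D')
    (h₁ : e₁.hom ≫ f' = f ≫ e₂.hom) (h₂ : e₂.hom ≫ g' = g ≫ e₃.hom) : IsShortExact f' g' := by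
  have hz : f' ≫ g' = 0 := by
    rw [← cancel_epi e₁.hom, reassoc_of% h₁, h₂, reassoc_of% h.zero, zero_comp, comp_zero]
  refine ⟨hz, ?_, ?_⟩
  · let e : ShortComplex.mk f.fm g.fm (congrArg Hom.fm h.zero) ≅
        ShortComplex.mk f'.fm g'.fm (congrArg Hom.fm hz) :=
      ShortComplex.isoMk ((evm P).mapIso e₁) ((evm P).mapIso e₂) ((evm P).mapIso e₃)
        (congrArg Hom.fm h₁) (congrArg Hom.fm h₂)
    exact ShortComplex.shortExact_of_iso e h.shortExact_m
  · let e : ShortComplex.mk f.f0 g.f0 (congrArg Hom.f0 h.zero) ≅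
        ShortComplex.mk f'.f0 g'.f0 (congrArg Hom.f0 hz) :=
      ShortComplex.isoMk ((ev0 P).mapIso e₁) ((ev0 P).mapIso e₂) ((ev0 P).mapIso e₃)
        (congrArg Hom.f0 h₁) (congrArg Hom.f0 h₂)
    exact ShortComplex.shortExact_of_iso e h.shortExact_0

lemma IsShortExact.iso_comp {A A' B D : Factorization P} {f : A ⟶ B} {g : B ⟶ D}
    (h : IsShortExact f g) (e : A' ≅ A) : IsShortExact (e.hom ≫ f) g :=
  h.of_iso e.symm (Iso.refl _) (Iso.refl _) (by simp) (by simp)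

lemma IsShortExact.units_smul {A B D : Factorization P} {f : A ⟶ B} {g : B ⟶ D}
    (h : IsShortExact f g) (a : ℤˣ) : IsShortExact f (a • g) := by
  rcases Int.units_eq_one_or a with rfl | rfl
  · rwa [one_smul]
  · exact h.of_iso (Iso.refl _) (Iso.refl _) (-Iso.refl _) (by simp) (by simp)

/-- A short exact sequence `0 ⟶ A ⟶ B ⟶ D ⟶ 0` and a morphism `D ⟶ Y[1]` induce a short exact
sequence `0 ⟶ A[1] ⟶ X[1] ⟶ cone(D ⟶ Y[1]) ⟶ 0` for the extension `X` of `B` by `Y` induced by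
the negative of `B ⟶ D ⟶ Y[1]`. -/
lemma exists_isShortExact_twist {A B D Y : Factorization P} {a : A ⟶ B} {b : B ⟶ D}
    (h : IsShortExact a b) (w' : D ⟶ Y.shiftObj) :
    ∃ (v : A ⟶ twist (-(b ≫ w'))) (c : (twist (-(b ≫ w'))).shiftObj ⟶ cone w'),
      Gr.ofHom v = (Gr.ofHom a).comp (twistInl _) ∧ IsShortExact (shiftMap v) c := by
  -- The twist restricted to `A` passes through `a ≫ b = 0`, so the graded inclusion of `A` is a
  -- morphism.
  obtain ⟨v, hv⟩ := (Gr.δ_eq_zero_iff ((Gr.ofHom a).comp (twistInl (-(b ≫ w'))))).1 (by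
    rw [Gr.δ_ofHom_comp, δ_twistInl, Gr.comp_neg, ← Gr.comp_assoc, ← Gr.ofHom_comp,
      Preadditive.comp_neg, reassoc_of% h.zero, zero_comp, neg_zero, Gr.ofHom_zero, Gr.zero_comp,
      neg_zero])
  have hfb : Gr.ofHom (twistFst (-(b ≫ w')) ≫ (-(b ≫ w'))) =
      -Gr.comp (Gr.ofHom (twistFst (-(b ≫ w')) ≫ b)) (Gr.ofHom w') := by
    apply Gr.ext <;> simp
  -- The map `b` on the `B` part and the identity on the `Y` part. The minus sign in the twist makes
  -- the defects of `coneInl` and `twistSnd` cancel.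
  obtain ⟨c, hc⟩ := (Gr.δ_eq_zero_iff ((Gr.ofHom (twistFst (-(b ≫ w')) ≫ b)).sh.comp (coneInl w') +
      (twistSnd (-(b ≫ w'))).sh.comp (Gr.ofHom (coneInr w')))).1 (by
    rw [map_add, Gr.sh_ofHom, Gr.δ_ofHom_comp, Gr.δ_comp_ofHom, Gr.δ_sh, δ_twistSnd, δ_coneInl,
      hfb]
    apply Gr.ext <;> simp)
  have hcm : c.fm = biprod.fst ≫ b.f0 ≫ biprod.inl + biprod.snd ≫ biprod.inr := by
    simpa using congrArg Gr.fm hc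
  have hc0 : c.f0 = P.T.map biprod.fst ≫ P.T.map b.fm ≫ biprod.inl +
      P.T.map biprod.snd ≫ biprod.inr := by
    simpa using congrArg Gr.f0 hc
  have hvm : v.fm = a.fm ≫ biprod.inl := congrArg Gr.fm hv
  have hv0 : v.f0 = a.f0 ≫ biprod.inl := congrArg Gr.f0 hv
  have hTv : P.T.map v.fm = P.T.map a.fm ≫ P.T.map biprod.inl := by rw [hvm, Functor.map_comp]
  have hs := isExactInj_shift.shortExact h
  have habm : a.fm ≫ b.fm = 0 := congrArg Hom.fm h.zero
  have hab0 : a.f0 ≫ b.f0 = 0 := congrArg Hom.f0 h.zero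
  have hzm : v.f0 ≫ c.fm = 0 := by
    rw [hv0, hcm]; simp [reassoc_of% hab0]
  have hz0 : P.T.map v.fm ≫ c.f0 = 0 := by
    have : P.T.map a.fm ≫ P.T.map b.fm = 0 := by rw [← Functor.map_comp, habm, Functor.map_zero]
    rw [hTv, hc0]
    simp [map_inl_fst_assoc, map_inl_snd_assoc, reassoc_of% this]
  refine ⟨v, c, hv, Factorization.hom_ext hzm hz0, ?_, ?_⟩
  · have : IsIso (biprod.lift (biprod.fst : B.X0 ⊞ Y.X0 ⟶ _) biprod.snd) := by
      have : biprod.lift (biprod.fst : B.X0 ⊞ Y.X0 ⟶ _) biprod.snd = 𝟙 _ := by ext <;> simp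
      rw [this]; infer_instance
    exact shortExact_biprod h.shortExact_0 _ _ biprod.fst biprod.snd (by simp [hv0]) (by simp [hv0])
      (by simp [hcm]) (by simp [hcm]) _
  -- In this component the middle term is `Φ` of a biproduct, so the splitting needed is the
  -- comparison isomorphism.
  · have : PreservesBinaryBiproduct B.Xm Y.Xm P.T :=
      preservesBinaryBiproduct_of_preservesBiproduct _ _ _
    have : IsIso (biprod.lift (P.T.map (biprod.fst : B.Xm ⊞ Y.Xm ⟶ _)) (P.T.map biprod.snd)) :=
      inferInstanceAs (IsIso (P.T.mapBiprod B.Xm Y.Xm).hom)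
    have h₁ : P.T.map v.fm ≫ P.T.map biprod.fst = P.T.map a.fm := by
      rw [hTv, Category.assoc, map_inl_fst, Category.comp_id]
    have h₂ : P.T.map v.fm ≫ P.T.map biprod.snd = 0 := by
      rw [hTv, Category.assoc, map_inl_snd, comp_zero]
    have h₃ : c.f0 ≫ (biprod.fst : P.T.obj D.Xm ⊞ P.T.obj Y.Xm ⟶ _) =
        P.T.map biprod.fst ≫ P.T.map b.fm := by
      rw [hc0]; simp
    have h₄ : c.f0 ≫ (biprod.snd : P.T.obj D.Xm ⊞ P.T.obj Y.Xm ⟶ _) = P.T.map biprod.snd := by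
      rw [hc0]; simp
    exact shortExact_biprod (I := P.T.obj B.Xm)
      (Z := P.T.obj (B.Xm ⊞ Y.Xm)) hs.shortExact_0 _ _
      (P.T.map biprod.fst) (P.T.map biprod.snd) h₁ h₂ h₃ h₄ _

end Factorization

namespace Factorization

variable {C : Type u} [Category.{v} C] [Abelian C] {P : Potential C}

/-! ### The totalization of a bounded resolution -/

/-- A factorization `J` with injective components which represents the degree `s` part of the total
complex of graded morphisms into a resolution `R`, together with the morphism
`(R.G 0)[s + 1] ⟶ J[1]` induced by the augmentation. -/
structure InjRes.Totalization (R : InjRes P) (s s' : ℤ) (h : s + 1 = s') where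
  /-- the factorization -/
  J : Factorization P
  isInj : IsInj J
  /-- the universal family -/
  p : R.Tot J
  p_eq_zero : ∀ (n : ℕ) (m : ℤ), n + m ≠ s → p n m = 0
  totD_p : R.totD J p = 0
  exists_comp_eq : ∀ (E : Factorization P) (x : R.Tot E),
    (∀ (n : ℕ) (m : ℤ), n + m ≠ s → x n m = 0) → ∃ y : Gr E J, ∀ n m, y.comp (p n m) = x n m
  eq_zero_of_comp : ∀ (E : Factorization P) (y : Gr E J), (∀ n m, y.comp (p n m) = 0) → y = 0
  /-- the augmentation -/
  u : (shiftPow P s').obj (R.G 0) ⟶ J.shiftObj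
  u_comp_zero : ((Gr.ofHom u).comp (p 0 s).sh).comp (Gr.ofHom (τ s s' h (R.I 0)).hom) =
    Gr.ofHom ((shiftPow P s').map (R.i 0))
  u_comp_succ : ∀ n m, (Gr.ofHom u).comp (p (n + 1) m).sh = 0

lemma isZero_of_isZero_components {E : Factorization P} (hm : IsZero E.Xm) (h0 : IsZero E.X0) :
    IsZero E := by
  rw [IsZero.iff_id_eq_zero]
  exact Factorization.hom_ext (hm.eq_of_src _ _) (h0.eq_of_src _ _)

lemma Gr.eq_of_isZero_tgt {E G : Factorization P} (h : IsZero G) (x y : Gr E G) : x = y :=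
  Gr.ext (((evm P).map_isZero h).eq_of_tgt _ _) (((ev0 P).map_isZero h).eq_of_tgt _ _)

lemma Gr.eq_of_isZero_src {E G : Factorization P} (h : IsZero E) (x y : Gr E G) : x = y :=
  Gr.ext (((evm P).map_isZero h).eq_of_src _ _) (((ev0 P).map_isZero h).eq_of_src _ _)

lemma Gr.ofHom_neg {E G : Factorization P} (f : E ⟶ G) : Gr.ofHom (-f) = -Gr.ofHom f := rfl

lemma Gr.ofHom_units_smul {E G : Factorization P} (a : ℤˣ) (f : E ⟶ G) :
    Gr.ofHom (a • f) = a • Gr.ofHom f := by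
  rcases Int.units_eq_one_or a with rfl | rfl
  · rw [one_smul, one_smul]
  · rw [Units.neg_smul, Units.neg_smul, one_smul, one_smul, Gr.ofHom_neg]

lemma δPow_single_ofHom {E G : Factorization P} (s m m' : ℤ) (h : m + 1 = m')
    (f : E ⟶ (shiftPow P s).obj G) :
    δPow E G m m' h ((Pi.single s (Gr.ofHom f) : ∀ m, Gr E ((shiftPow P m).obj G)) m) = 0 := by
  by_cases hm : m = s
  · subst hm
    rw [Pi.single_eq_same, δPow_apply, Gr.δ_ofHom, Gr.zero_comp]
  · rw [Pi.single_eq_of_ne hm, map_zero]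

namespace InjRes

variable (R : InjRes P)

lemma exists_totalization_of_isZero (hG : ∀ n, IsZero (R.G n)) (hI : ∀ n, IsZero (R.I n))
    (s s' : ℤ) (h : s + 1 = s') {S : ObjectProperty (HoFact P)} (hS : IsThick S) :
    ∃ X : R.Totalization s s' h, S ((toHo P).obj (cone X.u)) := by
  have hO : IsZero (0 : Factorization P) := isZero_zero _
  have hu : IsZero ((shiftPow P s').obj (R.G 0)) := (shiftPow P s').map_isZero (hG 0)
  refine ⟨{
    J := 0
    isInj := ⟨((evm P).map_isZero hO).injective, ((ev0 P).map_isZero hO).injective⟩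
    p := 0
    p_eq_zero := fun _ _ _ => rfl
    totD_p := map_zero _
    exists_comp_eq := fun E x _ => ⟨0, fun n m =>
      Gr.eq_of_isZero_tgt ((shiftPow P m).map_isZero (hI n)) _ _⟩
    eq_zero_of_comp := fun E y _ => Gr.eq_of_isZero_tgt hO _ _
    u := 0
    u_comp_zero := Gr.eq_of_isZero_src hu _ _
    u_comp_succ := fun _ _ => Gr.eq_of_isZero_src hu _ _ }, ?_⟩
  exact hS.cone _ (hS.zero _ ((toHo P).map_isZero hu))
    (hS.zero _ ((toHo P).map_isZero ((shift P).map_isZero hO)))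

lemma map_π_comp_map_i (s : ℤ) (n : ℕ) :
    (shiftPow P s).map (R.π n) ≫ (shiftPow P s).map (R.i (n + 1)) = (shiftPow P s).map (R.d n) :=
  ((shiftPow P s).map_comp _ _).symm

variable {R}

section Step

variable {s₀ s s' : ℤ} {h₀ : s₀ + 1 = s} (h : s + 1 = s') (Y : R.tail.Totalization s₀ s h₀)

/-- The morphism classifying the totalization of a resolution as an extension. -/
abbrev Totalization.twistMap : (shiftPow P s).obj (R.I 0) ⟶ Y.J.shiftObj :=
  -((s.negOnePow • (shiftPow P s).map (R.π 0)) ≫ Y.u)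

/-- The universal family of the totalization of a resolution. -/
def Totalization.twistFamily : R.Tot (twist Y.twistMap)
  | 0, m => (Pi.single s (Gr.ofHom (twistFst Y.twistMap)) :
      ∀ m, Gr (twist Y.twistMap) ((shiftPow P m).obj (R.I 0))) m
  | n + 1, m => (twistSnd Y.twistMap).comp (Y.p n m)

lemma Totalization.twistFamily_zero_self :
    Y.twistFamily 0 s = Gr.ofHom (twistFst Y.twistMap) :=
  Pi.single_eq_same (M := fun m => Gr (twist Y.twistMap) ((shiftPow P m).obj (R.I 0))) s _

lemma Totalization.twistFamily_zero_of_ne {m : ℤ} (hm : m ≠ s) : Y.twistFamily 0 m = 0 :=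
  Pi.single_eq_of_ne (M := fun m => Gr (twist Y.twistMap) ((shiftPow P m).obj (R.I 0))) hm _

lemma Totalization.twistFamily_succ (n : ℕ) (m : ℤ) :
    Y.twistFamily (n + 1) m = (twistSnd Y.twistMap).comp (Y.p n m) := rfl

/-- Composed with the first entry of the tail's universal family, the twist is the resolution
differential up to sign. -/
lemma Totalization.twistMap_comp_zero : ((Gr.ofHom Y.twistMap).comp (Y.p 0 s₀).sh).comp
    (Gr.ofHom (τ s₀ s h₀ (R.I 1)).hom) =
      -(s.negOnePow • Gr.ofHom ((shiftPow P s).map (R.d 0))) := by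
  have hY : ((Gr.ofHom Y.u).comp (Y.p 0 s₀).sh).comp (Gr.ofHom (τ s₀ s h₀ (R.I 1)).hom) =
      Gr.ofHom ((shiftPow P s).map (R.i 1)) := Y.u_comp_zero
  rw [Gr.ofHom_neg, Gr.ofHom_comp, Gr.ofHom_units_smul, Gr.neg_comp, Gr.neg_comp, Gr.units_smul_comp,
    Gr.units_smul_comp, Gr.units_smul_comp, Gr.comp_assoc (Gr.ofHom ((shiftPow P s).map _)),
    Gr.comp_assoc (Gr.ofHom ((shiftPow P s).map _)), hY, ← Gr.ofHom_comp, map_π_comp_map_i]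

lemma Totalization.twistMap_comp_succ (n : ℕ) (m : ℤ) :
    (Gr.ofHom Y.twistMap).comp (Y.p (n + 1) m).sh = 0 := by
  rw [Gr.ofHom_neg, Gr.ofHom_comp, Gr.neg_comp, Gr.comp_assoc, Y.u_comp_succ, Gr.comp_zero,
    neg_zero]

/-- Row zero is a morphism, hence has no defect. In row one the defect caused by the twist cancels
the resolution differential, and the higher rows reduce to the tail's family. -/
lemma Totalization.totD_twistFamily : R.totD _ Y.twistFamily = 0 := by
  have key : ∀ n m, R.totD _ Y.twistFamily (n + 1) m =
      (((Gr.ofHom (twistFst Y.twistMap)).comp ((Gr.ofHom Y.twistMap).comp (Y.p n (m - 1)).sh)).comp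
        (Gr.ofHom (τ (m - 1) m (sub_add_cancel m 1) (R.I (n + 1))).hom) +
      (twistSnd Y.twistMap).comp (δPow _ (R.I (n + 1)) (m - 1) m (sub_add_cancel m 1)
        (Y.p n (m - 1)))) + m.negOnePow • (Y.twistFamily n m).comp
          (Gr.ofHom ((shiftPow P m).map (R.d n))) := by
    intro n m
    rw [totD_succ, vert_apply, twistFamily_succ, δPow_apply, Gr.δ_comp, δ_twistSnd, Gr.add_comp,
      Gr.ofHom_comp, Gr.comp_assoc (Gr.ofHom (twistFst _)), δPow_apply,
      Gr.comp_assoc (twistSnd _) (Gr.δ _ _ _)]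
  have hY : ∀ n m, R.tail.totD _ Y.p n m = 0 := fun n m => by rw [Y.totD_p]; rfl
  funext n m
  rcases n with _ | _ | n
  · rw [totD_zero]
    exact δPow_single_ofHom s _ _ _ _
  · have hY0 := hY 0 m
    rw [totD_zero] at hY0
    rw [key]
    erw [hY0]
    rw [Gr.comp_zero, add_zero, Gr.comp_assoc (Gr.ofHom (twistFst _))]
    -- Only the column `m = s` carries `I 0`; there the sign `(-1)^s` built into the twist matches
    -- `(-1)^m` in the total differential.
    by_cases hm : m = s
    · subst hm
      obtain rfl : s₀ = m - 1 := by lia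
      erw [Y.twistMap_comp_zero]
      rw [twistFamily_zero_self, Gr.comp_neg, Gr.comp_units_smul, neg_add_cancel]
      rfl
    · rw [Y.p_eq_zero 0 (m - 1) (by lia), Y.twistFamily_zero_of_ne hm, Gr.sh_zero]
      simp
  · have hY0 := hY (n + 1) m
    rw [totD_succ, vert_apply] at hY0
    rw [key, twistMap_comp_succ, Gr.comp_zero, Gr.zero_comp, zero_add, twistFamily_succ,
      Gr.comp_assoc, ← Gr.comp_units_smul, ← Gr.comp_add]
    erw [hY0]
    rw [Gr.comp_zero]
    rfl

/-- The totalization of a resolution, from the one of its tail. -/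
lemma Totalization.exists_step {S : ObjectProperty (HoFact P)} (hS : IsThick S)
    (hT : ∀ T : Factorization P, IsTotOfBoundedExact T → S ((toHo P).obj T))
    (hY : S ((toHo P).obj (cone Y.u))) :
    ∃ X : R.Totalization s s' h, S ((toHo P).obj (cone X.u)) := by
  -- Rescaling the projection by `(-1)^s` keeps exactness and makes the resulting twist equal to
  -- `Y.twistMap`.
  obtain ⟨v, c, hv, hvc⟩ := exists_isShortExact_twist
    (((isExactInj_shiftPow s).shortExact (R.shortExact 0)).units_smul s.negOnePow) Y.u
  -- The third term is the cone of the tail's augmentation, which lies in `S`; so does the cone of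
  -- the new augmentation.
  have hcone := (hvc.iso_comp (τ s s' h (R.G 0)).symm).cone_mem hS hT hY
  refine ⟨{ J := twist Y.twistMap
            isInj := ?_
            p := Y.twistFamily
            p_eq_zero := ?_
            totD_p := Y.totD_twistFamily
            exists_comp_eq := ?_
            eq_zero_of_comp := ?_
            u := (τ s s' h (R.G 0)).inv ≫ shiftMap v
            u_comp_zero := ?_
            u_comp_succ := ?_ }, hcone⟩
  · have := Y.isInj.1
    have := Y.isInj.2
    have := (isExactInj_shiftPow s).injective_m (R.injective_m 0) (R.injective_0 0)
    have := (isExactInj_shiftPow s).injective_0 (R.injective_m 0) (R.injective_0 0)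
    exact ⟨inferInstanceAs (Injective (_ ⊞ _)), inferInstanceAs (Injective (_ ⊞ _))⟩
  · intro n m hn
    cases n with
    | zero => exact Y.twistFamily_zero_of_ne (by simpa using hn)
    | succ n => rw [twistFamily_succ, Y.p_eq_zero n m (by lia), Gr.comp_zero]
  · intro E x hx
    obtain ⟨y, hy⟩ := Y.exists_comp_eq E (fun n m => x (n + 1) m) fun n m hn => hx _ _ (by lia)
    refine ⟨(x 0 s).comp (twistInl _) + y.comp (twistInr _), fun n m => ?_⟩
    rcases n with _ | n
    · by_cases hm : m = s
      · subst hm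
        rw [twistFamily_zero_self, Gr.add_comp, Gr.comp_assoc, Gr.comp_assoc, twistInl_comp_fst,
          twistInr_comp_fst, Gr.comp_zero, add_zero, Gr.comp_id]
      · rw [Y.twistFamily_zero_of_ne hm, Gr.comp_zero, hx 0 m (by simpa using hm)]
    · rw [twistFamily_succ, ← Gr.comp_assoc, Gr.add_comp, Gr.comp_assoc, Gr.comp_assoc y,
        twistInl_comp_snd, twistInr_comp_snd, Gr.comp_zero, zero_add, Gr.comp_id, hy]
  · intro E y hy
    have h₁ := hy 0 s
    rw [twistFamily_zero_self] at h₁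
    have h₂ := Y.eq_zero_of_comp E (y.comp (twistSnd _)) fun n m => by
      rw [Gr.comp_assoc]; exact hy (n + 1) m
    rw [← twist_decomposition _ y, h₁, h₂, Gr.zero_comp, Gr.zero_comp, add_zero]
  · have h₁ : (Gr.ofHom v).comp (Gr.ofHom (twistFst Y.twistMap)) =
        Gr.ofHom ((shiftPow P s).map (R.i 0)) := by
      rw [hv, Gr.comp_assoc]
      erw [twistInl_comp_fst]
      rw [Gr.comp_id]
    rw [twistFamily_zero_self, Gr.ofHom_comp, Gr.comp_assoc (Gr.ofHom (Iso.inv _)), ← Gr.sh_ofHom v,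
      ← Gr.sh_comp, h₁, Gr.sh_ofHom, Gr.comp_assoc, ← Gr.ofHom_comp, τ_hom_naturality,
      ← Gr.ofHom_comp, Iso.inv_hom_id_assoc]
  · intro n m
    have h₁ : (Gr.ofHom v).comp (twistSnd Y.twistMap) = 0 := by
      rw [hv, Gr.comp_assoc]
      erw [twistInl_comp_snd]
      rw [Gr.comp_zero]
    rw [twistFamily_succ, Gr.ofHom_comp, Gr.comp_assoc, ← Gr.sh_ofHom v, ← Gr.sh_comp,
      ← Gr.comp_assoc, h₁, Gr.zero_comp, Gr.sh_zero, Gr.comp_zero]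

end Step

/-- Induction on the length of the resolution. The tail is totalized in degree `s - 1`, because its
index `n` is one less than in `R`. -/
lemma exists_totalization {S : ObjectProperty (HoFact P)} (hS : IsThick S)
    (hT : ∀ T : Factorization P, IsTotOfBoundedExact T → S ((toHo P).obj T)) (N : ℕ) :
    ∀ (R : InjRes P) (_ : R.IsBounded N) (s s' : ℤ) (h : s + 1 = s'),
      ∃ X : R.Totalization s s' h, S ((toHo P).obj (cone X.u)) := by
  induction N with
  | zero =>
    intro R hR s s' h
    exact R.exists_totalization_of_isZero
      (fun n => isZero_of_isZero_components (hR.1 n n.zero_le) (hR.2 n n.zero_le))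
      (fun n => isZero_of_isZero_components (hR.3 n n.zero_le) (hR.4 n n.zero_le)) s s' h hS
  | succ N ih =>
    intro R hR s s' h
    obtain ⟨Y, hY⟩ := ih R.tail ⟨fun n hn => hR.1 _ (by lia), fun n hn => hR.2 _ (by lia),
      fun n hn => hR.3 _ (by lia), fun n hn => hR.4 _ (by lia)⟩ (s - 1) s (by ring)
    exact Totalization.exists_step h Y hS hT hY

end InjRes

end Factorization

namespace Factorization

variable {C : Type u} [Category.{v} C] [Abelian C] {P : Potential C}

/-! ### Maps to factorizations with injective components in Verdier quotients -/

/-- The map `f` induces a cocycle on `cone g` through the projection to `A[1]`. A primitive of it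
has a `B`-part, which extends `f` along `g`, and an `A[1]`-part, which is the homotopy. -/
lemma exists_comp_eq_of_orth_cone {A B J : Factorization P} (g : A ⟶ B)
    (hg : orth P ((toHo P).obj (cone g))) (hJ : IsInj J) (f : (toHo P).obj A ⟶ (toHo P).obj J) :
    ∃ b : (toHo P).obj B ⟶ (toHo P).obj J, f = (toHo P).map g ≫ b := by
  obtain ⟨K, hK, ⟨e⟩⟩ := hJ.exists_iso_shiftObj
  suffices h : ∀ f : A ⟶ K.shiftObj, ∃ b : B ⟶ K.shiftObj, (toHo P).map f = (toHo P).map (g ≫ b) by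
    obtain ⟨f, rfl⟩ := (toHo P).map_surjective f
    obtain ⟨b, hb⟩ := h (f ≫ e.inv)
    refine ⟨(toHo P).map (b ≫ e.hom), ?_⟩
    rw [← cancel_mono ((toHo P).map e.inv), ← Functor.map_comp, hb, Category.assoc,
      ← Functor.map_comp, Category.assoc, e.hom_inv_id, Category.comp_id, Functor.map_comp]
  intro f
  obtain ⟨z, hz⟩ := (orth_iff _).1 hg _ ((isInj_shiftObj_iff K).2 hK)
    ((Gr.ofHom (coneFst g)).comp (Gr.ofHom f).sh)
    (by rw [Gr.δ_ofHom_comp, Gr.sh_ofHom, Gr.δ_ofHom, Gr.comp_zero])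
  obtain ⟨b, hb⟩ := (Gr.δ_eq_zero_iff ((Gr.ofHom (coneInr g)).comp z)).1 (by
    rw [Gr.δ_ofHom_comp, hz, coneInr_comp_fst])
  obtain ⟨a, ha⟩ := Gr.sh_bijective.2 ((coneInl g).comp z)
  have h : Gr.δ A K (-a) = Gr.ofHom (f - g ≫ b) := by
    apply Gr.sh_bijective.1
    have h₁ := Gr.δ_comp (coneInl g) z
    rw [← ha, Gr.δ_sh, δ_coneInl, Gr.neg_comp, Gr.comp_assoc, ← Gr.sh_comp, ← hb, ← Gr.sh_comp, hz,
      coneInl_comp_fst] at h₁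
    have h₂ : (Gr.δ A K (-a)).sh = -(Gr.δ A K a).sh := by
      rw [map_neg]
      ext <;> simp
    rw [h₂, h₁, Gr.ofHom_sub, Gr.sh_sub, Gr.ofHom_comp]
    abel
  have h' := (toHo_map_eq_zero_iff (f - g ≫ b)).2 ⟨_, h⟩
  exact ⟨b, by rwa [Functor.map_sub, sub_eq_zero] at h'⟩

section

variable {S : ObjectProperty (HoFact P)} (hS : IsThick S) (hO : S ≤ orth P)

include hO in
lemma exists_retraction {J : Factorization P} (hJ : IsInj J) {X Y : HoFact P} (t : X ⟶ Y)
    (ht : (verdierW S).multiplicativeClosure t) :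
    ∀ f : X ⟶ (toHo P).obj J, ∃ b : Y ⟶ (toHo P).obj J, f = t ≫ b := by
  induction ht with
  | of t ht =>
    intro f
    obtain ⟨g, rfl, hg⟩ := ht
    exact exists_comp_eq_of_orth_cone g (hO _ hg) hJ f
  | id X => exact fun f => ⟨f, (Category.id_comp f).symm⟩
  | comp_of t t' ht ht' ih =>
    intro f
    obtain ⟨b, rfl⟩ := ih f
    obtain ⟨g, rfl, hg⟩ := ht'
    obtain ⟨b', rfl⟩ := exists_comp_eq_of_orth_cone g (hO _ hg) hJ b
    exact ⟨b', (Category.assoc _ _ _).symm⟩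

-- Every denominator starting at `J` has a retraction in the homotopy category, so left fractions
-- into `J` collapse to ordinary maps, and maps equalized by a denominator were already equal.
include hS hO in
lemma bijective_toVerdier_map (X : HoFact P) {J : Factorization P} (hJ : IsInj J) :
    Function.Bijective (fun f : X ⟶ (toHo P).obj J => (verdierW S).Q.map f) := by
  have := hS.hasLeftCalculusOfFractions
  constructor
  · intro f g hfg
    obtain ⟨Z, t, ht, h⟩ := (MorphismProperty.map_eq_iff_postcomp (verdierW S).Q
      (verdierW S).multiplicativeClosure f g).1 hfg
    obtain ⟨r, hr⟩ := exists_retraction hO hJ t ht (𝟙 _)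
    rw [← Category.comp_id f, ← Category.comp_id g, hr, reassoc_of% h]
  · intro φ
    obtain ⟨y, rfl⟩ := Localization.exists_leftFraction (verdierW S).Q
      (verdierW S).multiplicativeClosure φ
    obtain ⟨r, hr⟩ := exists_retraction hO hJ y.s y.hs (𝟙 _)
    have := Localization.inverts (verdierW S).Q (verdierW S).multiplicativeClosure y.s y.hs
    refine ⟨y.f ≫ r, ?_⟩
    rw [← cancel_mono ((verdierW S).Q.map y.s)]
    have h := y.map_comp_map_s (verdierW S).Q
      (Localization.inverts (verdierW S).Q (verdierW S).multiplicativeClosure)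
    have h' : (verdierW S).Q.map r ≫ (verdierW S).Q.map y.s = 𝟙 _ := by
      rw [← cancel_epi ((verdierW S).Q.map y.s), ← Functor.map_comp_assoc, ← hr]
      simp
    rw [h]
    dsimp only
    rw [Functor.map_comp, Category.assoc, h', Category.comp_id]

end

/-! ### Graded morphisms to the translate of a totalization -/

/-- A family of graded morphisms which detects the vanishing of graded morphisms. -/
def IsJointlyMono {ι : Type*} {J : Factorization P} {K : ι → Factorization P}
    (p : ∀ i, Gr J (K i)) : Prop :=
  ∀ (E : Factorization P) (y : Gr E J), (∀ i, y.comp (p i) = 0) → y = 0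

/-- Replacing the source by a translate turns graded maps into `J[1]` into translates of graded maps
into `J`, so the universal property of `J` passes to `J[1]`. -/
lemma exists_sh_eq (E : Factorization P) : ∃ (E' : Factorization P) (e : E'.shiftObj ≅ E),
    ∀ (J : Factorization P) (y : Gr E J.shiftObj), ∃ y' : Gr E' J,
      (Gr.ofHom e.hom).comp y = y'.sh :=
  ⟨_, (shift P).objObjPreimageIso E, fun _ y =>
    ⟨_, (Gr.sh_bijective.2 ((Gr.ofHom ((shift P).objObjPreimageIso E).hom).comp y)).choose_spec.symm⟩⟩

lemma IsJointlyMono.sh {ι : Type*} {J : Factorization P} {K : ι → Factorization P}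
    {p : ∀ i, Gr J (K i)} (hp : IsJointlyMono p) : IsJointlyMono fun i => (p i).sh := by
  intro E y hy
  obtain ⟨E', e, he⟩ := exists_sh_eq E
  obtain ⟨y', hy'⟩ := he J y
  have : y' = 0 := hp E' y' fun i => Gr.sh_bijective.1 (by
    rw [Gr.sh_comp, ← hy', Gr.comp_assoc, hy, Gr.comp_zero, Gr.sh_zero])
  rw [← Gr.ofHom_comp_id_comp e.inv_hom_id y, hy', this, Gr.sh_zero, Gr.comp_zero]

namespace InjRes

variable {R : InjRes P} {s s' : ℤ} {h : s + 1 = s'} (X : R.Totalization s s' h)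

variable (R) in
/-- The homogeneous families of degree `q`. -/
def totDeg (E : Factorization P) (q : ℤ) : AddSubgroup (R.Tot E) where
  carrier := {x | ∀ (n : ℕ) (m : ℤ), n + m ≠ q → x n m = 0}
  zero_mem' := fun _ _ _ => rfl
  add_mem' := fun hx hy n m h => by
    rw [Pi.add_apply, Pi.add_apply, hx n m h, hy n m h, add_zero]
  neg_mem' := fun hx n m h => by rw [Pi.neg_apply, Pi.neg_apply, hx n m h, neg_zero]

namespace Totalization

lemma isJointlyMono : IsJointlyMono (fun i : ℕ × ℤ => X.p i.1 i.2) :=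
  fun E y hy => X.eq_zero_of_comp E y fun n m => hy (n, m)

/-- The family given by a graded morphism to the totalization. -/
def family (E : Factorization P) : Gr E X.J →+ R.Tot E where
  toFun y n m := y.comp (X.p n m)
  map_zero' := by funext n m; exact Gr.zero_comp _
  map_add' y z := by funext n m; exact Gr.add_comp _ _ _

/-- The family given by a graded morphism to the translate of the totalization. -/
def familySh (E : Factorization P) : Gr E X.J.shiftObj →+ R.Tot E where
  toFun c n m := (c.comp (X.p n (m - 1)).sh).comp
    (Gr.ofHom (τ (m - 1) m (sub_add_cancel m 1) (R.I n)).hom)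
  map_zero' := by funext n m; rw [Gr.zero_comp, Gr.zero_comp]; rfl
  map_add' c c' := by funext n m; rw [Gr.add_comp, Gr.add_comp]; rfl

variable {E : Factorization P}

lemma family_apply (y : Gr E X.J) (n : ℕ) (m : ℤ) : X.family E y n m = y.comp (X.p n m) := rfl

lemma familySh_apply (c : Gr E X.J.shiftObj) (n : ℕ) (m : ℤ) : X.familySh E c n m =
    (c.comp (X.p n (m - 1)).sh).comp
      (Gr.ofHom (τ (m - 1) m (sub_add_cancel m 1) (R.I n)).hom) := rfl

lemma family_mem (y : Gr E X.J) : X.family E y ∈ R.totDeg E s := fun n m hn => by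
  rw [family_apply, X.p_eq_zero n m hn, Gr.comp_zero]

lemma exists_family_eq {x : R.Tot E} (hx : x ∈ R.totDeg E s) : ∃ y, X.family E y = x := by
  obtain ⟨y, hy⟩ := X.exists_comp_eq E x hx
  exact ⟨y, by funext n m; exact hy n m⟩

lemma comp_τ_hom_eq_zero_iff {G : Factorization P} {m m' : ℤ} (h : m + 1 = m')
    (x : Gr E ((shiftPow P m).obj G).shiftObj) :
    x.comp (Gr.ofHom (τ m m' h G).hom) = 0 ↔ x = 0 := by
  constructor
  · intro hx
    rw [← Gr.comp_ofHom_comp_id (τ m m' h G).hom_inv_id x, hx, Gr.zero_comp]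
  · rintro rfl
    exact Gr.zero_comp _

lemma familySh_injective : Function.Injective (X.familySh E) := by
  rw [injective_iff_map_eq_zero]
  intro c hc
  refine X.isJointlyMono.sh E c fun ⟨n, m⟩ => ?_
  obtain ⟨m, rfl⟩ : ∃ m', m = m' - 1 := ⟨m + 1, by ring⟩
  have := congrFun (congrFun hc n) m
  rwa [familySh_apply, Pi.zero_apply, Pi.zero_apply, comp_τ_hom_eq_zero_iff] at this

lemma familySh_mem (c : Gr E X.J.shiftObj) : X.familySh E c ∈ R.totDeg E s' := fun n m hn => by
  rw [familySh_apply, X.p_eq_zero n (m - 1) (by lia), Gr.sh_zero, Gr.comp_zero, Gr.zero_comp]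

lemma exists_familySh_eq {x : R.Tot E} (hx : x ∈ R.totDeg E s') : ∃ c, X.familySh E c = x := by
  obtain ⟨E', e, he⟩ := exists_sh_eq E
  choose z hz using fun n m => he ((shiftPow P m).obj (R.I n))
    ((x n (m + 1)).comp (Gr.ofHom (τ m (m + 1) rfl (R.I n)).inv))
  obtain ⟨y, hy⟩ := X.exists_comp_eq E' z fun n m hn => Gr.sh_bijective.1 (by
    rw [← hz, hx n (m + 1) (by lia), Gr.zero_comp, Gr.comp_zero, Gr.sh_zero])
  refine ⟨(Gr.ofHom e.inv).comp y.sh, ?_⟩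
  have key : ∀ (n : ℕ) (m m' : ℤ) (h : m + 1 = m'), (((Gr.ofHom e.inv).comp y.sh).comp
      (X.p n m).sh).comp (Gr.ofHom (τ m m' h (R.I n)).hom) = x n m' := by
    rintro n m _ rfl
    rw [Gr.comp_assoc (Gr.ofHom e.inv), ← Gr.sh_comp, hy, ← hz,
      Gr.ofHom_comp_id_comp e.inv_hom_id, Gr.comp_ofHom_comp_id (Iso.inv_hom_id _)]
  funext n m
  exact key n (m - 1) m _

/-- The universal family is a cocycle, so by the Leibniz rule only the defect of `y` contributes. -/
lemma totD_family (y : Gr E X.J) : R.totD E (X.family E y) = X.familySh E (Gr.δ _ _ y) := by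
  have hp : ∀ n m, R.totD _ X.p n m = 0 := fun n m => by rw [X.totD_p]; rfl
  have key : ∀ n m, δPow E (R.I n) (m - 1) m (sub_add_cancel m 1) (y.comp (X.p n (m - 1))) =
      X.familySh E (Gr.δ _ _ y) n m +
        y.comp (δPow _ (R.I n) (m - 1) m (sub_add_cancel m 1) (X.p n (m - 1))) := by
    intro n m
    rw [δPow_apply, Gr.δ_comp, Gr.add_comp, familySh_apply, δPow_apply, Gr.comp_assoc y]
  funext n m
  cases n with
  | zero =>
    rw [totD_zero, family_apply, key, ← R.totD_zero, hp, Gr.comp_zero, add_zero]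
  | succ n =>
    rw [totD_succ, family_apply, key, add_assoc, vert_apply, family_apply, Gr.comp_assoc,
      ← Gr.comp_units_smul, ← vert_apply, ← Gr.comp_add, ← totD_succ, hp, Gr.comp_zero, add_zero]

/-- Translation contributes a sign through `δ_sh` and another through the change of `m` by one. They
agree, so the terms from the universal family cancel again. -/
lemma totD_familySh (c : Gr E X.J.shiftObj) (n : ℕ) (m : ℤ) :
    R.totD E (X.familySh E c) n m =
      (((Gr.δ _ _ c).comp (X.p n (m - 1 - 1)).sh.sh).comp
        (Gr.ofHom (shiftMap (τ (m - 1 - 1) (m - 1) (sub_add_cancel _ 1) (R.I n)).hom))).comp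
        (Gr.ofHom (τ (m - 1) m (sub_add_cancel m 1) (R.I n)).hom) := by
  have hp : ∀ n m, R.totD _ X.p n m = 0 := fun n m => by rw [X.totD_p]; rfl
  have key : δPow E (R.I n) (m - 1) m (sub_add_cancel m 1) (X.familySh E c n (m - 1)) =
      (((Gr.δ _ _ c).comp (X.p n (m - 1 - 1)).sh.sh).comp
        (Gr.ofHom (shiftMap (τ (m - 1 - 1) (m - 1) (sub_add_cancel _ 1) (R.I n)).hom))).comp
        (Gr.ofHom (τ (m - 1) m (sub_add_cancel m 1) (R.I n)).hom) -
      (c.comp (δPow _ (R.I n) (m - 1 - 1) (m - 1) (sub_add_cancel _ 1) (X.p n (m - 1 - 1))).sh).comp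
        (Gr.ofHom (τ (m - 1) m (sub_add_cancel m 1) (R.I n)).hom) := by
    rw [δPow_apply, familySh_apply, Gr.δ_comp_ofHom, Gr.δ_comp, Gr.δ_sh, δPow_apply, Gr.sh_comp,
      Gr.sh_ofHom, Gr.comp_neg, ← sub_eq_add_neg, Gr.sub_comp, Gr.sub_comp, Gr.comp_assoc c]
  cases n with
  | zero =>
    rw [totD_zero, key, ← R.totD_zero, hp, Gr.sh_zero, Gr.comp_zero, Gr.zero_comp, sub_zero]
  | succ n =>
    have hpn := hp (n + 1) (m - 1)
    rw [totD_succ, add_eq_zero_iff_eq_neg] at hpn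
    have hs : (m - 1).negOnePow = -m.negOnePow := by rw [Int.negOnePow_sub]; simp
    have hv : R.vert E m n (X.familySh E c n m) = (c.comp (R.vert _ (m - 1) n (X.p n (m - 1))).sh).comp
        (Gr.ofHom (τ (m - 1) m (sub_add_cancel m 1) (R.I (n + 1))).hom) := by
      rw [vert_apply, vert_apply, familySh_apply, Gr.comp_assoc, ← Gr.ofHom_comp,
        ← τ_hom_naturality, Gr.ofHom_comp, ← Gr.sh_ofHom, Gr.sh_comp, Gr.comp_assoc, Gr.comp_assoc,
        Gr.comp_assoc]
    rw [totD_succ, key, hpn, hs, Units.neg_smul, neg_neg, hv, Gr.sh_units_smul, Gr.comp_units_smul,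
      Gr.units_smul_comp, sub_add_cancel]

lemma totD_familySh_eq_zero_iff (c : Gr E X.J.shiftObj) :
    R.totD E (X.familySh E c) = 0 ↔ Gr.δ _ _ c = 0 := by
  constructor
  · intro hc
    refine X.isJointlyMono.sh.sh E _ fun ⟨n, m⟩ => ?_
    obtain ⟨m, rfl⟩ : ∃ m', m = m' - 1 - 1 := ⟨m + 1 + 1, by ring⟩
    have := congrFun (congrFun hc n) m
    rw [totD_familySh, Pi.zero_apply, Pi.zero_apply, comp_τ_hom_eq_zero_iff] at this
    have e := shiftMap_hom_inv_id (τ (m - 1 - 1) (m - 1) (sub_add_cancel _ 1) (R.I n))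
    rw [← Gr.comp_ofHom_comp_id e (Gr.comp _ _)]
    exact (congrArg (fun x => Gr.comp x _) this).trans (Gr.zero_comp _)
  · intro hc
    funext n m
    rw [totD_familySh, hc, Gr.zero_comp, Gr.zero_comp, Gr.zero_comp]
    rfl

end Totalization

end InjRes

end Factorization

namespace Factorization

variable {C : Type u} [Category.{v} C] [Abelian C] {P : Potential C}

/-! ### The groups of morphisms in Verdier quotients -/

namespace InjRes

variable {R : InjRes P}

/-- Morphisms to the translate of the totalization are the cocycles of the total complex. -/
lemma Totalization.exists_addEquiv {s q : ℤ} {h : s + 1 = q} (X : R.Totalization s q h)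
    (E : Factorization P) :
    ∃ e : (R.totDeg E q ⊓ (R.totD E).ker : AddSubgroup (R.Tot E)) ≃+ (E ⟶ X.J.shiftObj),
      ∀ x, (toHo P).map (e x) = 0 ↔ ∃ y ∈ R.totDeg E s, R.totD E y = x := by
  let φ : (E ⟶ X.J.shiftObj) →+ (R.totDeg E q ⊓ (R.totD E).ker : AddSubgroup (R.Tot E)) :=
    { toFun := fun f => ⟨X.familySh E (Gr.ofHom f), X.familySh_mem _,
        (X.totD_familySh_eq_zero_iff _).2 (Gr.δ_ofHom f)⟩
      map_zero' := Subtype.ext ((congrArg _ Gr.ofHom_zero).trans (map_zero _))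
      map_add' := fun f g => Subtype.ext ((congrArg _ (Gr.ofHom_add f g)).trans (map_add _ _ _)) }
  have hφ : Function.Bijective φ := by
    constructor
    · intro f g hfg
      exact Gr.ofHom_injective (X.familySh_injective (congrArg Subtype.val hfg))
    · rintro ⟨x, hx, hx'⟩
      obtain ⟨c, rfl⟩ := X.exists_familySh_eq hx
      obtain ⟨f, rfl⟩ := (Gr.δ_eq_zero_iff c).1 ((X.totD_familySh_eq_zero_iff c).1 hx')
      exact ⟨f, rfl⟩
  refine ⟨(AddEquiv.ofBijective φ hφ).symm, fun x => ?_⟩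
  obtain ⟨f, rfl⟩ := (AddEquiv.ofBijective φ hφ).surjective x
  rw [AddEquiv.symm_apply_apply, toHo_map_eq_zero_iff]
  constructor
  · rintro ⟨y, hy⟩
    exact ⟨X.family E y, X.family_mem y, by rw [X.totD_family, hy]; rfl⟩
  · rintro ⟨_, hy, hy'⟩
    obtain ⟨y, rfl⟩ := X.exists_family_eq hy
    rw [X.totD_family] at hy'
    exact ⟨y, X.familySh_injective hy'⟩

variable {S : ObjectProperty (HoFact P)} (hS : IsThick S)
  (hT : ∀ T : Factorization P, IsTotOfBoundedExact T → S ((toHo P).obj T)) (hO : S ≤ orth P)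

include hT hO in
/-- The groups of morphisms in a Verdier quotient are the cohomology groups of the total
complex. -/
lemma exists_addMonoidHom {N : ℕ} (hR : R.IsBounded N) (E : Factorization P) (q : ℤ) :
    letI := hS.preadditive
    ∃ f : (R.totDeg E q ⊓ (R.totD E).ker : AddSubgroup (R.Tot E)) →+
        ((toVerdier S).obj E ⟶ (toVerdier S).obj ((shiftPow P q).obj (R.G 0))),
      Function.Surjective f ∧ ∀ x, f x = 0 ↔ ∃ y ∈ R.totDeg E (q - 1), R.totD E y = x := by
  let := hS.preadditive
  have := hS.additive
  -- Totalizing in degree `q - 1` makes the translate `X.J[1]` represent degree `q`; it is the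
  -- target of the augmentation from the `q`-th translate, which the quotient inverts.
  obtain ⟨X, hX⟩ := exists_totalization hS hT N R hR (q - 1) q (by ring)
  obtain ⟨e, he⟩ := X.exists_addEquiv E
  have hu : verdierW S ((toHo P).map X.u) := ⟨X.u, rfl, hX⟩
  have : IsIso ((verdierW S).Q.map ((toHo P).map X.u)) := (verdierW S).Q_inverts _ hu
  have hloc := bijective_toVerdier_map hS hO ((toHo P).obj E) ((isInj_shiftObj_iff X.J).2 X.isInj)
  let g : (E ⟶ X.J.shiftObj) →+
      ((toVerdier S).obj E ⟶ (toVerdier S).obj ((shiftPow P q).obj (R.G 0))) :=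
    { toFun := fun f => (verdierW S).Q.map ((toHo P).map f) ≫
        inv ((verdierW S).Q.map ((toHo P).map X.u))
      map_zero' := by rw [Functor.map_zero, Functor.map_zero, zero_comp]
      map_add' := fun f f' => by rw [Functor.map_add, Functor.map_add, Preadditive.add_comp] }
  refine ⟨g.comp e.toAddMonoidHom, ?_, fun x => ?_⟩
  · refine Function.Surjective.comp (g := g) (fun φ => ?_) e.surjective
    obtain ⟨f, hf⟩ := hloc.2 (φ ≫ (verdierW S).Q.map ((toHo P).map X.u))
    obtain ⟨f, rfl⟩ := (toHo P).map_surjective f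
    exact ⟨f, (IsIso.comp_inv_eq _).2 hf⟩
  · rw [← he x]
    change (verdierW S).Q.map ((toHo P).map (e x)) ≫ inv _ = 0 ↔ _
    constructor
    · intro hx
      refine hloc.1 ?_
      rw [IsIso.comp_inv_eq, zero_comp] at hx
      exact hx.trans ((verdierW S).Q.map_zero _ _).symm
    · intro hx
      rw [hx, Functor.map_zero, zero_comp]

-- In degree `q`, filtration index at most `p` means `n ≤ p + q`. So the filtration is zero for `p +
-- q < 0`, and is everything for `p + q ≥ N`, the terms `I n` with `n ≥ N` being zero.
include hT hO in
lemma stronglyConvergesTo_verdierQuotient {N : ℕ} (hR : R.IsBounded N) (E : Factorization P) :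
    letI := hS.preadditive
    StronglyConvergesTo (R.filtDiff E).spectralSequence
      (fun q => (toVerdier S).obj E ⟶ (toVerdier S).obj ((shiftPow P q).obj (R.G 0))) := by
  let := hS.preadditive
  choose f hf hf' using fun q => exists_addMonoidHom hS hT hO hR E q
  refine (R.filtDiff E).stronglyConvergesTo (R.totDeg E) (fun p q x hx n m h => hx n m (Or.inl h))
    0 N (fun p q h => ?_) (fun p q h => ?_) _ f hf hf'
  · refine (AddSubgroup.eq_bot_iff_forall _).2 fun x hx => ?_
    funext n m
    exact R.mem_F.1 hx n m (by lia)
  · refine le_antisymm (fun x hx n m h => hx n m (Or.inl h)) fun x hx => R.mem_F.2 fun n m hnm => ?_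
    by_cases hn : n + m = q
    · have hI : IsZero (R.I n) :=
        isZero_of_isZero_components (hR.3 n (by lia)) (hR.4 n (by lia))
      exact Gr.eq_of_isZero_tgt ((shiftPow P m).map_isZero hI) _ _
    · exact hx n m hn

end InjRes

/-! ### The components of the translates -/

lemma nonempty_shiftPow_even_iso (F : Factorization P) (s : ℤ) :
    Nonempty (((shiftPow P (-(2 * s))).obj F).Xm ≅ (P.Φ ^ (-s)).functor.obj F.Xm) ∧
    Nonempty (((shiftPow P (-(2 * s))).obj F).X0 ≅ (P.Φ ^ (-s)).functor.obj F.X0) := by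
  obtain ⟨⟨e⟩, ⟨e'⟩⟩ := nonempty_shiftPow_evm_ev0_iso (P := P) (-s)
  have h : -(2 * s) = 2 * (-s) := by ring
  rw [h]
  exact ⟨⟨e.app F⟩, ⟨e'.app F⟩⟩

/-- Writing `-(2 * s + 1) = 2 * (-s - 1) + 1`, the extra `[1]` exchanges the components and applies
`Φ` to the one coming from `F⁻¹`, raising its exponent to `-s`. -/
lemma nonempty_shiftPow_odd_iso (F : Factorization P) (s : ℤ) :
    Nonempty (((shiftPow P (-(2 * s + 1))).obj F).Xm ≅ (P.Φ ^ (-s - 1)).functor.obj F.X0) ∧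
    Nonempty (((shiftPow P (-(2 * s + 1))).obj F).X0 ≅ (P.Φ ^ (-s)).functor.obj F.Xm) := by
  obtain ⟨⟨e⟩, ⟨e'⟩⟩ := nonempty_shiftPow_evm_ev0_iso (P := P) (-s - 1)
  obtain ⟨k⟩ := P.Φ.nonempty_pow_comp_iso (-s - 1) (-s) (by ring)
  let i := τ (2 * (-s - 1)) (-(2 * s + 1)) (by ring) F
  exact ⟨⟨(evm P).mapIso i.symm ≪≫ e'.app F⟩,
    ⟨(ev0 P).mapIso i.symm ≪≫ P.T.mapIso (e.app F) ≪≫ k.app F.Xm⟩⟩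

end Factorization
end

/-! ### The spectral sequence and its convergence in both quotients. -/

theorem mainTheorem7 {C : Type u} [Category.{v} C] [Abelian C] [EnoughInjectives C]
    [HasCoproducts.{v} C]
    (hC : ∀ (ι : Type v) (X : ι → C), (∀ i, Injective (X i)) → Injective (∐ X))
    (P : Potential C) (E F : Factorization P) :
    ∃ S : FiltSpectralSequence.{max u v},
      (∀ s q : ℤ, Nonempty ((S.page 1).X (2 * s, q) ≅ AddCommGrpCat.of
        (extGroup E.Xm ((P.Φ ^ (-s)).functor.obj F.Xm) (2 * s + q) ×
          extGroup E.X0 ((P.Φ ^ (-s)).functor.obj F.X0) (2 * s + q)))) ∧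
      (∀ s q : ℤ, Nonempty ((S.page 1).X (2 * s + 1, q) ≅ AddCommGrpCat.of
        (extGroup E.Xm ((P.Φ ^ (-s - 1)).functor.obj F.X0) (2 * s + 1 + q) ×
          extGroup E.X0 ((P.Φ ^ (-s)).functor.obj F.Xm) (2 * s + 1 + q)))) ∧
      ((∃ n : ℕ, HasInjectiveDimensionLT F.Xm n) → (∃ n : ℕ, HasInjectiveDimensionLT F.X0 n) →
        StronglyConvergesTo S (fun r => Factorization.HomCo E F r) ∧
        StronglyConvergesTo S (fun r => Factorization.HomAbs E F r)) := by
  -- A single resolution serves every claim: it exists for any `F`, and the construction makes it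
  -- bounded when the injective dimensions are finite.
  obtain ⟨R, rfl, hR⟩ := Factorization.exists_injRes F
  refine ⟨(R.filtDiff E).spectralSequence, fun s q => ?_, fun s q => ?_, fun h h' => ?_⟩
  · obtain ⟨⟨e⟩, ⟨e'⟩⟩ := Factorization.nonempty_shiftPow_even_iso (R.G 0) s
    obtain ⟨i⟩ := R.nonempty_addEquiv_extGroup_prod (E := E) (2 * s) q e e'
    exact ⟨i.toAddCommGrpIso⟩
  · obtain ⟨⟨e⟩, ⟨e'⟩⟩ := Factorization.nonempty_shiftPow_odd_iso (R.G 0) s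
    obtain ⟨i⟩ := R.nonempty_addEquiv_extGroup_prod (E := E) (2 * s + 1) q e e'
    exact ⟨i.toAddCommGrpIso⟩
  · obtain ⟨N, hN⟩ := hR h h'
    exact ⟨Factorization.InjRes.stronglyConvergesTo_verdierQuotient
        Factorization.isThick_coacycl (fun T hT S _ hS _ => hS T hT)
        Factorization.coacycl_le_orth hN E,
      Factorization.InjRes.stronglyConvergesTo_verdierQuotient
        Factorization.isThick_acycl (fun T hT S _ hS => hS T hT)
        Factorization.acycl_le_orth hN E⟩
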